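/- Let $H$ be a separable complex Hilbert space, $B(H)$ the Banach space of bounded operators on $H$ (regarded as a real Banach space), and $P(H)\subset B(H)$ the set of orthogonal projections. For a closed subspace $S\subseteq H$ let $P_S$ be the orthogonal projection onto $S$. Two closed subspaces $S,T$ have a common complement if there is a closed subspace $Z$ with $S\dotplus Z=T\dotplus Z=H$. Let $$\Gamma=\{(P_S,P_T)\in P(H)\times P(H): S,T\text{ have no common complement}\}.$$ For $0\le i,j\le\infty$ let $P_{i,j}$ be the set of orthogonal projections of rank $i$ and corank $j$. Let $\Gamma_{\infty,\infty}=\Gamma\cap(P_{\infty,\infty}\times P_{\infty,\infty})$, and - for $n\in\mathbb Z$, let $\Gamma_1^n$ be the set of $(P_S,P_T)\in\Gamma_{\infty,\infty}$ with $\dim (S\cap T^\perp)<\infty$, $\dim (S^\perp\cap T)<\infty$, such that $P_T|_S:S\to T$ is a Fredholm operator of index $n$; - $\Gamma_\infty^l=\{(P_S,P_T)\in\Gamma_{\infty,\infty}:\dim (S\cap T^\perp)<\infty,\ \dim (S^\perp\cap T)=\infty\}$; - $\Gamma_\infty^r=\{(P_S,P_T)\in\Gamma_{\infty,\infty}:\dim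 (S\cap T^\perp)=\infty,\ \dim (S^\perp\cap T)<\infty\}$. For subsets $M\subseteq N$ of a real Banach space $E$, call $M$ a $C^\infty$ submanifold of $N$ if around every $x\in M$ there is a $C^\infty$ diffeomorphism $\varphi:U\to V$ between open subsets of $E$, $x\in U$, and closed subspaces $F\subseteq G$ of $E$ with $\varphi(U\cap M)=V\cap F$ and $\varphi(U\cap N)=V\cap G$; it is complemented at $x$ if this can be done with $F$ complemented in $G$. (For $N=E$ one has $G=E$.) Then: 1. $\Gamma$ is closed in $B(H)\times B(H)$. 2. $\Gamma$ is the disjoint union of the sets $P_{i,j}\times P_{k,l}$ with $(i,j)\ne(k,l)$, the sets $\Gamma_1^n$ with $n\neq0$, and the sets $\Gamma_\infty^l$ and $\Gamma_\infty^r$; each of these pieces is relatively open in $\Gamma$. 3. $\Gamma$ and each of these pieces are $C^\infty$ submanifolds of $B(H)\times B(H)$ and of $P(H)\times P(H)$. 4. These submanifolds are non complemented: at every point of $\Gamma_1^n$ ($n\ne0$), of $\Gamma_\infty^l$ and of $\Gamma_\infty^r$, neither $\Gamma$ nor the piece is complemented, either in $B(H)\times B(H)$ or in $P(H)\times P(H)$.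 In particular, if $\dim H=\infty$, then $\Gamma$ is not a complemented submanifold of either of them. -/

import Mathlib

open scoped ContDiff

noncomputable section

/-! ### Submanifolds of Banach spaces, not assumed to be complemented -/

namespace BanachSub

variable {E : Type*} [NormedAddCommGroup E] [NormedSpace ℝ E]

/-- `φ` is a `C^∞` diffeomorphism between open subsets of `E`, defined around `x`, which
carries `N` to the closed subspace `G` and `M` to the closed subspace `F ⊆ G`
(inside the domain of `φ`). -/
structure IsFlattening (M N : Set E) (x : E) (φ : OpenPartialHomeomorph E E)
    (F G : Submodule ℝ E) : Prop where
  mem_source : x ∈ φ.source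
  contDiffOn : ContDiffOn ℝ ∞ φ φ.source
  contDiffOn_symm : ContDiffOn ℝ ∞ φ.symm φ.target
  isClosed_left : IsClosed (F : Set E)
  isClosed_right : IsClosed (G : Set E)
  le : F ≤ G
  mem_left_iff : ∀ y ∈ φ.source, y ∈ M ↔ φ y ∈ F
  mem_right_iff : ∀ y ∈ φ.source, y ∈ N ↔ φ y ∈ G

/-- `M` is a `C^∞` submanifold of `N ⊆ E`: around each point of `M` there is a chart of `E` adapted
to both `M` and `N`. No complement of the model subspace is required. For `N = Set.univ` the
subspace `G` is all of `E`, and this says that `M` is a submanifold of the Banach space `E`. -/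
def IsSubmanifoldOf (M N : Set E) : Prop :=
  M ⊆ N ∧ ∀ x ∈ M, ∃ (φ : OpenPartialHomeomorph E E) (F G : Submodule ℝ E),
    IsFlattening M N x φ F G

/-- `M` is a complemented submanifold of `N` near `x`: there is an adapted chart around `x` whose
model subspace `F` of `M` has a closed complement in the model subspace `G` of `N`. -/
def IsComplementedAt (M N : Set E) (x : E) : Prop :=
  ∃ (φ : OpenPartialHomeomorph E E) (F G : Submodule ℝ E),
    IsFlattening M N x φ F G ∧ (F.comap G.subtype).ClosedComplemented

end BanachSub

/-! ### Pairs of closed subspaces, as pairs of orthogonal projections -/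

namespace CommonCompl

section

variable {H : Type*} [NormedAddCommGroup H] [InnerProductSpace ℂ H]

/-- Two subspaces have a common (closed) complement. -/
def HasCommonComplement (S T : Submodule ℂ H) : Prop :=
  ∃ Z : Submodule ℂ H, IsClosed (Z : Set H) ∧ IsCompl S Z ∧ IsCompl T Z

/-- The dimension of a subspace, in `{0, 1, …, ∞}`. -/
def dim (S : Submodule ℂ H) : ℕ∞ :=
  Cardinal.toENat (Module.rank ℂ S)

/-- For operators `P`, `Q`, the operator `Q|_{R(P)} : R(P) → R(Q)`. -/
def restr (P Q : H →L[ℂ] H) : P.range →L[ℂ] Q.range :=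
  (Q.comp P.range.subtypeL).codRestrict Q.range fun x => ⟨(x : H), rfl⟩

/-- The index of a Fredholm operator: dimension of the kernel minus dimension of the cokernel. -/
def index {X Y : Type*} [NormedAddCommGroup X] [NormedSpace ℂ X] [NormedAddCommGroup Y]
    [NormedSpace ℂ Y] (A : X →L[ℂ] Y) : ℤ :=
  (Module.finrank ℂ A.ker : ℤ) - (Module.finrank ℂ (Y ⧸ A.range) : ℤ)

end

variable (H : Type*) [NormedAddCommGroup H] [InnerProductSpace ℂ H] [CompleteSpace H]

/-- `P(H) × P(H)`: the pairs of orthogonal projections. -/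
def projPairs : Set ((H →L[ℂ] H) × (H →L[ℂ] H)) :=
  {p | IsStarProjection p.1 ∧ IsStarProjection p.2}

/-- `P_{i,j}`: the orthogonal projections of rank `i` and corank `j`. -/
def projOfRank (i j : ℕ∞) : Set (H →L[ℂ] H) :=
  {P | IsStarProjection P ∧ dim P.range = i ∧ dim P.rangeᗮ = j}

/-- `Γ`: the pairs `(P_S, P_T)` such that `S` and `T` have no common complement. -/
def Gam : Set ((H →L[ℂ] H) × (H →L[ℂ] H)) :=
  {p | p ∈ projPairs H ∧ ¬ HasCommonComplement p.1.range p.2.range}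

/-- The pairs in `Γ` of projections of infinite rank and corank. -/
def GamInfInf : Set ((H →L[ℂ] H) × (H →L[ℂ] H)) :=
  Gam H ∩ projOfRank H ⊤ ⊤ ×ˢ projOfRank H ⊤ ⊤

/-- `Γ_1`: the dimensions of `S ∩ T^⊥` and of `S^⊥ ∩ T` are both finite. -/
def Gam1 : Set ((H →L[ℂ] H) × (H →L[ℂ] H)) :=
  {p | p ∈ GamInfInf H ∧ dim (p.1.range ⊓ p.2.rangeᗮ) < ⊤ ∧ dim (p.1.rangeᗮ ⊓ p.2.range) < ⊤}

/-- `Γ_1^n`: the pairs in `Γ_1` for which `P_T|_S : S → T` is Fredholm of index `n`. -/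
def Gam1n (n : ℤ) : Set ((H →L[ℂ] H) × (H →L[ℂ] H)) :=
  {p | p ∈ Gam1 H ∧ (restr p.1 p.2).IsFredholm ∧ index (restr p.1 p.2) = n}

/-- `Γ_∞^l`: `dim S ∩ T^⊥ < ∞` and `dim S^⊥ ∩ T = ∞`. -/
def GamInfL : Set ((H →L[ℂ] H) × (H →L[ℂ] H)) :=
  {p | p ∈ GamInfInf H ∧ dim (p.1.range ⊓ p.2.rangeᗮ) < ⊤ ∧ dim (p.1.rangeᗮ ⊓ p.2.range) = ⊤}

/-- `Γ_∞^r`: `dim S ∩ T^⊥ = ∞` and `dim S^⊥ ∩ T < ∞`. -/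
def GamInfR : Set ((H →L[ℂ] H) × (H →L[ℂ] H)) :=
  {p | p ∈ GamInfInf H ∧ dim (p.1.range ⊓ p.2.rangeᗮ) = ⊤ ∧ dim (p.1.rangeᗮ ⊓ p.2.range) < ⊤}

/-- The labels of the pieces of `Γ`. -/
inductive PieceIndex : Type
  | full (i j k l : ℕ∞) (h : (i, j) ≠ (k, l)) : PieceIndex
  | fredholm (n : ℤ) (h : n ≠ 0) : PieceIndex
  | left : PieceIndex
  | right : PieceIndex

/-- The pieces of `Γ`. -/
def piece : PieceIndex → Set ((H →L[ℂ] H) × (H →L[ℂ] H))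
  | .full i j k l _ => projOfRank H i j ×ˢ projOfRank H k l
  | .fredholm n _ => Gam1n H n
  | .left => GamInfL H
  | .right => GamInfR H

end CommonCompl

end

/-! Write S, T for the ranges of projections P, Q. For 0 < δ < 1 let E be a spectral projection of
(P - Q)² cutting at δ²; it commutes with P and Q. On the kernel of E the norm of P - Q is at most δ
< 1, so P maps that part of T isomorphically onto that part of S. On the range of E the operator P -
Q is invertible, so ran E is the direct sum of S ∩ ran E and T ∩ ran E; if these have equal
dimension, the graph of an isomorphism between them is a common complement there
(`Reduces.hasCommonComplement`). Conversely, a common complement forces these dimensions to agree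
once δ is small (`HasCommonComplement.exists_reduces`).

Hence outside common complements at least one of the two dimensions is finite for every δ, which
makes (1 - Q)P or (1 - P)Q compact, being a norm limit of finite-rank operators. If (1 - Q)P is
compact, an index formula compares dim (S ∩ T^⊥) - dim (S^⊥ ∩ T) with dim (S ∩ ran E) - dim (T ∩ ran
E), and the latter also computes the former for all nearby pairs (`Reduces.eventually_index`). So a
common complement exists exactly when this index vanishes, the pieces are relatively open, and near
such a point of Γ a pair of projections belongs to Γ exactly when (1 - Q)P is compact
(`eventually_mem_gam_iff`).

Compactness is membership in a closed ideal J. Projections near p are projections onto graphs of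
elements k of the corner (1 - p)A p. In graph coordinates (k, l) the condition (1 - Y)X ∈ J becomes
(1 - q - l)(p + k) ∈ J, and a shear straightens it to the linear condition (1 - q)k ∈ J
(`exists_isFlattening`). At pairs of unequal dimension data, J is the whole algebra.

The model is not complemented for the reason that c₀ is not complemented in ℓ^∞. Diagonal operators
embed ℓ^∞ in the ambient corner, and finitely supported sequences land in the model. A projection
would give an operator on ℓ^∞ vanishing on finitely supported sequences, with values separated by
countably many functionals; an almost disjoint family shows that it kills the indicator of some
infinite set. The corresponding diagonal operator would then be compact, which it is not.
Derivatives of transition maps show that this obstruction does not depend on the chart. -/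

noncomputable section

/-! ### Adapted charts, and independence of complementation from the chart. -/

namespace BanachSub

open Topology Filter

variable {E : Type*} [NormedAddCommGroup E] [NormedSpace ℝ E]

/-- A flattening restricts to an open neighbourhood, and only depends on `M` and `N` there. -/
theorem IsFlattening.restrOpen {M N M' N' : Set E} {x : E} {φ : OpenPartialHomeomorph E E}
    {F G : Submodule ℝ E} (h : IsFlattening M N x φ F G) {U : Set E} (hU : IsOpen U) (hx : x ∈ U)
    (hM : ∀ y ∈ U, y ∈ M' ↔ y ∈ M) (hN : ∀ y ∈ U, y ∈ N' ↔ y ∈ N) :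
    IsFlattening M' N' x (φ.restrOpen U hU) F G where
  mem_source := ⟨h.mem_source, hx⟩
  contDiffOn := h.contDiffOn.mono fun _ hy => hy.1
  contDiffOn_symm := h.contDiffOn_symm.mono fun _ hy => hy.1
  isClosed_left := h.isClosed_left
  isClosed_right := h.isClosed_right
  le := h.le
  mem_left_iff y hy := (hM y hy.2).trans (h.mem_left_iff y hy.1)
  mem_right_iff y hy := (hN y hy.2).trans (h.mem_right_iff y hy.1)

/-- Lets one chart adapted to both Γ and the pairs of projections also serve for Γ inside the whole
Banach space. -/
theorem IsFlattening.univ {M N : Set E} {x : E} {φ : OpenPartialHomeomorph E E}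
    {F G : Submodule ℝ E} (h : IsFlattening M N x φ F G) :
    IsFlattening M Set.univ x φ F ⊤ where
  mem_source := h.mem_source
  contDiffOn := h.contDiffOn
  contDiffOn_symm := h.contDiffOn_symm
  isClosed_left := h.isClosed_left
  isClosed_right := isClosed_univ
  le := le_top
  mem_left_iff := h.mem_left_iff
  mem_right_iff _ _ := by simp

/-- Conjugation of a flattening by a linear isomorphism of the ambient space. -/
theorem IsFlattening.conj {M N : Set E} {x : E} {φ : OpenPartialHomeomorph E E}
    {F G : Submodule ℝ E} (h : IsFlattening M N x φ F G) (e : E ≃L[ℝ] E) :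
    IsFlattening (e ⁻¹' M) (e ⁻¹' N) (e.symm x)
      ((e.toHomeomorph.toOpenPartialHomeomorph.trans φ).trans
        e.symm.toHomeomorph.toOpenPartialHomeomorph)
      (F.comap (e : E →ₗ[ℝ] E)) (G.comap (e : E →ₗ[ℝ] E)) where
  mem_source := by simpa using h.mem_source
  contDiffOn := by
    have h1 : ContDiffOn ℝ ∞ (fun y => φ (e y)) (e ⁻¹' φ.source) :=
      h.contDiffOn.comp e.contDiff.contDiffOn fun y hy => hy
    refine (e.symm.contDiff.comp_contDiffOn h1).mono ?_
    intro y hy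
    simpa using hy
  contDiffOn_symm := by
    have h1 : ContDiffOn ℝ ∞ (fun y => φ.symm (e y)) (e ⁻¹' φ.target) :=
      h.contDiffOn_symm.comp e.contDiff.contDiffOn fun y hy => hy
    refine (e.symm.contDiff.comp_contDiffOn h1).mono ?_
    intro y hy
    simpa using hy
  isClosed_left := h.isClosed_left.preimage e.continuous
  isClosed_right := h.isClosed_right.preimage e.continuous
  le := Submodule.comap_mono h.le
  mem_left_iff y hy := by
    have hy' : e y ∈ φ.source := by simpa using hy
    simpa using h.mem_left_iff (e y) hy'
  mem_right_iff y hy := by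
    have hy' : e y ∈ φ.source := by simpa using hy
    simpa using h.mem_right_iff (e y) hy'

theorem IsComplementedAt.congr {M N M' : Set E} {x : E} (h : IsComplementedAt M N x) {U : Set E}
    (hU : IsOpen U) (hx : x ∈ U) (hM : ∀ y ∈ U, y ∈ M' ↔ y ∈ M) : IsComplementedAt M' N x := by
  obtain ⟨φ, F, G, h, hc⟩ := h
  exact ⟨_, F, G, h.restrOpen hU hx hM fun _ _ => Iff.rfl, hc⟩

theorem IsSubmanifoldOf.inter_open {M N U : Set E} (h : IsSubmanifoldOf M N) (hU : IsOpen U) :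
    IsSubmanifoldOf (M ∩ U) N := by
  refine ⟨fun y hy => h.1 hy.1, fun x hx => ?_⟩
  obtain ⟨φ, F, G, hf⟩ := h.2 x hx.1
  exact ⟨_, F, G, hf.restrOpen hU hx.2 (fun y hy => ⟨fun h => h.1, fun h => ⟨h, hy⟩⟩)
    fun _ _ => Iff.rfl⟩

/-- If a map sends `F` to the closed subspace `F'` near `a ∈ F`, then so does its derivative. -/
theorem map_mem_of_hasFDerivAt {E' : Type*} [NormedAddCommGroup E'] [NormedSpace ℝ E']
    {f : E → E'} {L : E →L[ℝ] E'} {a : E}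
    (hf : HasFDerivAt f L a) {F : Submodule ℝ E} {F' : Submodule ℝ E'}
    (hF' : IsClosed (F' : Set E'))
    (ha : a ∈ F) (h : ∀ᶠ y in 𝓝 a, y ∈ F → f y ∈ F') {v : E} (hv : v ∈ F) : L v ∈ F' := by
  have h1 : HasDerivAt (fun t : ℝ => a + t • v) v 0 := by
    simpa using ((hasDerivAt_id (0 : ℝ)).smul_const v).const_add a
  have h2 : HasDerivAt (fun t : ℝ => f (a + t • v)) (L v) 0 := by
    have h3 : HasFDerivAt f L (a + (0 : ℝ) • v) := by simpa using hf
    exact h3.comp_hasDerivAt (0 : ℝ) h1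
  rw [hasDerivAt_iff_tendsto_slope] at h2
  refine hF'.mem_of_tendsto h2 ?_
  have hc : Tendsto (fun t : ℝ => a + t • v) (𝓝 0) (𝓝 a) := by
    simpa using h1.continuousAt.tendsto
  filter_upwards [(hc.eventually h).filter_mono nhdsWithin_le_nhds] with t ht
  have ha' : f a ∈ F' := h.self_of_nhds ha
  rw [slope_def_module]
  refine F'.smul_mem _ (F'.sub_mem (ht (F.add_mem ha (F.smul_mem _ hv))) ?_)
  simpa using ha'

/-- The model pair of a flattening is unique up to linear isomorphism. -/
theorem IsFlattening.exists_equiv {M N : Set E} {x : E} (hx : x ∈ M) (hMN : M ⊆ N)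
    {φ ψ : OpenPartialHomeomorph E E} {F G F' G' : Submodule ℝ E} (h : IsFlattening M N x φ F G)
    (h' : IsFlattening M N x ψ F' G') :
    ∃ L L' : E →L[ℝ] E, (∀ v, L' (L v) = v) ∧ (∀ v, L (L' v) = v) ∧ (∀ v ∈ F, L v ∈ F') ∧
      (∀ v ∈ F', L' v ∈ F) ∧ (∀ v ∈ G, L v ∈ G') ∧ (∀ v ∈ G', L' v ∈ G) := by
  -- Near `φ x` the transition map carries `F` into `F'` and `G` into `G'`; both targets are closed,
  -- so its derivative does too. The reverse transition supplies the inverse of this derivative.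
  have key : ∀ {φ ψ : OpenPartialHomeomorph E E} {F G F' G' : Submodule ℝ E}
      (_ : IsFlattening M N x φ F G) (_ : IsFlattening M N x ψ F' G'),
      ∃ L : E →L[ℝ] E, HasFDerivAt (fun y => ψ (φ.symm y)) L (φ x) ∧ (∀ v ∈ F, L v ∈ F') ∧
        (∀ v ∈ G, L v ∈ G') := by
    intro φ ψ F G F' G' h h'
    have hxt : φ x ∈ φ.target := φ.map_source h.mem_source
    have hs : φ.symm (φ x) = x := φ.left_inv h.mem_source
    have hcs : ContDiffAt ℝ ∞ φ.symm (φ x) :=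
      h.contDiffOn_symm.contDiffAt (φ.open_target.mem_nhds hxt)
    have hd : DifferentiableAt ℝ (fun y => ψ (φ.symm y)) (φ x) := by
      have h1 : DifferentiableAt ℝ φ.symm (φ x) := hcs.differentiableAt (by simp)
      have h2 : DifferentiableAt ℝ ψ (φ.symm (φ x)) := by
        rw [hs]
        exact (h'.contDiffOn.contDiffAt (ψ.open_source.mem_nhds h'.mem_source)).differentiableAt
          (by simp)
      exact h2.comp (φ x) h1
    have hnear : ∀ᶠ y in 𝓝 (φ x), y ∈ φ.target ∧ φ.symm y ∈ ψ.source := by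
      refine (φ.open_target.eventually_mem hxt).and (hcs.continuousAt.eventually ?_)
      rw [hs]
      exact ψ.open_source.mem_nhds h'.mem_source
    refine ⟨_, hd.hasFDerivAt, fun v hv => ?_, fun v hv => ?_⟩
    · refine map_mem_of_hasFDerivAt hd.hasFDerivAt h'.isClosed_left
        ((h.mem_left_iff x h.mem_source).1 hx) ?_ hv
      filter_upwards [hnear] with y hy hyF
      refine (h'.mem_left_iff _ hy.2).1 ((h.mem_left_iff _ (φ.map_target hy.1)).2 ?_)
      rwa [φ.right_inv hy.1]
    · refine map_mem_of_hasFDerivAt hd.hasFDerivAt h'.isClosed_right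
        ((h.mem_right_iff x h.mem_source).1 (hMN hx)) ?_ hv
      filter_upwards [hnear] with y hy hyF
      refine (h'.mem_right_iff _ hy.2).1 ((h.mem_right_iff _ (φ.map_target hy.1)).2 ?_)
      rwa [φ.right_inv hy.1]
  have inv : ∀ {φ ψ : OpenPartialHomeomorph E E} {L L' : E →L[ℝ] E}, x ∈ φ.source → x ∈ ψ.source →
      ContinuousAt φ.symm (φ x) →
      HasFDerivAt (fun y => ψ (φ.symm y)) L (φ x) → HasFDerivAt (fun y => φ (ψ.symm y)) L' (ψ x) →
      ∀ v, L' (L v) = v := by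
    intro φ ψ L L' hφ hψ hc hL hL' v
    have hs : φ.symm (φ x) = x := φ.left_inv hφ
    have hL'' : HasFDerivAt (fun y => φ (ψ.symm y)) L' (ψ (φ.symm (φ x))) := by rwa [hs]
    have h1 := HasFDerivAt.comp (φ x) hL'' hL
    have h2 : HasFDerivAt (fun y : E => y) (ContinuousLinearMap.id ℝ E) (φ x) := hasFDerivAt_id _
    have h3 : ((fun y => φ (ψ.symm y)) ∘ fun y => ψ (φ.symm y)) =ᶠ[𝓝 (φ x)] fun y => y := by
      have : ∀ᶠ y in 𝓝 (φ x), φ.symm y ∈ ψ.source := by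
        refine hc.eventually ?_
        rw [hs]
        exact ψ.open_source.mem_nhds hψ
      filter_upwards [this, φ.open_target.mem_nhds (φ.map_source hφ)] with y hy hy'
      simp [ψ.left_inv hy, φ.right_inv hy']
    have h4 := h1.unique (h2.congr_of_eventuallyEq h3)
    exact DFunLike.congr_fun h4 v
  obtain ⟨L, hL, hF, hG⟩ := key h h'
  obtain ⟨L', hL', hF', hG'⟩ := key h' h
  have cφ := φ.symm.continuousAt (φ.map_source h.mem_source)
  have cψ := ψ.symm.continuousAt (ψ.map_source h'.mem_source)
  exact ⟨L, L', inv h.mem_source h'.mem_source cφ hL hL',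
    inv h'.mem_source h.mem_source cψ hL' hL, hF, hF', hG, hG'⟩

/-- Whether a submanifold is complemented can be tested in a single flattening. -/
theorem IsComplementedAt.closedComplemented {M N : Set E} {x : E} (hx : x ∈ M) (hMN : M ⊆ N)
    {ψ : OpenPartialHomeomorph E E} {F' G' : Submodule ℝ E} (h' : IsFlattening M N x ψ F' G')
    (hc : IsComplementedAt M N x) : ∃ π : G' →L[ℝ] F', ∀ v (hv : v ∈ F'),
      π ⟨v, h'.le hv⟩ = ⟨v, hv⟩ := by
  obtain ⟨φ, F, G, h, π, hπ⟩ := hc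
  obtain ⟨L, L', hLL, hLL', hF, hF', hG, hG'⟩ := h.exists_equiv hx hMN h'
  let a : G' →L[ℝ] G := (L'.comp G'.subtypeL).codRestrict G fun v => hG' v v.2
  let b : (F.comap G.subtype) →L[ℝ] F' :=
    (L.comp (G.subtypeL.comp (F.comap G.subtype).subtypeL)).codRestrict F' fun v => hF _ v.2
  refine ⟨b.comp (π.comp a), fun v hv => ?_⟩
  have h1 : π (a ⟨v, h'.le hv⟩) = ⟨⟨L' v, hG' v (h'.le hv)⟩, hF' v hv⟩ :=
    hπ ⟨⟨L' v, hG' v (h'.le hv)⟩, hF' v hv⟩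
  ext
  simp only [ContinuousLinearMap.comp_apply, h1]
  exact hLL' v

end BanachSub
end

noncomputable section

/-! ### An explicit chart flattening the projections of a C*-algebra -/

namespace ProjChart

variable {A : Type*} [CStarAlgebra A]

theorem commute_ringInverse {a b : A} (h : Commute a b) : Commute a (Ring.inverse b) := by
  by_cases hb : IsUnit b
  · obtain ⟨u, rfl⟩ := hb
    rw [Ring.inverse_unit]
    exact h.units_inv_right
  · rw [Ring.inverse_non_unit _ hb]
    exact Commute.zero_right a

/-- The off-diagonal corner `(1 - p) A p`. -/
def corner (p : A) : Submodule ℝ A where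
  carrier := {W | (1 - p) * W * p = W}
  add_mem' {a b} ha hb := by
    simp only [Set.mem_ofPred_eq] at *
    rw [mul_add, add_mul, ha, hb]
  zero_mem' := by simp
  smul_mem' c a ha := by
    simp only [Set.mem_ofPred_eq] at *
    rw [mul_smul_comm, smul_mul_assoc, ha]

theorem mem_corner {p W : A} : W ∈ corner p ↔ (1 - p) * W * p = W := Iff.rfl

theorem isClosed_corner (p : A) : IsClosed (corner p : Set A) :=
  isClosed_eq (by fun_prop) continuous_id

theorem corner_mul {p k : A} (hp : IsIdempotentElem p) (hk : k ∈ corner p) : k * p = k := by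
  rw [mem_corner] at hk
  rw [← hk, mul_assoc, hp.eq]

theorem mul_corner {p k : A} (hp : IsIdempotentElem p) (hk : k ∈ corner p) : p * k = 0 := by
  rw [mem_corner] at hk
  rw [← hk, ← mul_assoc, ← mul_assoc, mul_sub, mul_one, hp.eq, sub_self, zero_mul, zero_mul]

theorem mem_corner_iff {p k : A} (hp : IsIdempotentElem p) :
    k ∈ corner p ↔ p * k = 0 ∧ k * p = k := by
  refine ⟨fun h => ⟨mul_corner hp h, corner_mul hp h⟩, fun h => ?_⟩
  rw [mem_corner, sub_mul, h.1, one_mul, sub_zero, h.2]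

theorem compress_mem_corner {p : A} (hp : IsIdempotentElem p) (X : A) :
    (1 - p) * X * p ∈ corner p := by
  rw [mem_corner, ← mul_assoc, ← mul_assoc, hp.one_sub.eq, mul_assoc, hp.eq]

/-- The orthogonal projection onto the graph of `k`, for `k` in the corner of `p`. -/
def graphProj (p k : A) : A := (p + k) * Ring.inverse (1 + star k * k) * (p + star k)

/-- The element `k` whose graph is the range of `X * p`. -/
def slope (p X : A) : A := (1 - p) * X * p * Ring.inverse (p * X * p + (1 - p))

/-- The inverse chart. -/
def unflat (p W : A) : A :=
  graphProj p ((1 - p) * W * p) + (W - (1 - p) * W * p) + (1 - p) * W * p * (W * p)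

/-- The chart. -/
def flat (p X : A) : A :=
  slope p X + ((X - graphProj p (slope p X)) - (1 - p) * (X - graphProj p (slope p X)) * p)

variable {p k : A}

theorem mul_inverse_comm (hp : IsStarProjection p) (hk : k ∈ corner p) :
    p * Ring.inverse (1 + star k * k) = Ring.inverse (1 + star k * k) * p := by
  have h1 : k * p = k := corner_mul hp.isIdempotentElem hk
  have h2 : p * star k = star k := by
    rw [← hp.isSelfAdjoint.star_eq, ← star_mul, h1]
  have : Commute p (1 + star k * k) := by
    rw [Commute, SemiconjBy, mul_add, add_mul, ← mul_assoc, h2, mul_assoc (star k), h1]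
    simp
  exact commute_ringInverse this

theorem corner_star (hp : IsStarProjection p) (hk : k ∈ corner p) :
    p * star k = star k ∧ star k * p = 0 := by
  have h1 : k * p = k := corner_mul hp.isIdempotentElem hk
  have h2 : p * k = 0 := mul_corner hp.isIdempotentElem hk
  constructor
  · rw [← hp.isSelfAdjoint.star_eq, ← star_mul, h1]
  · rw [← hp.isSelfAdjoint.star_eq, ← star_mul, h2, star_zero]

theorem slope_mem_corner (hp : IsStarProjection p) (X : A) : slope p X ∈ corner p := by
  have hc : Commute p (p * X * p + (1 - p)) := by
    rw [Commute, SemiconjBy, mul_add, add_mul, mul_sub, sub_mul, mul_assoc (p * X),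
      hp.isIdempotentElem.eq, ← mul_assoc, ← mul_assoc, hp.isIdempotentElem.eq]
    simp
  have hc' := commute_ringInverse hc
  rw [mem_corner_iff hp.isIdempotentElem]
  constructor
  · rw [slope, ← mul_assoc, mul_corner hp.isIdempotentElem
      (compress_mem_corner hp.isIdempotentElem X), zero_mul]
  · rw [slope, mul_assoc, ← hc'.eq, ← mul_assoc, corner_mul hp.isIdempotentElem
      (compress_mem_corner hp.isIdempotentElem X)]

theorem slope_mul (hp : IsStarProjection p) {X : A} (hX : IsUnit (p * X * p + (1 - p))) :
    slope p X * (p * X * p) = (1 - p) * X * p := by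
  have h1 : slope p X * (p * X * p + (1 - p)) = (1 - p) * X * p := by
    rw [slope, mul_assoc, Ring.inverse_mul_cancel _ hX, mul_one]
  rw [← h1, mul_add, mul_sub, mul_one, corner_mul hp.isIdempotentElem (slope_mem_corner hp X)]
  simp

theorem slope_eq (hp : IsStarProjection p) (hk : k ∈ corner p) {X : A}
    (hX : IsUnit (p * X * p + (1 - p)))
    (h : (1 - p) * X * p = k * (p * X * p)) : slope p X = k := by
  have : k * (p * X * p + (1 - p)) = (1 - p) * X * p := by
    rw [mul_add, h, mul_sub, mul_one, corner_mul hp.isIdempotentElem hk]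
    simp
  rw [slope, ← this, mul_assoc, Ring.mul_inverse_cancel _ hX, mul_one]

/-- The star is only conjugate linear; it enters `graphProj`, which is why smoothness is taken over
the reals. -/
theorem contDiff_star : ContDiff ℝ ∞ (star : A → A) :=
  (starL' ℝ : A ≃L[ℝ] A).contDiff

/-- The second identity is the defining relation of the slope: the projection onto the graph of `k`
has slope `k`. Both charts rest on it. -/
theorem mul_graphProj_mul (hp : IsStarProjection p) (hk : k ∈ corner p) :
    p * graphProj p k * p = Ring.inverse (1 + star k * k) * p ∧
    (1 - p) * graphProj p k * p = k * (p * graphProj p k * p) := by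
  obtain ⟨h3, h4⟩ := corner_star hp hk
  have h1 := corner_mul hp.isIdempotentElem hk
  have h2 := mul_corner hp.isIdempotentElem hk
  have hc := mul_inverse_comm hp hk
  have e1 : graphProj p k * p = (p + k) * (Ring.inverse (1 + star k * k) * p) := by
    rw [graphProj, mul_assoc, add_mul p (star k) p, h4, add_zero, hp.isIdempotentElem.eq, mul_assoc]
  have e2 : p * graphProj p k * p = Ring.inverse (1 + star k * k) * p := by
    rw [mul_assoc, e1, ← mul_assoc, mul_add, h2, hp.isIdempotentElem.eq, add_zero, ← mul_assoc,
      hc, mul_assoc, hp.isIdempotentElem.eq]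
  refine ⟨e2, ?_⟩
  rw [e2, mul_assoc, e1, ← mul_assoc, mul_add, sub_mul, sub_mul, h2, hp.isIdempotentElem.eq]
  simp

/-- The off-diagonal entry of `X - graphProj p k`, for `k` the slope of `X`, is determined by the
other entries: it is `k` times the diagonal entry. So `flat` can drop it to store `k` in that
corner, and the last term of `unflat` restores it. -/
theorem unflat_flat (hp : IsStarProjection p) {X : A} (hX : IsUnit (p * X * p + (1 - p))) :
    unflat p (flat p X) = X := by
  have hi := hp.isIdempotentElem
  have hk := slope_mem_corner hp X
  obtain ⟨-, hg⟩ := mul_graphProj_mul hp hk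
  have hs := slope_mul hp hX
  have e1 : (1 - p) * flat p X * p = slope p X := by
    rw [flat]
    generalize X - graphProj p (slope p X) = Y
    rw [mul_add, add_mul, mem_corner.1 hk, mul_sub, sub_mul,
      mem_corner.1 (compress_mem_corner hi Y), sub_self, add_zero]
  have e2 : slope p X * (flat p X * p) = (1 - p) * (X - graphProj p (slope p X)) * p := by
    have h1 : (1 - p) * (X - graphProj p (slope p X)) * p =
        slope p X * (p * (X - graphProj p (slope p X)) * p) := by
      rw [mul_sub, sub_mul, hg, ← hs, mul_sub p, sub_mul, mul_sub]
    have h2 : p * (flat p X * p) = p * (X - graphProj p (slope p X)) * p := by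
      rw [flat]
      generalize X - graphProj p (slope p X) = Y
      rw [← mul_assoc, mul_add, mul_sub, mul_corner hi hk,
        mul_corner hi (compress_mem_corner hi Y), zero_add, sub_zero]
    rw [h1, ← h2, ← mul_assoc _ p, corner_mul hi hk]
  rw [unflat, e1, e2, flat]
  abel

/-- The correction `k * (W * p)` in `unflat` adds `k * (p * W * p)` to the off-diagonal entry while
`p * W * p` is added to the diagonal one, so the slope remains exactly `k`. -/
theorem flat_unflat (hp : IsStarProjection p) {W : A}
    (hW : IsUnit (p * unflat p W * p + (1 - p))) : flat p (unflat p W) = W := by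
  have hi := hp.isIdempotentElem
  have hk := compress_mem_corner hi W
  obtain ⟨-, hg⟩ := mul_graphProj_mul hp hk
  have key : slope p (unflat p W) = (1 - p) * W * p := by
    refine slope_eq hp hk hW ?_
    rw [unflat]
    set k := (1 - p) * W * p with hkd
    have h1 := mul_corner hi hk
    have h2 := corner_mul hi hk
    have h3 := mem_corner.1 hk
    have h4 : (1 - p) * k = k := by rw [sub_mul, h1]; simp
    have e1 : (1 - p) * (k * (W * p)) * p = k * (p * W * p) := by
      rw [← mul_assoc (1 - p) k, h4, mul_assoc k, mul_assoc W, hi.eq, mul_assoc p, ← mul_assoc k p,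
        h2]
    have e2 : (1 - p) * (W - k) * p = 0 := by
      rw [mul_sub, sub_mul, h3, ← hkd, sub_self]
    have e3 : p * (W - k) * p = p * W * p := by rw [mul_sub, h1, sub_zero]
    have e4 : p * (k * (W * p)) * p = 0 := by rw [← mul_assoc, h1]; simp
    simp only [mul_add, add_mul, e1, e2, e3, e4, hg]
    simp [mul_assoc]
  rw [flat, key, unflat]
  set k := (1 - p) * W * p with hkd
  have h1 := mul_corner hi hk
  have h3 := mem_corner.1 hk
  have h4 : (1 - p) * k = k := by rw [sub_mul, h1]; simp
  have e1 : graphProj p k + (W - k) + k * (W * p) - graphProj p k = (W - k) + k * (W * p) := by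
    abel
  have e2 : (1 - p) * ((W - k) + k * (W * p)) * p = k * (W * p) := by
    rw [mul_add, add_mul, mul_sub, sub_mul, ← hkd, h3, sub_self, zero_add, ← mul_assoc (1 - p), h4,
      mul_assoc k, mul_assoc W, hi.eq]
  rw [e1, e2]
  abel

section

variable [PartialOrder A] [StarOrderedRing A]

theorem isUnit_one_add_star_mul (k : A) : IsUnit (1 + star k * k) :=
  CStarAlgebra.isUnit_of_le 1 (le_add_of_nonneg_right (star_mul_self_nonneg k))

theorem graphProj_mul_add (hp : IsStarProjection p) (hk : k ∈ corner p) :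
    graphProj p k * (p + k) = p + k := by
  obtain ⟨h3, h4⟩ := corner_star hp hk
  have h1 := corner_mul hp.isIdempotentElem hk
  have h2 := mul_corner hp.isIdempotentElem hk
  have h5 : (p + star k) * (p + k) = (1 + star k * k) * p := by
    rw [add_mul, mul_add, mul_add, add_mul, hp.isIdempotentElem.eq, h2, h4, mul_assoc, h1]
    simp
  rw [graphProj, mul_assoc, h5, mul_assoc, ← mul_assoc (Ring.inverse _),
    Ring.inverse_mul_cancel _ (isUnit_one_add_star_mul k), one_mul, add_mul, h1,
    hp.isIdempotentElem.eq]

theorem isStarProjection_graphProj (hp : IsStarProjection p) (hk : k ∈ corner p) :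
    IsStarProjection (graphProj p k) := by
  constructor
  · rw [IsIdempotentElem]
    nth_rw 2 [graphProj]
    rw [← mul_assoc, ← mul_assoc, graphProj_mul_add hp hk, graphProj]
  · rw [IsSelfAdjoint, graphProj, star_mul, star_mul, ← Ring.inverse_star, star_add, star_add,
      star_add, star_mul, star_star, star_one, hp.isSelfAdjoint.star_eq, mul_assoc]

/-- A projection close to `p` is the projection onto the graph of its slope. -/
theorem eq_graphProj (hp : IsStarProjection p) {q : A} (hq : IsStarProjection q)
    (hu : IsUnit (p * q * p + (1 - p))) (hpq : ‖q - p‖ < 1) : graphProj p (slope p q) = q := by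
  have hi := hp.isIdempotentElem
  have hk := slope_mem_corner hp q
  have h1 := mul_corner hi hk
  have h2 := corner_mul hi hk
  set k := slope p q with hkd
  set r := graphProj p k with hrd
  have hr := isStarProjection_graphProj hp hk
  rw [← hrd] at hr
  -- Since the second factor is a unit, this exhibits `p + k` as a right multiple of `q`-stable
  -- elements, so the graph projection `r` lies under `q`. The difference `q - r` then kills `p`,
  -- and `(q - r) * (q - p) = q - r` with `‖q - p‖ < 1` forces it to vanish.
  have e1 : (p + k) * (p * q * p + (1 - p)) = q * p := by
    have h3 : k * (p * q * p) = (1 - p) * q * p := slope_mul hp hu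
    have h4 : p * (p * q * p) = p * q * p := by rw [← mul_assoc, ← mul_assoc, hi.eq]
    have h5 : p * (1 - p) = 0 := by rw [mul_sub, hi.eq]; simp
    have h6 : k * (1 - p) = 0 := by rw [mul_sub, h2]; simp
    rw [mul_add, add_mul, add_mul, h3, h4, h5, h6, sub_mul, sub_mul]
    simp
  have e2 : p + k = q * p * Ring.inverse (p * q * p + (1 - p)) := by
    rw [← e1, mul_assoc, Ring.mul_inverse_cancel _ hu, mul_one]
  have e3 : q * (p + k) = p + k := by
    rw [e2, ← mul_assoc, ← mul_assoc, hq.isIdempotentElem.eq]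
  have e4 : q * r = r := by
    rw [hrd, graphProj, ← mul_assoc, ← mul_assoc, e3]
  have e5 : r * q = r := by
    have := congrArg star e4
    rwa [star_mul, hq.isSelfAdjoint.star_eq, hr.isSelfAdjoint.star_eq] at this
  have e6 : (q - r) * q = q - r := by rw [sub_mul, hq.isIdempotentElem.eq, e5]
  have e7 : (q - r) * p = 0 := by
    have : (q - r) * (q * p) = 0 := by
      rw [← e1, ← mul_assoc, sub_mul, e3, graphProj_mul_add hp hk, sub_self, zero_mul]
    rwa [← mul_assoc, e6] at this
  have e8 : (q - r) * (q - p) = q - r := by rw [mul_sub, e6, e7, sub_zero]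
  have e9 : ‖q - r‖ = 0 := by
    by_contra h0
    have hpos : 0 < ‖q - r‖ := lt_of_le_of_ne (norm_nonneg _) (Ne.symm h0)
    have := norm_mul_le (q - r) (q - p)
    rw [e8] at this
    nlinarith
  exact (sub_eq_zero.1 (norm_eq_zero.1 e9)).symm

/-- A nearby projection is the graph projection of its slope, leaving nothing but the slope in
`flat`. Conversely, for `k` in the corner the correction term contains `k * k = 0`, so `unflat`
returns a graph projection. -/
theorem flat_mem_corner_iff (hp : IsStarProjection p) {X : A}
    (hu : IsUnit (p * X * p + (1 - p))) (hX : ‖X - p‖ < 1) :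
    IsStarProjection X ↔ flat p X ∈ corner p := by
  have hi := hp.isIdempotentElem
  constructor
  · intro h
    have : flat p X = slope p X := by
      rw [flat, eq_graphProj hp h hu hX]
      simp
    rw [this]
    exact slope_mem_corner hp X
  · intro h
    have h1 := unflat_flat hp hu
    have h2 : flat p X * (flat p X * p) = 0 := by
      rw [corner_mul hi h, ← corner_mul hi h, mul_assoc, ← mul_assoc p, mul_corner hi h, zero_mul,
        mul_zero]
    rw [unflat, mem_corner.1 h, h2] at h1
    rw [← h1]
    simpa using isStarProjection_graphProj hp h

theorem graphProj_flat (hp : IsStarProjection p) {X : A}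
    (hu : IsUnit (p * X * p + (1 - p))) (hX : ‖X - p‖ < 1) (h : IsStarProjection X) :
    graphProj p (flat p X) = X := by
  have : flat p X = slope p X := by
    rw [flat, eq_graphProj hp h hu hX]
    simp
  rw [this, eq_graphProj hp h hu hX]

theorem contDiff_graphProj (p : A) : ContDiff ℝ ∞ (graphProj p) := by
  refine ((contDiff_const.add contDiff_id).mul ?_).mul (contDiff_const.add contDiff_star)
  rw [contDiff_iff_contDiffAt]
  intro k
  obtain ⟨u, hu⟩ := isUnit_one_add_star_mul k
  have h1 : ContDiffAt ℝ ∞ Ring.inverse (1 + star k * k) := hu ▸ contDiffAt_ringInverse ℝ u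
  exact h1.comp k (contDiff_const.add (contDiff_star.mul contDiff_id)).contDiffAt

theorem contDiff_unflat (p : A) : ContDiff ℝ ∞ (unflat p) := by
  have hk : ContDiff ℝ ∞ fun W : A => (1 - p) * W * p :=
    (contDiff_const.mul contDiff_id).mul contDiff_const
  exact (((contDiff_graphProj p).comp hk).add (contDiff_id.sub hk)).add (hk.mul (contDiff_id.mul contDiff_const))

theorem contDiffOn_flat (p : A) :
    ContDiffOn ℝ ∞ (flat p) {X | IsUnit (p * X * p + (1 - p))} := by
  have hs : ContDiffOn ℝ ∞ (slope p) {X | IsUnit (p * X * p + (1 - p))} := by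
    refine ((contDiff_const.mul contDiff_id).mul contDiff_const).contDiffOn.mul ?_
    intro X hX
    obtain ⟨u, hu⟩ := hX
    have h1 : ContDiffAt ℝ ∞ Ring.inverse (p * X * p + (1 - p)) :=
      hu ▸ contDiffAt_ringInverse ℝ u
    exact (h1.comp X (((contDiff_const.mul contDiff_id).mul contDiff_const).add
      contDiff_const).contDiffAt).contDiffWithinAt
  have hX := contDiffOn_id.sub ((contDiff_graphProj p).comp_contDiffOn hs)
  exact hs.add (hX.sub ((contDiffOn_const.mul hX).mul contDiffOn_const))

/-- The chart at `p` as a local homeomorphism, on a domain where every projection is the projection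
onto a graph over `p`. -/
def projChart (p : A) (hp : IsStarProjection p) : OpenPartialHomeomorph A A where
  toFun := flat p
  invFun := unflat p
  source := {X | IsUnit (p * X * p + (1 - p))} ∩ {X | ‖X - p‖ < 1}
  target := unflat p ⁻¹' ({X | IsUnit (p * X * p + (1 - p))} ∩ {X | ‖X - p‖ < 1})
  map_source' X hX := by
    rw [Set.mem_preimage, unflat_flat hp hX.1]
    exact hX
  map_target' W hW := hW
  left_inv' X hX := unflat_flat hp hX.1
  right_inv' W hW := flat_unflat hp hW.1
  open_source := (Units.isOpen.preimage (by fun_prop)).inter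
    (isOpen_lt (by fun_prop) continuous_const)
  open_target := ((Units.isOpen.preimage (by fun_prop)).inter
    (isOpen_lt (by fun_prop) continuous_const)).preimage (contDiff_unflat p).continuous
  continuousOn_toFun := ((contDiffOn_flat p).mono Set.inter_subset_left).continuousOn
  continuousOn_invFun := (contDiff_unflat p).continuous.continuousOn

theorem mem_projChart_source {p : A} (hp : IsStarProjection p) : p ∈ (projChart p hp).source := by
  constructor
  · change IsUnit (p * p * p + (1 - p))
    rw [hp.isIdempotentElem.eq, hp.isIdempotentElem.eq]
    simp
  · change ‖p - p‖ < 1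
    simp

end

/-! ### Straightening the condition `(1 - Y) X ∈ J` for a closed ideal. -/

/-- The factor `1 - (1 - p) l` of the shear, where `l` is the corner of `W` at `q`. -/
def shearFactor (p q W : A) : A := 1 - (1 - p) * ((1 - q) * W * q)

/-- The shear that turns the condition `(1 - q - l) (p + k) ∈ J` into `(1 - q) k ∈ J`. -/
def shear (p q : A) : OpenPartialHomeomorph (A × A) (A × A) where
  toFun W := (shearFactor p q W.2 * W.1 - (1 - p) * ((1 - q) * W.2 * q) * p, W.2)
  invFun W := (Ring.inverse (shearFactor p q W.2) *
    (W.1 + (1 - p) * ((1 - q) * W.2 * q) * p), W.2)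
  source := {W | IsUnit (shearFactor p q W.2)}
  target := {W | IsUnit (shearFactor p q W.2)}
  map_source' W hW := hW
  map_target' W hW := hW
  left_inv' W hW := by
    ext
    · change Ring.inverse (shearFactor p q W.2) * (shearFactor p q W.2 * W.1 - _ + _) = W.1
      rw [sub_add_cancel, ← mul_assoc, Ring.inverse_mul_cancel _ hW, one_mul]
    · rfl
  right_inv' W hW := by
    ext
    · change shearFactor p q W.2 * (Ring.inverse (shearFactor p q W.2) * (W.1 + _)) - _ = W.1
      rw [← mul_assoc, Ring.mul_inverse_cancel _ hW, one_mul, add_sub_cancel_right]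
    · rfl
  open_source := Units.isOpen.preimage (by unfold shearFactor; fun_prop)
  open_target := Units.isOpen.preimage (by unfold shearFactor; fun_prop)
  continuousOn_toFun := by
    unfold shearFactor
    fun_prop
  continuousOn_invFun := by
    refine ContinuousOn.prodMk (ContinuousOn.mul ?_ (by fun_prop)) (by fun_prop)
    intro W hW
    obtain ⟨u, hu⟩ := hW
    have h1 : ContinuousAt Ring.inverse (shearFactor p q W.2) := hu ▸ NormedRing.inverse_continuousAt u
    refine (ContinuousAt.comp (f := fun W : A × A => shearFactor p q W.2) h1 ?_).continuousWithinAt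
    unfold shearFactor
    fun_prop

theorem contDiff_shear_corner (q : A) : ContDiff ℝ ∞ fun W : A × A => (1 - q) * W.2 * q :=
  (contDiff_const.mul contDiff_snd).mul contDiff_const

theorem contDiff_shearFactor (p q : A) : ContDiff ℝ ∞ fun W : A × A => shearFactor p q W.2 :=
  contDiff_const.sub (contDiff_const.mul (contDiff_shear_corner q))

theorem contDiff_shear (p q : A) : ContDiff ℝ ∞ (shear p q) :=
  (((contDiff_shearFactor p q).mul contDiff_fst).sub
    ((contDiff_const.mul (contDiff_shear_corner q)).mul contDiff_const)).prodMk contDiff_snd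

theorem contDiffOn_shear_symm (p q : A) :
    ContDiffOn ℝ ∞ (shear p q).symm (shear p q).target := by
  refine ContDiffOn.prodMk (ContDiffOn.mul ?_ (contDiff_fst.add
    ((contDiff_const.mul (contDiff_shear_corner q)).mul contDiff_const)).contDiffOn)
      contDiff_snd.contDiffOn
  intro W hW
  obtain ⟨u, hu⟩ := hW
  have h1 : ContDiffAt ℝ ∞ Ring.inverse (shearFactor p q W.2) := hu ▸ contDiffAt_ringInverse ℝ u
  exact (h1.comp W (contDiff_shearFactor p q).contDiffAt).contDiffWithinAt

/-- The leading `1 - p` in the shear terms gives `p * shearFactor = p`, and the added term lies in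
the corner; both conditions defining the corner are therefore unaffected. -/
theorem shear_mem_corner_iff {p q : A} (hp : IsStarProjection p) {W : A × A}
    (hW : IsUnit (shearFactor p q W.2)) :
    (shear p q W).1 ∈ corner p ↔ W.1 ∈ corner p := by
  have hi := hp.isIdempotentElem
  change shearFactor p q W.2 * W.1 - (1 - p) * ((1 - q) * W.2 * q) * p ∈ corner p ↔ _
  rw [Submodule.sub_mem_iff_left _ (compress_mem_corner hi _), mem_corner_iff hi,
    mem_corner_iff hi, ← mul_assoc]
  have h1 : p * shearFactor p q W.2 = p := by
    rw [shearFactor, mul_sub, mul_one, ← mul_assoc, mul_sub, mul_one, hi.eq]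
    simp
  rw [h1, mul_assoc, hW.mul_right_inj]

/-- The model of the pairs of projections `(X, Y)` with `(1 - Y) X ∈ J`. -/
def idealCorner (p q : A) (J : Submodule ℝ A) : Submodule ℝ (A × A) :=
  (corner p).prod (corner q) ⊓
    J.comap ((LinearMap.mulLeft ℝ (1 - q)).comp (LinearMap.fst ℝ A A))

theorem mem_idealCorner {p q : A} {J : Submodule ℝ A} {W : A × A} : W ∈ idealCorner p q J ↔
    (W.1 ∈ corner p ∧ W.2 ∈ corner q) ∧ (1 - q) * W.1 ∈ J := Iff.rfl

section Ideal

variable [PartialOrder A] [StarOrderedRing A] {p q : A} {J : Submodule ℝ A}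

/-- For `k`, `l` in the corners of `p`, `q` and an ideal `J` that contains `(1 - q) p`: the product
`(1 - P_l) P_k` belongs to `J` if and only if the first component of the shear of `(k, l)` does
so, once multiplied by `1 - q`. -/
theorem mul_graphProj_mem_iff (hp : IsStarProjection p) (hq : IsStarProjection q)
    (hl : ∀ a, ∀ x ∈ J, a * x ∈ J) (hr : ∀ a, ∀ x ∈ J, x * a ∈ J) (h0 : (1 - q) * p ∈ J)
    {W : A × A} (hk : W.1 ∈ corner p) (hl' : W.2 ∈ corner q) :
    (1 - graphProj q W.2) * graphProj p W.1 ∈ J ↔ (1 - q) * (shear p q W).1 ∈ J := by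
  obtain ⟨k, l⟩ := W
  simp only at hk hl'
  change _ ↔ (1 - q) * (shearFactor p q l * k - (1 - p) * ((1 - q) * l * q) * p) ∈ J
  rw [shearFactor, mem_corner.1 hl']
  have hqi := hq.isIdempotentElem
  have l1 := mul_corner hqi hl'
  have l2 := corner_mul hqi hl'
  -- `1 - q - l` is the oblique counterpart of `1 - graphProj q l`, with the graph of `l` as kernel:
  -- each is a left multiple of the other. Likewise `p + k` and `graphProj p k` are right multiples
  -- of each other, so the ideal does not distinguish them.
  have e1 : (1 - q - l) * (q + l) = 0 := by
    have l3 : l * l = 0 := by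
      nth_rw 1 [← l2]
      rw [mul_assoc, l1, mul_zero]
    simp only [mul_add, sub_mul, one_mul, hqi.eq, l1, l2, l3]
    abel
  have e2 : (1 - q - l) * graphProj q l = 0 := by
    rw [graphProj, ← mul_assoc, ← mul_assoc, e1, zero_mul, zero_mul]
  have e3 : (1 - q - l) * (1 - graphProj q l) = 1 - q - l := by rw [mul_sub, e2]; simp
  have e4 : (1 - graphProj q l) * (1 - q - l) = 1 - graphProj q l := by
    have := graphProj_mul_add hq hl'
    rw [sub_sub, mul_sub, mul_one, sub_mul _ _ (q + l), this]
    simp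
  have e5 : (1 - graphProj q l) * graphProj p k ∈ J ↔ (1 - q - l) * (p + k) ∈ J := by
    constructor
    · intro h
      have := hr (p + k) _ (hl (1 - q - l) _ h)
      rwa [← mul_assoc, e3, mul_assoc, graphProj_mul_add hp hk] at this
    · intro h
      have := hl (1 - graphProj q l) _ (hr (Ring.inverse (1 + star k * k) * (p + star k)) _ h)
      rwa [mul_assoc (1 - q - l), ← mul_assoc _ (1 - q - l), e4, ← mul_assoc (p + k),
        ← graphProj] at this
  -- The two sides differ from `(1 - q - l) * (p + k)` only by multiples of `(1 - q) * p`, which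
  -- lies in `J` by `h0`. This identity dictates the formula for the shear.
  have e6 : (1 - q) * ((1 - (1 - p) * l) * k - (1 - p) * l * p) =
      (1 - q - l) * (p + k) - (1 - q) * p + (1 - q) * p * (l * (p + k)) := by
    have l4 : (1 - q) * l = l := by rw [sub_mul, l1]; simp
    have : (1 - q) * ((1 - (1 - p) * l) * k - (1 - p) * l * p) =
      (1 - q) * k - ((1 - q) * l) * (p + k) + (1 - q) * p * (l * (p + k)) := by noncomm_ring
    rw [this, l4]
    noncomm_ring
  rw [e5, e6, Submodule.add_mem_iff_left _ (hr _ _ h0), Submodule.sub_mem_iff_left _ h0]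

/-- The pairs of projections `(X, Y)` with `(1 - Y) X ∈ J`, for a closed ideal `J`, form a
submanifold of the pairs of projections. -/
theorem exists_isFlattening (hp : IsStarProjection p) (hq : IsStarProjection q)
    (hJ : IsClosed (J : Set A))
    (hl : ∀ a, ∀ x ∈ J, a * x ∈ J) (hr : ∀ a, ∀ x ∈ J, x * a ∈ J) (h0 : (1 - q) * p ∈ J) :
    ∃ φ : OpenPartialHomeomorph (A × A) (A × A), BanachSub.IsFlattening
      {x : A × A | (IsStarProjection x.1 ∧ IsStarProjection x.2) ∧ (1 - x.2) * x.1 ∈ J}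
      {x : A × A | IsStarProjection x.1 ∧ IsStarProjection x.2} (p, q) φ
      (idealCorner p q J) ((corner p).prod (corner q)) := by
  have hsrc : ∀ y ∈ (((projChart p hp).prod (projChart q hq)).trans (shear p q)).source,
      y.1 ∈ (projChart p hp).source ∧ y.2 ∈ (projChart q hq).source ∧
      IsUnit (shearFactor p q (flat q y.2)) := by
    intro y hy
    simp only [OpenPartialHomeomorph.trans_source, OpenPartialHomeomorph.prod_source] at hy
    exact ⟨hy.1.1, hy.1.2, hy.2⟩
  have hN : ∀ y ∈ (((projChart p hp).prod (projChart q hq)).trans (shear p q)).source,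
      (IsStarProjection y.1 ∧ IsStarProjection y.2) ↔
      (shear p q (flat p y.1, flat q y.2)).1 ∈ corner p ∧ flat q y.2 ∈ corner q := by
    intro y hy
    obtain ⟨h1, h2, h3⟩ := hsrc y hy
    rw [shear_mem_corner_iff hp h3, flat_mem_corner_iff hp h1.1 h1.2,
      flat_mem_corner_iff hq h2.1 h2.2]
  refine ⟨((projChart p hp).prod (projChart q hq)).trans (shear p q), ?_, ?_, ?_, ?_, ?_, ?_, ?_, hN⟩
  · rw [OpenPartialHomeomorph.trans_source]
    refine ⟨⟨mem_projChart_source hp, mem_projChart_source hq⟩, ?_⟩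
    change IsUnit (shearFactor p q (flat q q))
    have h1 := mem_projChart_source hq
    -- The base point has coordinate zero, where the shear factor is the identity, so it lies in the
    -- domain of the shear.
    have : flat q q = 0 := by
      have h2 : slope q q = 0 := by
        rw [slope, sub_mul, hq.isIdempotentElem.eq]
        simp
      rw [flat, eq_graphProj hq hq h1.1 h1.2, h2]
      simp
    rw [this, shearFactor]
    simp
  · refine (contDiff_shear p q).comp_contDiffOn
      (f := Prod.map (flat p) (flat q)) ?_
    refine (ContDiffOn.prodMap (contDiffOn_flat p) (contDiffOn_flat q)).mono ?_
    intro y hy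
    exact ⟨(hsrc y hy).1.1, (hsrc y hy).2.1.1⟩
  · refine ContDiff.comp_contDiffOn (g := Prod.map (unflat p) (unflat q)) ?_
      ((contDiffOn_shear_symm p q).mono ?_)
    · exact (contDiff_unflat p).prodMap (contDiff_unflat q)
    · intro y hy
      exact hy.1
  · have hc : IsClosed {W : A × A | (1 - q) * W.1 ∈ J} := hJ.preimage (by fun_prop)
    exact (((isClosed_corner p).prod (isClosed_corner q))).inter hc
  · exact (isClosed_corner p).prod (isClosed_corner q)
  · exact inf_le_left
  · intro y hy
    obtain ⟨h1, h2, h3⟩ := hsrc y hy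
    change (IsStarProjection y.1 ∧ IsStarProjection y.2) ∧ _ ↔
      ((shear p q (flat p y.1, flat q y.2)).1 ∈ corner p ∧ flat q y.2 ∈ corner q) ∧ _
    rw [← hN y hy]
    refine and_congr_right fun h => ?_
    have := mul_graphProj_mem_iff hp hq hl hr h0 (W := (flat p y.1, flat q y.2))
      ((flat_mem_corner_iff hp h1.1 h1.2).1 h.1) ((flat_mem_corner_iff hq h2.1 h2.2).1 h.2)
    rw [graphProj_flat hp h1.1 h1.2 h.1, graphProj_flat hq h2.1 h2.2 h.2] at this
    exact this

end Ideal

end ProjChart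
end

noncomputable section

/-! ### Two projections and a projection reducing both -/

namespace CommonCompl

open scoped InnerProductSpace

section Projection

variable {H : Type*} [NormedAddCommGroup H] [InnerProductSpace ℂ H] [CompleteSpace H]
  {P Q E : H →L[ℂ] H}

theorem _root_.IsStarProjection.apply_apply (hP : IsStarProjection P) (x : H) : P (P x) = P x :=
  DFunLike.congr_fun hP.isIdempotentElem.eq x

theorem _root_.IsStarProjection.mem_range_iff (hP : IsStarProjection P) {x : H} :
    x ∈ P.range ↔ P x = x := by
  refine ⟨?_, fun h => ⟨x, h⟩⟩
  rintro ⟨y, rfl⟩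
  exact hP.apply_apply y

theorem _root_.IsStarProjection.inner_left (hP : IsStarProjection P) (x y : H) :
    ⟪P x, y⟫_ℂ = ⟪x, P y⟫_ℂ := by
  have := ContinuousLinearMap.adjoint_inner_left P y x
  rw [← ContinuousLinearMap.star_eq_adjoint, hP.isSelfAdjoint.star_eq] at this
  exact this

theorem _root_.IsStarProjection.mem_orthogonal_iff (hP : IsStarProjection P) {x : H} :
    x ∈ P.rangeᗮ ↔ P x = 0 := by
  rw [ContinuousLinearMap.orthogonal_range, ← ContinuousLinearMap.star_eq_adjoint,
    hP.isSelfAdjoint.star_eq]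
  rfl

theorem _root_.IsStarProjection.norm_sq_add (hP : IsStarProjection P) (x : H) :
    ‖P x‖ ^ 2 + ‖x - P x‖ ^ 2 = ‖x‖ ^ 2 := by
  have h0 : ⟪P x, x - P x⟫_ℂ = 0 := by
    rw [hP.inner_left, map_sub, hP.apply_apply, sub_self,
      inner_zero_right]
  have := norm_add_sq_eq_norm_sq_add_norm_sq_of_inner_eq_zero (P x) (x - P x) h0
  rw [add_sub_cancel] at this
  nlinarith [this]

theorem _root_.IsStarProjection.norm_apply_le (hP : IsStarProjection P) (x : H) : ‖P x‖ ≤ ‖x‖ := by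
  have := hP.norm_sq_add x
  exact abs_le_of_sq_le_sq' (by nlinarith [sq_nonneg ‖x - P x‖]) (norm_nonneg _) |>.2

theorem _root_.IsStarProjection.isClosed_range (hP : IsStarProjection P) :
    IsClosed (P.range : Set H) := by
  have : (P.range : Set H) = {x | P x = x} := by
    ext x
    exact hP.mem_range_iff
  rw [this]
  exact isClosed_eq P.continuous continuous_id

/-- `E` is a projection that commutes with `P` and `Q`, such that `P - Q` is bounded by `δ` on the
kernel of `E` and bounded below by `δ` on the range of `E`. -/
structure Reduces (δ : ℝ) (P Q E : H →L[ℂ] H) : Prop where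
  proj : IsStarProjection E
  left : ∀ x, E (P x) = P (E x)
  right : ∀ x, E (Q x) = Q (E x)
  le : ∀ x, E x = 0 → ‖P x - Q x‖ ≤ δ * ‖x‖
  ge : ∀ x, E x = x → δ * ‖x‖ ≤ ‖P x - Q x‖

theorem Reduces.symm {δ : ℝ} (h : Reduces δ P Q E) : Reduces δ Q P E where
  proj := h.proj
  left := h.right
  right := h.left
  le x hx := by rw [norm_sub_rev]; exact h.le x hx
  ge x hx := by rw [norm_sub_rev]; exact h.ge x hx

theorem reduces_zero {δ : ℝ} (h : ‖P - Q‖ ≤ δ) : Reduces δ P Q (0 : H →L[ℂ] H) where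
  proj := IsStarProjection.zero _
  left _ := by simp
  right _ := by simp
  le x _ := by
    have := (P - Q).le_opNorm x
    exact this.trans (by gcongr)
  ge x hx := by
    have : x = 0 := by simpa using hx.symm
    simp [this]

/-- Spectral subspaces of `(P - Q)²` reduce `P` and `Q`. -/
theorem exists_reduces (hP : IsStarProjection P) (hQ : IsStarProjection Q) {δ : ℝ} (hδ : 0 ≤ δ) :
    ∃ E, Reduces δ P Q E := by
  have hPs := hP.isSelfAdjoint
  have hQs := hQ.isSelfAdjoint
  have hD : IsSelfAdjoint (P - Q) := hPs.sub hQs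
  set c : H →L[ℂ] H := algebraMap ℝ (H →L[ℂ] H) (δ ^ 2) with hc
  set R : H →L[ℂ] H := (P - Q) * (P - Q) - c with hR
  have hcs : IsSelfAdjoint c := IsSelfAdjoint.algebraMap _ (IsSelfAdjoint.all _)
  have hRs : IsSelfAdjoint R := by
    refine IsSelfAdjoint.sub ?_ hcs
    have := hD.star_eq
    rw [IsSelfAdjoint, star_mul, this]
  have hp2 := hP.isIdempotentElem.eq
  have hq2 := hQ.isIdempotentElem.eq
  -- Expanding, (P - Q)² = P + Q - PQ - QP, which commutes with both projections.
  have hRP : Commute R P := by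
    refine Commute.sub_left ?_ (Algebra.commutes _ _)
    rw [Commute, SemiconjBy]
    simp only [mul_sub, sub_mul, hp2, hq2]
    simp only [mul_assoc, hp2]
    rw [← mul_assoc P P, hp2]
    abel
  have hRQ : Commute R Q := by
    refine Commute.sub_left ?_ (Algebra.commutes _ _)
    rw [Commute, SemiconjBy]
    simp only [mul_sub, sub_mul, hp2, hq2]
    simp only [mul_assoc, hq2]
    rw [← mul_assoc Q Q, hq2]
    abel
  have hNP : Commute R⁻ P := hRP.cfcₙ_real _
  have hNQ : Commute R⁻ Q := hRQ.cfcₙ_real _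
  have hNs : IsSelfAdjoint R⁻ := .of_nonneg (CFC.negPart_nonneg R)
  -- `E` will project onto the kernel of `R⁻`. There `R` acts as `R⁺ ≥ 0`, giving the lower bound;
  -- on the orthogonal complement, the closure of the range of `R⁻`, `R⁺` vanishes, giving the upper
  -- bound.
  set K : Submodule ℂ H := R⁻.ker with hK
  have hKc : IsClosed (K : Set H) := R⁻.isClosed_ker
  have : CompleteSpace K := hKc.completeSpace_coe
  have hE : IsStarProjection K.starProjection := isStarProjection_starProjection
  have hcomm : ∀ {B : H →L[ℂ] H}, Commute R⁻ B → IsSelfAdjoint B →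
      ∀ x, K.starProjection (B x) = B (K.starProjection x) := by
    intro B hB hBs x
    have hinv : ∀ y ∈ K, B y ∈ K := by
      intro y hy
      change R⁻ (B y) = 0
      have h1 : R⁻ (B y) = B (R⁻ y) := DFunLike.congr_fun hB.eq y
      have h2 : R⁻ y = 0 := hy
      rw [h1, h2, map_zero]
    refine (Submodule.eq_starProjection_of_mem_orthogonal (hinv _
      (Submodule.starProjection_apply_mem K x)) ?_)
    rw [← map_sub]
    intro y hy
    have h3 := ContinuousLinearMap.adjoint_inner_left B (x - K.starProjection x) y
    rw [← ContinuousLinearMap.star_eq_adjoint, hBs.star_eq] at h3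
    rw [← h3]
    exact Submodule.sub_starProjection_mem_orthogonal x (B y) (hinv y hy)
  have hnorm : ∀ x, ((‖P x - Q x‖ ^ 2 : ℝ)) =
      δ ^ 2 * ‖x‖ ^ 2 + RCLike.re ⟪R⁺ x, x⟫_ℂ - RCLike.re ⟪R⁻ x, x⟫_ℂ := by
    intro x
    have h1 : (P - Q) ((P - Q) x) = c x + R⁺ x - R⁻ x := by
      have h2 := CFC.posPart_sub_negPart R hRs
      have h3 : (P - Q) * (P - Q) = c + (R⁺ - R⁻) := by rw [h2, hR]; abel
      have h4 := DFunLike.congr_fun h3 x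
      rw [add_sub_assoc]
      exact h4
    have h5 := ContinuousLinearMap.adjoint_inner_left (P - Q) x ((P - Q) x)
    rw [← ContinuousLinearMap.star_eq_adjoint, hD.star_eq, h1] at h5
    have h6 : c x = ((δ ^ 2 : ℝ) : ℂ) • x := by
      rw [hc, Algebra.algebraMap_eq_smul_one]
      rfl
    rw [h6] at h5
    have h7 := congrArg RCLike.re h5
    rw [inner_self_eq_norm_sq, inner_sub_left, inner_add_left, inner_smul_left, map_sub, map_add,
      Complex.conj_ofReal] at h7
    have h8 : RCLike.re (((δ ^ 2 : ℝ) : ℂ) * ⟪x, x⟫_ℂ) = δ ^ 2 * ‖x‖ ^ 2 := by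
      rw [← inner_self_eq_norm_sq (𝕜 := ℂ) x]
      exact Complex.re_ofReal_mul _ _
    rw [h8] at h7
    exact h7.symm
  have hpos : ∀ {B : H →L[ℂ] H}, 0 ≤ B → ∀ x, 0 ≤ RCLike.re ⟪B x, x⟫_ℂ := by
    intro B hB x
    exact (ContinuousLinearMap.nonneg_iff_isPositive B |>.1 hB).re_inner_nonneg_left x
  refine ⟨K.starProjection, hE, hcomm hNP hPs, hcomm hNQ hQs, fun x hx => ?_, fun x hx => ?_⟩
  · have hx' : x ∈ Kᗮ := Submodule.starProjection_apply_eq_zero_iff K |>.1 hx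
    have h1 : R⁺ x = 0 := by
      have h2 : Kᗮ = R⁻.range.topologicalClosure := by
        have := ContinuousLinearMap.orthogonal_ker R⁻
        rwa [← ContinuousLinearMap.star_eq_adjoint, hNs.star_eq] at this
      have h3 : R⁻.range.topologicalClosure ≤ R⁺.ker := by
        refine Submodule.topologicalClosure_minimal _ ?_ R⁺.isClosed_ker
        rintro _ ⟨y, rfl⟩
        exact DFunLike.congr_fun (CFC.posPart_mul_negPart R) y
      exact h3 (h2 ▸ hx')
    have h4 := hnorm x
    rw [h1, inner_zero_left, map_zero, add_zero] at h4
    have h5 := hpos (CFC.negPart_nonneg R) x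
    refine abs_le_of_sq_le_sq' ?_ (by positivity) |>.2
    rw [mul_pow]
    linarith
  · have h1 : R⁻ x = 0 := Submodule.starProjection_eq_self_iff.1 hx
    have h4 := hnorm x
    rw [h1, inner_zero_left, map_zero, sub_zero] at h4
    have h5 := hpos (CFC.posPart_nonneg R) x
    refine abs_le_of_sq_le_sq' ?_ (norm_nonneg _) |>.2
    rw [mul_pow]
    linarith

end Projection

end CommonCompl
end

/-! ### Dimensions, and common complements from reducing projections. -/

noncomputable section

namespace CommonCompl

open scoped InnerProductSpace

section Dim

variable {H : Type*} [NormedAddCommGroup H] [InnerProductSpace ℂ H]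

theorem dim_eq_of_bijOn {A B : Submodule ℂ H} (f : H →ₗ[ℂ] H) (hAB : ∀ x ∈ A, f x ∈ B)
    (hinj : ∀ x ∈ A, f x = 0 → x = 0) (hsurj : ∀ y ∈ B, ∃ x ∈ A, f x = y) : dim A = dim B := by
  have e : A ≃ₗ[ℂ] B := LinearEquiv.ofBijective (f.restrict hAB) (by
    constructor
    · rw [injective_iff_map_eq_zero]
      intro x hx
      exact Subtype.ext (hinj x x.2 (congrArg Subtype.val hx))
    · intro y
      obtain ⟨x, hx, hxy⟩ := hsurj y y.2
      exact ⟨⟨x, hx⟩, Subtype.ext hxy⟩)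
  rw [dim, dim, e.rank_eq]

theorem dim_sup_of_disjoint {A B : Submodule ℂ H} (h : Disjoint A B) :
    dim (A ⊔ B) = dim A + dim B := by
  have := Submodule.rank_sup_add_rank_inf_eq A B
  rw [h.eq_bot, rank_bot, add_zero] at this
  rw [dim, this, map_add]
  rfl

theorem dim_lt_top_iff {A : Submodule ℂ H} : dim A < ⊤ ↔ FiniteDimensional ℂ A := by
  rw [dim, Cardinal.toENat_lt_top, Module.rank_lt_aleph0_iff]

theorem dim_eq_top_iff {A : Submodule ℂ H} : dim A = ⊤ ↔ ¬ FiniteDimensional ℂ A := by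
  rw [← dim_lt_top_iff, lt_top_iff_ne_top, not_not]

theorem dim_eq_finrank (A : Submodule ℂ H) [FiniteDimensional ℂ A] :
    dim A = Module.finrank ℂ A := by
  rw [dim, ← Module.finrank_eq_rank, Cardinal.toENat_nat]

theorem dim_mono {A B : Submodule ℂ H} (h : A ≤ B) : dim A ≤ dim B :=
  OrderHomClass.mono Cardinal.toENat (Submodule.rank_mono h)

/-- Here `F` is a bounded idempotent onto `S`. Its kernel complements `S`, and complements `T` as
well because `F` identifies `T` with `S`. -/
theorem hasCommonComplement_of_bijOn {S T : Submodule ℂ H} (F : H →L[ℂ] H) (hF : ∀ x, F x ∈ S)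
    (hS : ∀ s ∈ S, F s = s) (hinj : ∀ t ∈ T, F t = 0 → t = 0)
    (hsurj : ∀ s ∈ S, ∃ t ∈ T, F t = s) : HasCommonComplement S T := by
  refine ⟨F.ker, F.isClosed_ker, ⟨?_, ?_⟩, ⟨?_, ?_⟩⟩
  · rw [Submodule.disjoint_def]
    intro x hx hx'
    rw [← hS x hx]
    exact hx'
  · rw [codisjoint_iff_le_sup]
    intro x _
    refine Submodule.mem_sup.2 ⟨F x, hF x, x - F x, ?_, by abel⟩
    change F (x - F x) = 0
    rw [map_sub, hS _ (hF x), sub_self]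
  · rw [Submodule.disjoint_def]
    exact fun x hx hx' => hinj x hx hx'
  · rw [codisjoint_iff_le_sup]
    intro x _
    obtain ⟨t, ht, htx⟩ := hsurj (F x) (hF x)
    refine Submodule.mem_sup.2 ⟨t, ht, x - t, ?_, by abel⟩
    change F (x - t) = 0
    rw [map_sub, htx, sub_self]

end Dim

section Hilbert

open TopologicalSpace

theorem nonempty_hilbertBasis_nat (K : Type*) [NormedAddCommGroup K] [InnerProductSpace ℂ K]
    [CompleteSpace K] [SeparableSpace K] (h : ¬ FiniteDimensional ℂ K) :
    Nonempty (HilbertBasis ℕ ℂ K) := by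
  obtain ⟨w, b, hb⟩ := exists_hilbertBasis ℂ K
  have hw : Countable w := by
    have hsep : ∀ x y : w, x ≠ y → 1 ≤ dist (b x) (b y) := by
      intro x y hxy
      have h0 : ⟪b x, b y⟫_ℂ = 0 := b.orthonormal.2 hxy
      have h1 := norm_sub_sq (𝕜 := ℂ) (b x) (b y)
      rw [h0, b.orthonormal.1, b.orthonormal.1, map_zero] at h1
      rw [dist_eq_norm]
      nlinarith [norm_nonneg (b x - b y)]
    -- Distinct basis vectors are at distance at least 1, so these balls are disjoint nonempty open
    -- sets in a separable space.
    refine Pairwise.countable_of_isOpen_disjoint (s := fun x : w => Metric.ball (b x) (1 / 2)) ?_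
      (fun _ => Metric.isOpen_ball) (fun x => ⟨b x, by simp⟩)
    intro x y hxy
    refine Metric.ball_disjoint_ball ?_
    have := hsep x y hxy
    norm_num
    exact this
  have hw' : Infinite w := by
    by_contra hfin
    rw [not_infinite_iff_finite] at hfin
    have := Fintype.ofFinite w
    exact h (Module.Basis.finiteDimensional_of_finite b.toOrthonormalBasis.toBasis)
  have e : ℕ ≃ w := (nonempty_equiv_of_countable (α := ℕ) (β := w)).some
  refine ⟨HilbertBasis.mk (v := b ∘ e) (b.orthonormal.comp e e.injective) ?_⟩
  rw [Set.range_comp, e.range_eq_univ, Set.image_univ, b.dense_span]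

variable {H : Type*} [NormedAddCommGroup H] [InnerProductSpace ℂ H] [CompleteSpace H]
  [SeparableSpace H]

/-- The place where separability makes the value `⊤` of `dim` informative: any two
infinite-dimensional closed subspaces are copies of ℓ². -/
theorem nonempty_equiv_of_dim_eq {A B : Submodule ℂ H} (hA : IsClosed (A : Set H))
    (hB : IsClosed (B : Set H)) (h : dim A = dim B) : Nonempty (A ≃L[ℂ] B) := by
  have : CompleteSpace A := hA.completeSpace_coe
  have : CompleteSpace B := hB.completeSpace_coe
  by_cases hf : dim A = ⊤
  · obtain ⟨a⟩ := nonempty_hilbertBasis_nat A (dim_eq_top_iff.1 hf)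
    obtain ⟨b⟩ := nonempty_hilbertBasis_nat B (dim_eq_top_iff.1 (h ▸ hf))
    exact ⟨(a.repr.trans b.repr.symm).toContinuousLinearEquiv⟩
  · have h1 : FiniteDimensional ℂ A := dim_lt_top_iff.1 (lt_top_iff_ne_top.2 hf)
    have h2 : FiniteDimensional ℂ B := dim_lt_top_iff.1 (lt_top_iff_ne_top.2 (h ▸ hf))
    refine ⟨ContinuousLinearEquiv.ofFinrankEq ?_⟩
    rw [dim_eq_finrank A, dim_eq_finrank B] at h
    exact_mod_cast h

end Hilbert

section Projection

variable {H : Type*} [NormedAddCommGroup H] [InnerProductSpace ℂ H] [CompleteSpace H]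
  {P Q E : H →L[ℂ] H} {δ : ℝ}

theorem range_one_sub (hP : IsStarProjection P) : (1 - P).range = P.rangeᗮ := by
  ext x
  rw [hP.one_sub.mem_range_iff, hP.mem_orthogonal_iff]
  simp

theorem Reduces.one_sub (h : Reduces δ P Q E) : Reduces δ (1 - P) (1 - Q) E where
  proj := h.proj
  left x := by simp [h.left]
  right x := by simp [h.right]
  le x hx := by
    have := h.le x hx
    rw [norm_sub_rev] at this
    simpa using this
  ge x hx := by
    have := h.ge x hx
    rw [norm_sub_rev] at this
    simpa using this

/-- For such `t` one has `‖t‖ = ‖P t - Q t‖ ≤ δ * ‖t‖`. -/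
theorem Reduces.eq_zero_of_apply_eq_zero (h : Reduces δ P Q E) (hδ : δ < 1) {t : H} (ht : Q t = t)
    (hE : E t = 0) (h0 : P t = 0) : t = 0 := by
  have := h.le t hE
  rw [h0, ht, zero_sub, norm_neg] at this
  by_contra hne
  have : 0 < ‖t‖ := norm_pos_iff.2 hne
  nlinarith

/-- A bounded inverse of the bijection that `P` induces between the parts of the ranges of `Q` and
`P` in the kernel of `E`. -/
theorem Reduces.exists_section (h : Reduces δ P Q E) (hP : IsStarProjection P)
    (hQ : IsStarProjection Q) (hδ₀ : 0 ≤ δ) (hδ : δ < 1) :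
    ∃ a : H →L[ℂ] H, (∀ s, Q (a s) = a s) ∧ (∀ s, E s = 0 → E (a s) = 0) ∧
      ∀ s, P s = s → E s = 0 → P (a s) = s := by
  -- On the part of the range of `P` in the kernel of `E`, `1 - N` acts as `P Q`. Its Neumann
  -- inverse, followed by `Q`, is the desired section.
  set N : H →L[ℂ] H := P * (P - Q) * P * (1 - E) with hN
  have hEE : ∀ x, E ((1 - E) x) = 0 := fun x => by simp [h.proj.apply_apply]
  have hNE : ∀ x, E (N x) = 0 := by
    intro x
    change E (P ((P - Q) (P ((1 - E) x)))) = 0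
    rw [h.left, sub_apply, map_sub, h.left, h.right, h.left, hEE]
    simp
  have hnorm : ‖N‖ ≤ δ := by
    refine N.opNorm_le_bound hδ₀ fun x => ?_
    change ‖P ((P - Q) (P ((1 - E) x)))‖ ≤ _
    refine (hP.norm_apply_le _).trans ((h.le _ ?_).trans ?_)
    · rw [h.left, hEE, map_zero]
    · gcongr
      exact (hP.norm_apply_le _).trans (h.proj.one_sub.norm_apply_le x)
  set u := Units.oneSub N (hnorm.trans_lt hδ)
  have huy : ∀ s, (↑u⁻¹ : H →L[ℂ] H) s - N ((↑u⁻¹ : H →L[ℂ] H) s) = s := by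
    intro s
    have h1 : (u : H →L[ℂ] H) * (↑u⁻¹ : H →L[ℂ] H) = 1 := u.mul_inv
    exact DFunLike.congr_fun h1 s
  have hyE : ∀ s, E s = 0 → E ((↑u⁻¹ : H →L[ℂ] H) s) = 0 := by
    intro s hE
    have := congrArg E (huy s)
    rw [map_sub, hNE, hE, sub_zero] at this
    exact this
  refine ⟨Q * (↑u⁻¹ : H →L[ℂ] H), fun s => hQ.apply_apply _, fun s hE => ?_, fun s hs hE => ?_⟩
  · rw [mul_apply_eq_comp, h.right, hyE s hE, map_zero]
  set y : H := (↑u⁻¹ : H →L[ℂ] H) s with hy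
  have hyP : P y = y := by
    have h1 : P (N y) = N y := hP.apply_apply _
    have := congrArg P (huy s)
    rw [map_sub, ← hy, h1, hs, ← huy s] at this
    exact sub_left_injective this
  have h2 : N y = y - P (Q y) := by
    change P ((P - Q) (P ((1 - E) y))) = _
    have hyE' : E y = 0 := hyE s hE
    simp [hyE', hyP]
  change P (Q y) = s
  rw [← huy s, ← hy, h2]
  abel

theorem Reduces.exists_apply_eq (h : Reduces δ P Q E) (hP : IsStarProjection P)
    (hQ : IsStarProjection Q) (hδ₀ : 0 ≤ δ) (hδ : δ < 1) {s : H} (hs : P s = s) (hE : E s = 0) :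
    ∃ t, Q t = t ∧ E t = 0 ∧ P t = s := by
  obtain ⟨a, h1, h2, h3⟩ := h.exists_section hP hQ hδ₀ hδ
  exact ⟨a s, h1 s, h2 s hE, h3 s hs hE⟩

theorem Reduces.dim_inf_orthogonal (h : Reduces δ P Q E) (hP : IsStarProjection P)
    (hQ : IsStarProjection Q) (hδ₀ : 0 ≤ δ) (hδ : δ < 1) :
    dim (Q.range ⊓ E.rangeᗮ) = dim (P.range ⊓ E.rangeᗮ) := by
  refine dim_eq_of_bijOn (P : H →ₗ[ℂ] H) ?_ ?_ ?_
  · rintro x ⟨-, hx⟩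
    refine ⟨⟨x, rfl⟩, ?_⟩
    rw [SetLike.mem_coe, h.proj.mem_orthogonal_iff] at hx ⊢
    rw [ContinuousLinearMap.coe_coe, h.left, hx, map_zero]
  · rintro x ⟨hx1, hx2⟩ h0
    exact h.eq_zero_of_apply_eq_zero hδ (hQ.mem_range_iff.1 hx1)
      (h.proj.mem_orthogonal_iff.1 hx2) h0
  · rintro y ⟨hy1, hy2⟩
    obtain ⟨t, ht1, ht2, ht3⟩ := h.exists_apply_eq hP hQ hδ₀ hδ (hP.mem_range_iff.1 hy1)
      (h.proj.mem_orthogonal_iff.1 hy2)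
    exact ⟨t, ⟨hQ.mem_range_iff.2 ht1, h.proj.mem_orthogonal_iff.2 ht2⟩, ht3⟩

theorem Reduces.dim_range (h : Reduces δ P Q E) (hP : IsStarProjection P) :
    dim P.range = dim (P.range ⊓ E.range) + dim (P.range ⊓ E.rangeᗮ) := by
  rw [← dim_sup_of_disjoint]
  · congr 1
    apply le_antisymm
    · intro x hx
      rw [hP.mem_range_iff] at hx
      refine Submodule.mem_sup.2 ⟨E x, ⟨?_, ⟨x, rfl⟩⟩, x - E x, ⟨?_, ?_⟩, by abel⟩
      · exact hP.mem_range_iff.2 (by rw [← h.left, hx])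
      · exact hP.mem_range_iff.2 (by rw [map_sub, ← h.left, hx])
      · exact h.proj.mem_orthogonal_iff.2 (by rw [map_sub, h.proj.apply_apply, sub_self])
    · exact sup_le inf_le_left inf_le_left
  · exact (Submodule.orthogonal_disjoint E.range).mono inf_le_right inf_le_right

/-- The operator is self-adjoint and respects the splitting by `E`: bounded below by `δ` on the
range, the identity on the kernel. Its square is thus bounded below by `δ ^ 2`. -/
theorem Reduces.isUnit (h : Reduces δ P Q E) (hP : IsStarProjection P)
    (hQ : IsStarProjection Q) (hδ₀ : 0 < δ) (hδ : δ < 1) :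
    IsUnit ((P - Q) * E + (1 - E)) := by
  set D : H →L[ℂ] H := (P - Q) * E + (1 - E) with hD
  have hcomm : Commute (P - Q) E := by
    ext x
    simp [h.left, h.right]
  have hsa : IsSelfAdjoint D := by
    rw [IsSelfAdjoint, hD, star_add, star_mul, star_sub, star_sub, star_one,
      hP.isSelfAdjoint.star_eq, hQ.isSelfAdjoint.star_eq, h.proj.isSelfAdjoint.star_eq, hcomm.eq]
  have hu : IsUnit (D * D) := by
    refine ContinuousLinearMap.isUnit_of_forall_le_norm_inner_map (c := ⟨δ ^ 2, sq_nonneg δ⟩) (D * D)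
      (by change (0 : ℝ) < δ ^ 2; positivity) fun x => ?_
    have h1 : ⟪(D * D) x, x⟫_ℂ = ⟪D x, D x⟫_ℂ := by
      have := ContinuousLinearMap.adjoint_inner_left D x (D x)
      rwa [← ContinuousLinearMap.star_eq_adjoint, hsa.star_eq] at this
    rw [h1, inner_self_eq_norm_sq_to_K, norm_pow]
    change _ * δ ^ 2 ≤ _
    have h2 := h.proj.norm_sq_add (D x)
    have h3 : E (D x) = P (E x) - Q (E x) := by
      simp [hD, h.left, h.right, h.proj.apply_apply]
    have h4 : D x - E (D x) = x - E x := by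
      rw [h3]
      simp [hD]
    rw [h4, h3] at h2
    have h5 := h.proj.norm_sq_add x
    have h6 := h.ge (E x) (h.proj.apply_apply x)
    have h7 : (δ * ‖E x‖) ^ 2 ≤ ‖P (E x) - Q (E x)‖ ^ 2 := by gcongr
    have h8 : δ ^ 2 ≤ 1 := by nlinarith
    rw [RCLike.norm_ofReal, abs_norm]
    nlinarith [sq_nonneg ‖x - E x‖]
  exact ((Commute.refl D).isUnit_mul_iff.1 hu).1

theorem Reduces.eq_zero_of_mem (h : Reduces δ P Q E) (hδ₀ : 0 < δ) {x : H} (hPx : P x = x)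
    (hQx : Q x = x) (hE : E x = x) : x = 0 := by
  have := h.ge x hE
  rw [hPx, hQx, sub_self, norm_zero] at this
  by_contra hne
  have : 0 < ‖x‖ := norm_pos_iff.2 hne
  nlinarith

/-- Inverting `P - Q` on the range of `E` writes each of its vectors as a vector of ran P minus one
of ran Q, boundedly. With `Reduces.eq_zero_of_mem` this is the direct sum decomposition of ran E. -/
theorem Reduces.exists_sub_eq (h : Reduces δ P Q E) (hP : IsStarProjection P)
    (hQ : IsStarProjection Q) (hδ₀ : 0 < δ) (hδ : δ < 1) :
    ∃ B : H →L[ℂ] H, (∀ x, E (B x) = B x) ∧ ∀ x, E x = x → P (B x) - Q (B x) = x := by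
  obtain ⟨u, hu⟩ := h.isUnit hP hQ hδ₀ hδ
  refine ⟨E * ↑u⁻¹, fun x => h.proj.apply_apply _, fun x hx => ?_⟩
  have h1 : (u : H →L[ℂ] H) * (↑u⁻¹ : H →L[ℂ] H) = 1 := u.mul_inv
  have h2 := congrArg E (DFunLike.congr_fun h1 x)
  rw [hu] at h2
  simp only [mul_apply_eq_comp, add_apply,
    sub_apply, one_apply_eq_self, map_add, map_sub, h.left, h.right,
    h.proj.apply_apply, sub_self, add_zero, hx] at h2
  exact h2

/-- In ran E both ran Q and the orthogonal complement of ran P are complements of ran P, so `1 - P`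
identifies them. -/
theorem Reduces.dim_orthogonal_inf (h : Reduces δ P Q E) (hP : IsStarProjection P)
    (hQ : IsStarProjection Q) (hδ₀ : 0 < δ) (hδ : δ < 1) :
    dim (Q.range ⊓ E.range) = dim (P.rangeᗮ ⊓ E.range) := by
  obtain ⟨B, hB, hB'⟩ := h.exists_sub_eq hP hQ hδ₀ hδ
  refine dim_eq_of_bijOn ((1 - P : H →L[ℂ] H) : H →ₗ[ℂ] H) ?_ ?_ ?_
  · rintro x ⟨-, hx⟩
    rw [SetLike.mem_coe, h.proj.mem_range_iff] at hx
    refine ⟨?_, ?_⟩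
    · rw [SetLike.mem_coe, hP.mem_orthogonal_iff]
      simp [hP.apply_apply]
    · rw [SetLike.mem_coe, h.proj.mem_range_iff]
      simp [h.left, hx]
  · rintro x ⟨hx1, hx2⟩ h0
    have h0' : x - P x = 0 := h0
    exact h.eq_zero_of_mem hδ₀ (sub_eq_zero.1 h0').symm (hQ.mem_range_iff.1 hx1)
      (h.proj.mem_range_iff.1 hx2)
  · rintro y ⟨hy1, hy2⟩
    rw [SetLike.mem_coe, hP.mem_orthogonal_iff] at hy1
    rw [SetLike.mem_coe, h.proj.mem_range_iff] at hy2
    refine ⟨- Q (B y), ⟨?_, ?_⟩, ?_⟩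
    · exact Q.range.neg_mem ⟨_, rfl⟩
    · exact E.range.neg_mem (h.proj.mem_range_iff.2 (by rw [h.right, hB]))
    · have h1 := hB' y hy2
      have h2 : - Q (B y) = y - P (B y) := by
        rw [eq_sub_iff_add_eq, add_comm, ← sub_eq_add_neg]
        exact h1
      change - Q (B y) - P (- Q (B y)) = y
      rw [h2, map_sub, hy1, hP.apply_apply]
      abel

/-- Two subspaces whose parts in the range of a reducing projection have equal dimensions have a
common complement. -/
theorem Reduces.hasCommonComplement [TopologicalSpace.SeparableSpace H] (h : Reduces δ P Q E)
    (hP : IsStarProjection P) (hQ : IsStarProjection Q) (hδ₀ : 0 < δ) (hδ : δ < 1)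
    (hdim : dim (P.range ⊓ E.range) = dim (Q.range ⊓ E.range)) :
    HasCommonComplement P.range Q.range := by
  obtain ⟨B, hB, hB'⟩ := h.exists_sub_eq hP hQ hδ₀ hδ
  obtain ⟨J⟩ := nonempty_equiv_of_dim_eq (hP.isClosed_range.inter h.proj.isClosed_range)
    (hQ.isClosed_range.inter h.proj.isClosed_range) hdim
  have memP : ∀ {x}, x ∈ P.range ⊓ E.range ↔ P x = x ∧ E x = x := fun {x} => by
    rw [Submodule.mem_inf, hP.mem_range_iff, h.proj.mem_range_iff]
  have memQ : ∀ {x}, x ∈ Q.range ⊓ E.range ↔ Q x = x ∧ E x = x := fun {x} => by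
    rw [Submodule.mem_inf, hQ.mem_range_iff, h.proj.mem_range_iff]
  let τ : H →L[ℂ] (Q.range ⊓ E.range : Submodule ℂ H) := (-(Q * B * E)).codRestrict _ fun x => by
    rw [memQ]
    simp [hQ.apply_apply, h.right, hB]
  -- `F` is the idempotent onto ran P along the common complement. On ker E it is `P`; a vector of
  -- ran E splits as `P (B x) + τ x`, and `F` sends it to `P (B x) - J⁻¹ (τ x)`, which vanishes
  -- exactly on the graph of `J`.
  let F : H →L[ℂ] H := P * (1 - E) + P * B * E -
    (P.range ⊓ E.range).subtypeL.comp ((J.symm : _ →L[ℂ] _).comp τ)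
  have hFx : ∀ x, F x = P (x - E x) + P (B (E x)) - J.symm (τ x) := fun x => rfl
  have hτ : ∀ x, (τ x : H) = - Q (B (E x)) := fun x => rfl
  have hEx : ∀ x, E x = P (B (E x)) + τ x := by
    intro x
    rw [hτ, ← sub_eq_add_neg]
    exact (hB' _ (h.proj.apply_apply x)).symm
  have hJ : ∀ z, P (J.symm z) = J.symm z ∧ E (J.symm z) = J.symm z := fun z =>
    memP.1 (J.symm z).2
  have hτ' : ∀ x, Q (τ x) = τ x ∧ E (τ x) = τ x := fun x => memQ.1 (τ x).2
  have hEP : ∀ x, E (P (B (E x))) = P (B (E x)) := fun x => by rw [h.left, hB]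
  have hτS : ∀ s, P s = s → τ s = 0 := by
    intro s hs
    have h1 : P (τ s) = τ s := by
      have h2 : (τ s : H) = E s - P (B (E s)) := eq_sub_of_add_eq' (hEx s).symm
      rw [h2, map_sub, hP.apply_apply, ← h.left, hs]
    exact Subtype.ext (h.eq_zero_of_mem hδ₀ h1 (hτ' s).1 (hτ' s).2)
  have hτT : ∀ t, Q t = t → P (B (E t)) = 0 ∧ (τ t : H) = E t := by
    intro t ht
    have h1 : Q (P (B (E t))) = P (B (E t)) := by
      have h2 : P (B (E t)) = E t - τ t := eq_sub_of_add_eq (hEx t).symm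
      rw [h2, map_sub, (hτ' t).1, ← h.right, ht]
    have h3 := h.eq_zero_of_mem hδ₀ (hP.apply_apply _) h1 (hEP t)
    refine ⟨h3, ?_⟩
    have := hEx t
    rw [h3, zero_add] at this
    exact this.symm
  refine hasCommonComplement_of_bijOn F (fun x => ?_) (fun s hs => ?_) (fun t ht h0 => ?_)
    (fun s hs => ?_)
  · rw [hP.mem_range_iff, hFx, map_sub, map_add, hP.apply_apply, hP.apply_apply, (hJ _).1]
  · rw [hP.mem_range_iff] at hs
    have h1 := hEx s
    rw [hτS s hs] at h1
    rw [hFx, hτS s hs, map_sub, hs, ← h.left, hs]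
    simp only [Submodule.coe_zero, add_zero, map_zero, sub_zero] at h1 ⊢
    rw [← h1]
    abel
  · rw [hQ.mem_range_iff] at ht
    obtain ⟨h1, h2⟩ := hτT t ht
    rw [hFx, h1, add_zero] at h0
    have h3 : J.symm (τ t) = (0 : H) := by
      have := congrArg E h0
      rw [map_sub, (hJ _).2, h.left, map_sub, h.proj.apply_apply, sub_self, map_zero, map_zero,
        zero_sub, neg_eq_zero] at this
      exact this
    have h4 : τ t = 0 := by
      have h5 : J.symm (τ t) = 0 := Subtype.ext h3
      simpa using h5
    have h6 : E t = 0 := by rw [← h2, h4]; rfl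
    rw [h3, sub_zero, h6, sub_zero] at h0
    exact h.eq_zero_of_apply_eq_zero hδ ht h6 h0
  · rw [hP.mem_range_iff] at hs
    obtain ⟨t, ht1, ht2, ht3⟩ := h.exists_apply_eq hP hQ hδ₀.le hδ (s := s - E s)
      (by rw [map_sub, ← h.left, hs]) (by rw [map_sub, h.proj.apply_apply, sub_self])
    let z : (P.range ⊓ E.range : Submodule ℂ H) := ⟨E s, memP.2
      ⟨by rw [← h.left, hs], h.proj.apply_apply s⟩⟩
    obtain ⟨hz1, hz2⟩ := memQ.1 (J z).2
    have hQt : Q (t - J z) = t - J z := by rw [map_sub, ht1, hz1]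
    have hEt : E (t - J z) = - J z := by rw [map_sub, ht2, hz2, zero_sub]
    refine ⟨t - J z, hQ.mem_range_iff.2 hQt, ?_⟩
    obtain ⟨h1, h2⟩ := hτT _ hQt
    have h3 : τ (t - J z) = - J z := Subtype.ext (by rw [h2, hEt]; rfl)
    rw [hFx, h1, h3, hEt]
    simp only [map_neg, ContinuousLinearEquiv.symm_apply_apply, sub_neg_eq_add, sub_add_cancel,
      ht3, Submodule.coe_neg, add_zero]
    change s - E s + E s = s
    abel

end Projection

end CommonCompl
end

noncomputable section

/-! ### Index computations -/

/-- Both sides equal rank + nullity + corank. The additive form avoids subtraction, which is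
meaningless when dimensions are infinite. -/
theorem LinearMap.rank_ker_add_rank {K : Type*} [Field K] {V W : Type*} [AddCommGroup V]
    [Module K V] [AddCommGroup W] [Module K W] (f : V →ₗ[K] W) :
    (Module.rank K f.ker).toENat + (Module.rank K W).toENat =
      (Module.rank K V).toENat + (Module.rank K (W ⧸ f.range)).toENat := by
  have h1 := congrArg Cardinal.toENat (LinearMap.lift_rank_range_add_rank_ker f)
  have h2 := congrArg Cardinal.toENat (Submodule.rank_quotient_add_rank f.range)
  simp only [map_add, Cardinal.toENat_lift] at h1 h2
  rw [← h1, ← h2]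
  ring

/-- If `f` is injective on a complement of `N` and maps it to a complement of `C`, then `N` and `C`
differ in dimension as the kernel and the cokernel of `f`. -/
theorem LinearMap.rank_ker_add_rank_of_isCompl {K : Type*} [Field K] {V W : Type*} [AddCommGroup V]
    [Module K V] [AddCommGroup W] [Module K W] (f : V →ₗ[K] W) {V₁ N : Submodule K V}
    {C : Submodule K W} (hV : IsCompl V₁ N) (hinj : Disjoint V₁ f.ker)
    (hW : IsCompl (V₁.map f) C) :
    (Module.rank K f.ker).toENat ≤ (Module.rank K N).toENat ∧
    (Module.rank K f.ker).toENat + (Module.rank K C).toENat =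
      (Module.rank K N).toENat + (Module.rank K (W ⧸ f.range)).toENat := by
  -- Passing to the quotients by `V₁` and its image changes neither kernel nor cokernel, and the new
  -- source and target are copies of `N` and `C`.
  let g : V ⧸ V₁ →ₗ[K] W ⧸ V₁.map f := V₁.mapQ (V₁.map f) f (Submodule.le_comap_map f V₁)
  have h := g.rank_ker_add_rank
  have e1 := (Submodule.quotientEquivOfIsCompl V₁ N hV).rank_eq
  have e2 := (Submodule.quotientEquivOfIsCompl (V₁.map f) C hW).rank_eq
  have e3 : Module.rank K g.ker = Module.rank K f.ker := by
    refine (LinearEquiv.ofBijective (M₂ := g.ker) ((V₁.mkQ.restrict (p := f.ker) (q := g.ker) ?_))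
      ⟨?_, ?_⟩).rank_eq.symm
    · intro x hx
      change g (V₁.mkQ x) = 0
      have hx' : f x = 0 := hx
      change V₁.mapQ (V₁.map f) f _ (V₁.mkQ x) = 0
      rw [Submodule.mkQ_apply, Submodule.mapQ_apply, hx', Submodule.Quotient.mk_zero]
    · rw [injective_iff_map_eq_zero]
      intro x hx
      have h1 : V₁.mkQ (x : V) = 0 := congrArg Subtype.val hx
      rw [Submodule.mkQ_apply, Submodule.Quotient.mk_eq_zero] at h1
      exact Subtype.ext (Submodule.disjoint_def.1 hinj x h1 x.2)
    · rintro ⟨y, hy⟩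
      obtain ⟨x, rfl⟩ := V₁.mkQ_surjective y
      have h1 : V₁.mapQ (V₁.map f) f (Submodule.le_comap_map f V₁) (V₁.mkQ x) = 0 := hy
      rw [Submodule.mkQ_apply, Submodule.mapQ_apply, Submodule.Quotient.mk_eq_zero] at h1
      obtain ⟨v, hv, hvx⟩ := h1
      refine ⟨⟨x - v, ?_⟩, Subtype.ext ?_⟩
      · change f (x - v) = 0
        rw [map_sub, hvx, sub_self]
      · change V₁.mkQ (x - v) = V₁.mkQ x
        have : V₁.mkQ v = 0 := by simpa using hv
        rw [map_sub, this, sub_zero]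
  have e4 : Module.rank K ((W ⧸ V₁.map f) ⧸ g.range) = Module.rank K (W ⧸ f.range) := by
    have h1 : g.range = f.range.map (V₁.map f).mkQ := Submodule.range_mapQ _ _ _ _
    rw [h1]
    exact (Submodule.quotientQuotientEquivQuotient (V₁.map f) f.range
      LinearMap.map_le_range).rank_eq
  have hle := OrderHomClass.mono Cardinal.toENat (Submodule.rank_le g.ker)
  rw [e1, e3] at hle
  rw [e1, e2, e3, e4] at h
  exact ⟨hle, h⟩

namespace CommonCompl

open scoped InnerProductSpace

variable {H : Type*} [NormedAddCommGroup H] [InnerProductSpace ℂ H] [CompleteSpace H]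
  {P Q E : H →L[ℂ] H} {δ : ℝ}

/-- The map that a bounded operator induces between two subspaces. -/
def mapSub (K : H →L[ℂ] H) {S T : Submodule ℂ H} (hK : ∀ x ∈ S, K x ∈ T) : S →ₗ[ℂ] T :=
  (K : H →ₗ[ℂ] H).restrict hK

/-- The index formula for operators that are close enough to `Q` on the part of the range of `P` in
the kernel of a reducing projection: `G` witnesses this closeness. -/
theorem Reduces.rank_ker_add (h : Reduces δ P Q E) (hP : IsStarProjection P)
    (hQ : IsStarProjection Q) (hδ : δ < 1) {a : H →L[ℂ] H} (ha₁ : ∀ t, P (a t) = a t)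
    (ha₂ : ∀ t, E t = 0 → E (a t) = 0) (ha₃ : ∀ t, Q t = t → E t = 0 → Q (a t) = t)
    {T : Submodule ℂ H} {K c G : H →L[ℂ] H} (hK : ∀ x ∈ P.range, K x ∈ T)
    (hc : ∀ x ∈ Q.range, c x ∈ T) (hG : ∀ t, Q t = t → G t = K (a (t - E t)) + c (E t))
    (hGinj : ∀ t, Q t = t → G t = 0 → t = 0) (hGsurj : ∀ y ∈ T, ∃ t, Q t = t ∧ G t = y) :
    (Module.rank ℂ (mapSub K hK).ker).toENat ≤ dim (P.range ⊓ E.range) ∧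
    (Module.rank ℂ (mapSub K hK).ker).toENat + dim (Q.range ⊓ E.range) =
      dim (P.range ⊓ E.range) + (Module.rank ℂ (T ⧸ (mapSub K hK).range)).toENat := by
  -- `a` is also a left inverse of `Q` on ran P ∩ ker E. Hence `K` factors there as `G ∘ Q`, and the
  -- bijection `G` from ran Q onto `T` makes `K` injective on this part, with image complementary to
  -- `c (ran Q ∩ ran E)`.
  have haQ : ∀ v, P v = v → E v = 0 → a (Q v) = v := by
    intro v hv hE
    have hE' : E (Q v) = 0 := by rw [h.right, hE, map_zero]
    have h1 : Q (a (Q v) - v) = 0 := by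
      rw [map_sub, ha₃ _ (hQ.apply_apply v) hE', sub_self]
    refine sub_eq_zero.1 (h.symm.eq_zero_of_apply_eq_zero hδ ?_ ?_ h1)
    · rw [map_sub, ha₁, hv]
    · rw [map_sub, ha₂ _ hE', hE, sub_zero]
  have hKG : ∀ v, P v = v → E v = 0 → K v = G (Q v) := by
    intro v hv hE
    have hE' : E (Q v) = 0 := by rw [h.right, hE, map_zero]
    rw [hG _ (hQ.apply_apply v), hE', sub_zero, map_zero, add_zero, haQ v hv hE]
  have hcG : ∀ t, Q t = t → E t = t → c t = G t := by
    intro t ht hE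
    rw [hG t ht, hE, sub_self, map_zero, map_zero, zero_add]
  set f := mapSub K hK with hf
  have hfx : ∀ x, ((f x : T) : H) = K x := fun x => rfl
  set V₁ : Submodule ℂ P.range := E.rangeᗮ.comap P.range.subtype with hV₁
  set N : Submodule ℂ P.range := E.range.comap P.range.subtype with hN
  set C : Submodule ℂ T := ((Q.range ⊓ E.range).map (c : H →ₗ[ℂ] H)).comap T.subtype with hC
  have memV : ∀ {x : P.range}, x ∈ V₁ ↔ E x = 0 := fun {x} => h.proj.mem_orthogonal_iff
  have memN : ∀ {x : P.range}, x ∈ N ↔ E x = x := fun {x} => h.proj.mem_range_iff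
  have memC : ∀ {y : T}, y ∈ C ↔ ∃ t, Q t = t ∧ E t = t ∧ c t = y := fun {y} => by
    constructor
    · rintro ⟨t, ht, hty⟩
      exact ⟨t, hQ.mem_range_iff.1 ht.1, h.proj.mem_range_iff.1 ht.2, hty⟩
    · rintro ⟨t, h1, h2, h3⟩
      exact ⟨t, ⟨hQ.mem_range_iff.2 h1, h.proj.mem_range_iff.2 h2⟩, h3⟩
  have memP : ∀ x : P.range, P x = x := fun x => hP.mem_range_iff.1 x.2
  have hVN : IsCompl V₁ N := by
    constructor
    · rw [Submodule.disjoint_def]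
      intro x hx hx'
      rw [memV] at hx
      rw [memN, hx] at hx'
      exact Subtype.ext hx'.symm
    · rw [codisjoint_iff_le_sup]
      intro x _
      have hEx : E (x : H) ∈ P.range := hP.mem_range_iff.2 (by rw [← h.left, memP])
      refine Submodule.mem_sup.2 ⟨x - ⟨E x, hEx⟩, ?_, ⟨E x, hEx⟩, ?_, by abel⟩
      · rw [memV]
        change E (x - E x) = 0
        rw [map_sub, h.proj.apply_apply, sub_self]
      · rw [memN]
        exact h.proj.apply_apply _
  have hdisj : Disjoint V₁ f.ker := by
    rw [Submodule.disjoint_def]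
    intro x hx hx'
    rw [memV] at hx
    have h1 : K x = 0 := congrArg Subtype.val (LinearMap.mem_ker.1 hx')
    rw [hKG x (memP x) hx] at h1
    have h2 := hGinj _ (hQ.apply_apply _) h1
    have h3 := haQ x (memP x) hx
    rw [h2, map_zero] at h3
    exact Subtype.ext h3.symm
  have hcompl : IsCompl (V₁.map f) C := by
    constructor
    · rw [Submodule.disjoint_def]
      rintro y ⟨x, hx, rfl⟩ hy
      obtain ⟨t, ht, hEt, htx⟩ := memC.1 hy
      have hx' := memV.1 hx
      rw [hfx, hKG x (memP x) hx', hcG t ht hEt] at htx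
      have h1 : t - Q x = 0 := hGinj _ (by rw [map_sub, ht, hQ.apply_apply])
        (by rw [map_sub, htx, sub_self])
      have h2 : E (t - Q x) = 0 := by rw [h1, map_zero]
      rw [map_sub, hEt, h.right, hx', map_zero, sub_zero] at h2
      rw [h2, zero_sub, neg_eq_zero] at h1
      refine Subtype.ext ?_
      rw [hfx, hKG x (memP x) hx', h1, map_zero]
      rfl
    · rw [codisjoint_iff_le_sup]
      intro y _
      obtain ⟨t, ht, hty⟩ := hGsurj y y.2
      have hQE : Q (E t) = E t := by rw [← h.right, ht]
      have hat : a (t - E t) ∈ P.range := hP.mem_range_iff.2 (ha₁ _)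
      have hct : c (E t) ∈ T := hc _ (hQ.mem_range_iff.2 hQE)
      refine Submodule.mem_sup.2 ⟨f ⟨a (t - E t), hat⟩, ⟨_, ?_, rfl⟩, ⟨c (E t), hct⟩, ?_,
        Subtype.ext ?_⟩
      · exact memV.2 (ha₂ _ (by rw [map_sub, h.proj.apply_apply, sub_self]))
      · exact memC.2 ⟨E t, hQE, h.proj.apply_apply t, rfl⟩
      · rw [← hty, hG t ht]
        rfl
  have key := f.rank_ker_add_rank_of_isCompl hVN hdisj hcompl
  have e1 : Module.rank ℂ N = Module.rank ℂ (P.range ⊓ E.range : Submodule ℂ H) := by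
    refine (LinearEquiv.ofBijective (M₂ := (P.range ⊓ E.range : Submodule ℂ H))
      (P.range.subtype.restrict (p := N) fun x hx => ⟨x.2, hx⟩) ⟨?_, ?_⟩).rank_eq
    · intro x y hxy
      exact Subtype.ext (Subtype.ext
        (congrArg (fun z : (P.range ⊓ E.range : Submodule ℂ H) => (z : H)) hxy))
    · rintro ⟨y, hy⟩
      exact ⟨⟨⟨y, hy.1⟩, hy.2⟩, rfl⟩
  have e2 : Module.rank ℂ (Q.range ⊓ E.range : Submodule ℂ H) = Module.rank ℂ C := by
    refine (LinearEquiv.ofBijective (M₂ := C) (LinearMap.codRestrict C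
      (((c : H →ₗ[ℂ] H).restrict (p := Q.range ⊓ E.range) (q := T) fun x hx => hc x hx.1))
      fun x => ?_) ⟨?_, ?_⟩).rank_eq
    · exact ⟨x, x.2, rfl⟩
    · rw [injective_iff_map_eq_zero]
      intro x hx
      have h1 : c (x : H) = 0 := congrArg (fun z : C => ((z : T) : H)) hx
      have hx1 := hQ.mem_range_iff.1 x.2.1
      rw [hcG x hx1 (h.proj.mem_range_iff.1 x.2.2)] at h1
      exact Subtype.ext (hGinj _ hx1 h1)
    · rintro ⟨y, t, ht, hty⟩
      exact ⟨⟨t, ht⟩, Subtype.ext (Subtype.ext hty)⟩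
  rw [dim, dim, ← e1, e2]
  exact key

end CommonCompl
end

/-! ### The restricted projection: kernel, cokernel and local constancy of the index. -/

noncomputable section

namespace CommonCompl

open scoped InnerProductSpace
open Topology Filter

variable {H : Type*} [NormedAddCommGroup H] [InnerProductSpace ℂ H] [CompleteSpace H]
  {P Q E : H →L[ℂ] H} {δ : ℝ}

theorem _root_.IsStarProjection.completeSpace_range (hP : IsStarProjection P) :
    CompleteSpace P.range :=
  hP.isClosed_range.completeSpace_coe

theorem toENat_rank_ker_restr (hQ : IsStarProjection Q) :
    (Module.rank ℂ (restr P Q).ker).toENat = dim (P.range ⊓ Q.rangeᗮ) := by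
  refine congrArg Cardinal.toENat (LinearEquiv.ofBijective
    (M₂ := (P.range ⊓ Q.rangeᗮ : Submodule ℂ H))
    (P.range.subtype.restrict (p := (restr P Q).ker) ?_) ⟨?_, ?_⟩).rank_eq
  · intro x hx
    exact ⟨x.2, hQ.mem_orthogonal_iff.2 (congrArg Subtype.val (LinearMap.mem_ker.1 hx))⟩
  · intro x y hxy
    exact Subtype.ext (Subtype.ext
      (congrArg (fun z : (P.range ⊓ Q.rangeᗮ : Submodule ℂ H) => (z : H)) hxy))
  · rintro ⟨y, hy⟩
    exact ⟨⟨⟨y, hy.1⟩, LinearMap.mem_ker.2 (Subtype.ext (hQ.mem_orthogonal_iff.1 hy.2))⟩, rfl⟩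

/-- A closed range has its orthogonal complement in ran Q as a copy of the cokernel, and `y` in ran
Q is orthogonal to `Q (ran P)` exactly when `P y = 0`. -/
theorem toENat_rank_coker_restr (hP : IsStarProjection P) (hQ : IsStarProjection Q)
    (hcl : IsClosed ((restr P Q).range : Set Q.range)) :
    (Module.rank ℂ (Q.range ⧸ (restr P Q).range)).toENat = dim (P.rangeᗮ ⊓ Q.range) := by
  have := hQ.completeSpace_range
  have : CompleteSpace (restr P Q).range := hcl.completeSpace_coe
  have e1 := (Submodule.quotientEquivOfIsCompl _ _
    (Submodule.isCompl_orthogonal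
      (K := (restr P Q).range))).rank_eq
  rw [e1]
  have mem : ∀ y : Q.range, y ∈ (restr P Q).rangeᗮ ↔ P y = 0 := by
    intro y
    rw [← hP.mem_orthogonal_iff, Submodule.mem_orthogonal, Submodule.mem_orthogonal]
    constructor
    · intro h x hx
      have := h _ ⟨⟨x, hx⟩, rfl⟩
      change ⟪Q x, (y : H)⟫_ℂ = 0 at this
      rwa [hQ.inner_left, hQ.mem_range_iff.1 y.2] at this
    · rintro h _ ⟨x, rfl⟩
      change ⟪Q x, (y : H)⟫_ℂ = 0
      rw [hQ.inner_left, hQ.mem_range_iff.1 y.2]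
      exact h x x.2
  refine congrArg Cardinal.toENat (LinearEquiv.ofBijective
    (M₂ := (P.rangeᗮ ⊓ Q.range : Submodule ℂ H))
    (Q.range.subtype.restrict (p := (restr P Q).rangeᗮ) ?_) ⟨?_, ?_⟩).rank_eq
  · intro x hx
    exact ⟨hP.mem_orthogonal_iff.2 ((mem x).1 hx), x.2⟩
  · intro x y hxy
    exact Subtype.ext (Subtype.ext
      (congrArg (fun z : (P.rangeᗮ ⊓ Q.range : Submodule ℂ H) => (z : H)) hxy))
  · rintro ⟨y, hy⟩
    exact ⟨⟨⟨y, hy.2⟩, (mem _).2 (hP.mem_orthogonal_iff.1 hy.1)⟩, rfl⟩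

theorem isFredholm_restr (hP : IsStarProjection P) (hQ : IsStarProjection Q)
    (hcl : IsClosed ((restr P Q).range : Set Q.range)) (hi : dim (P.range ⊓ Q.rangeᗮ) < ⊤)
    (hj : dim (P.rangeᗮ ⊓ Q.range) < ⊤) : (restr P Q).IsFredholm := by
  have := hP.completeSpace_range
  have := hQ.completeSpace_range
  have : CompleteSpace (restr P Q).range := hcl.completeSpace_coe
  have hker : FiniteDimensional ℂ (restr P Q).ker := by
    rw [← toENat_rank_ker_restr hQ, Cardinal.toENat_lt_top] at hi
    exact Module.rank_lt_aleph0_iff.1 hi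
  have hcoker : FiniteDimensional ℂ (Q.range ⧸ (restr P Q).range) := by
    rw [← toENat_rank_coker_restr hP hQ hcl, Cardinal.toENat_lt_top] at hj
    exact Module.rank_lt_aleph0_iff.1 hj
  refine ⟨?_, hcl, hker, hcoker, Submodule.ClosedComplemented.of_finiteDimensional _⟩
  rw [isStrictMap_iff_isQuotientMap_rangeFactorization]
  exact (restr P Q).rangeRestrict.isQuotientMap (LinearMap.surjective_rangeRestrict _)

theorem index_restr (hP : IsStarProjection P) (hQ : IsStarProjection Q)
    (hcl : IsClosed ((restr P Q).range : Set Q.range)) {i j : ℕ}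
    (hi : dim (P.range ⊓ Q.rangeᗮ) = i) (hj : dim (P.rangeᗮ ⊓ Q.range) = j) :
    index (restr P Q) = i - j := by
  rw [← toENat_rank_ker_restr hQ] at hi
  rw [← toENat_rank_coker_restr hP hQ hcl] at hj
  rw [index, Module.finrank, Module.finrank, ← Cardinal.toNat_toENat,
    ← Cardinal.toNat_toENat, hi, hj]
  rfl

/-- Around a pair reduced by `E` with a finite-dimensional part, the restricted projections have
closed range and constant index. -/
theorem Reduces.eventually_index (h : Reduces δ P Q E) (hP : IsStarProjection P)
    (hQ : IsStarProjection Q) (hδ₀ : 0 ≤ δ) (hδ : δ < 1)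
    (hfin : FiniteDimensional ℂ (P.range ⊓ E.range : Submodule ℂ H)) :
    ∀ᶠ x : (H →L[ℂ] H) × (H →L[ℂ] H) in 𝓝 (P, Q), IsStarProjection x.1 → IsStarProjection x.2 →
      IsClosed ((restr x.1 x.2).range : Set x.2.range) ∧
      dim (x.1.range ⊓ x.2.rangeᗮ) ≤ dim (P.range ⊓ E.range) ∧
      dim (x.1.range ⊓ x.2.rangeᗮ) + dim (Q.range ⊓ E.range) =
        dim (P.range ⊓ E.range) + dim (x.1.rangeᗮ ⊓ x.2.range) := by
  obtain ⟨a, ha₁, ha₂, ha₃⟩ := h.symm.exists_section hQ hP hδ₀ hδ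
  -- At the base point the three terms are the blocks of the identity, so `G x` stays invertible
  -- nearby. It agrees with `x.2 x.1 a` on ran Q ∩ ker E and with `x.2` on ran Q ∩ ran E, as the
  -- index formula requires.
  let G : (H →L[ℂ] H) × (H →L[ℂ] H) → (H →L[ℂ] H) := fun x =>
    x.2 * x.1 * (a * (Q * (1 - E))) + x.2 * (E * Q) + (1 - x.2) * (1 - Q)
  have hGc : Continuous G := by fun_prop
  have hG1 : G (P, Q) = 1 := by
    ext x
    change Q (P (a (Q (x - E x)))) + Q (E (Q x)) + ((x - Q x) - Q (x - Q x)) = x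
    have h1 : E (Q (x - E x)) = 0 := by
      rw [h.right, map_sub, h.proj.apply_apply, sub_self, map_zero]
    rw [ha₁, ha₃ _ (hQ.apply_apply _) h1, h.right, hQ.apply_apply, map_sub, map_sub,
      hQ.apply_apply]
    abel
  have hev1 : ∀ᶠ x in 𝓝 (P, Q), IsUnit (G x) := by
    refine hGc.continuousAt.eventually (Units.isOpen.mem_nhds ?_)
    rw [hG1]
    exact isUnit_one
  have hev2 : ∀ᶠ x : (H →L[ℂ] H) × (H →L[ℂ] H) in 𝓝 (P, Q), ‖x.1 - P‖ < 1 / 2 := by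
    have hc : Continuous fun x : (H →L[ℂ] H) × (H →L[ℂ] H) => ‖x.1 - P‖ := by fun_prop
    refine hc.continuousAt.eventually (gt_mem_nhds ?_)
    norm_num
  filter_upwards [hev1, hev2]
  rintro ⟨P', Q'⟩ ⟨u, hu⟩ hPP hP' hQ'
  simp only at hPP hP' hQ' ⊢
  have hGx : ∀ t, Q t = t → (u : H →L[ℂ] H) t = Q' (P' (a (t - E t))) + Q' (E t) := by
    intro t ht
    rw [hu]
    change Q' (P' (a (Q (t - E t)))) + Q' (E (Q t)) + ((t - Q t) - Q' (t - Q t)) = _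
    rw [map_sub Q, ← h.right, ht]
    simp
  have hinv1 : ∀ x, (↑u⁻¹ : H →L[ℂ] H) ((u : H →L[ℂ] H) x) = x := fun x =>
    DFunLike.congr_fun u.inv_mul x
  have hinv2 : ∀ x, (u : H →L[ℂ] H) ((↑u⁻¹ : H →L[ℂ] H) x) = x := fun x =>
    DFunLike.congr_fun u.mul_inv x
  have hGinj : ∀ t, (u : H →L[ℂ] H) t = 0 → t = 0 := by
    intro t ht
    rw [← hinv1 t, ht, map_zero]
  -- The third term of `G` makes `u` respect the complements: if `u t` lies in ran Q', the component
  -- of `t` off ran Q is killed by the injective `u`. Hence `u` maps ran Q onto ran Q'.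
  have hQu : ∀ y, Q' y = y → Q ((↑u⁻¹ : H →L[ℂ] H) y) = (↑u⁻¹ : H →L[ℂ] H) y := by
    intro y hy
    set t := (↑u⁻¹ : H →L[ℂ] H) y with ht
    have h1 : (u : H →L[ℂ] H) t = y := hinv2 y
    have hux : ∀ x, (u : H →L[ℂ] H) x = Q' (P' (a (Q (x - E x)))) + Q' (E (Q x)) +
        ((x - Q x) - Q' (x - Q x)) := fun x => by rw [hu]; rfl
    have h2 : (t - Q t) - Q' (t - Q t) = 0 := by
      have h3 := congrArg (fun z => z - Q' z) (hux t)
      simp only [map_add, map_sub Q' _ (Q' _), hQ'.apply_apply, h1, hy, sub_self] at h3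
      rw [add_zero] at h3
      have h4 : ∀ α β γ : H, α + β + γ - (α + β) = γ := fun α β γ => by abel
      rw [h4] at h3
      exact h3.symm
    have h5 : (u : H →L[ℂ] H) (t - Q t) = 0 := by
      rw [hux, map_sub Q _ (E _), ← h.right]
      rw [map_sub Q t, hQ.apply_apply, sub_self, map_zero, sub_zero, map_zero, map_zero, map_zero,
        zero_add, zero_add, sub_zero]
      exact h2
    exact (sub_eq_zero.1 (hGinj _ h5)).symm
  -- Since `P'` is close to `P`, it maps ran P isomorphically onto ran P'; so `Q'` on ran P' may be
  -- replaced by `Q' P'` on the fixed space ran P.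
  have hred : Reduces (1 / 2) P' P 0 := reduces_zero hPP.le
  have hsurjP : ∀ x ∈ P'.range, ∃ s, P s = s ∧ P' s = x := by
    intro x hx
    obtain ⟨s, h1, -, h3⟩ := hred.exists_apply_eq hP' hP (by norm_num) (by norm_num)
      (hP'.mem_range_iff.1 hx) (by simp)
    exact ⟨s, h1, h3⟩
  have hinjP : ∀ s, P s = s → P' s = 0 → s = 0 := fun s hs h0 =>
    hred.eq_zero_of_apply_eq_zero (by norm_num) hs (by simp) h0
  have hK : ∀ x ∈ P.range, (Q' * P') x ∈ Q'.range := fun x _ => ⟨P' x, rfl⟩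
  have key := h.rank_ker_add hP hQ hδ ha₁ ha₂ ha₃ (T := Q'.range) (K := Q' * P') (c := Q')
    (G := u) hK (fun x _ => ⟨x, rfl⟩) hGx (fun t _ => hGinj t)
    (fun y hy => ⟨_, hQu y (hQ'.mem_range_iff.1 hy), hinv2 y⟩)
  set f := mapSub (Q' * P') hK with hf
  have hrange : (restr P' Q').range = f.range := by
    ext y
    constructor
    · rintro ⟨x, rfl⟩
      obtain ⟨s, hs, hsx⟩ := hsurjP x x.2
      refine ⟨⟨s, hP.mem_range_iff.2 hs⟩, Subtype.ext ?_⟩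
      change Q' (P' s) = Q' x
      rw [hsx]
    · rintro ⟨s, rfl⟩
      exact ⟨⟨P' s, ⟨s, rfl⟩⟩, rfl⟩
  have hker : Module.rank ℂ f.ker = Module.rank ℂ (restr P' Q').ker := by
    refine (LinearEquiv.ofBijective (M₂ := (restr P' Q').ker)
      ((mapSub P' (S := P.range) (T := P'.range) fun x _ => ⟨x, rfl⟩).restrict
        (p := f.ker) ?_) ⟨?_, ?_⟩).rank_eq
    · intro x hx
      exact LinearMap.mem_ker.2 (Subtype.ext (congrArg Subtype.val (LinearMap.mem_ker.1 hx)))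
    · rw [injective_iff_map_eq_zero]
      intro x hx
      have h1 : P' x = 0 := congrArg (fun z : (restr P' Q').ker => ((z : P'.range) : H)) hx
      exact Subtype.ext (Subtype.ext (hinjP _ (hP.mem_range_iff.1 x.1.2) h1))
    · rintro ⟨y, hy⟩
      obtain ⟨s, hs, hsy⟩ := hsurjP y y.2
      refine ⟨⟨⟨s, hP.mem_range_iff.2 hs⟩, LinearMap.mem_ker.2 (Subtype.ext ?_)⟩,
        Subtype.ext (Subtype.ext hsy)⟩
      have h1 : Q' y = 0 := congrArg Subtype.val (LinearMap.mem_ker.1 hy)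
      change Q' (P' s) = 0
      rw [hsy, h1]
  have hcl : IsClosed ((restr P' Q').range : Set Q'.range) := by
    rw [hrange]
    let L : Q'.range →L[ℂ] H := (E * (↑u⁻¹ : H →L[ℂ] H)).comp Q'.range.subtypeL
    let N : Submodule ℂ P.range := E.range.comap P.range.subtype
    have hNfin : FiniteDimensional ℂ N := by
      refine FiniteDimensional.of_injective (V₂ := (P.range ⊓ E.range : Submodule ℂ H))
        (P.range.subtype.restrict (p := N) fun x hx => ⟨x.2, hx⟩) ?_
      intro x y hxy
      exact Subtype.ext (Subtype.ext
        (congrArg (fun z : (P.range ⊓ E.range : Submodule ℂ H) => (z : H)) hxy))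
    -- The image of the part in ker E is closed, being cut out by `E u⁻¹ = 0`; the remaining part of
    -- ran P is finite-dimensional.
    have heq : f.range = L.ker ⊔ N.map f := by
      apply le_antisymm
      · rintro _ ⟨x, rfl⟩
        have hPx := hP.mem_range_iff.1 x.2
        have hEx : E (x : H) ∈ P.range := hP.mem_range_iff.2 (by rw [← h.left, hPx])
        refine Submodule.mem_sup.2 ⟨f (x - ⟨E x, hEx⟩), ?_, f ⟨E x, hEx⟩,
          ⟨_, ⟨x, rfl⟩, rfl⟩, ?_⟩
        · set v : H := x - E x with hv
          have hPv : P v = v := by rw [hv, map_sub, ← h.left, hPx]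
          have hEv : E v = 0 := by rw [hv, map_sub, h.proj.apply_apply, sub_self]
          have hEQ : E (Q v) = 0 := by rw [h.right, hEv, map_zero]
          have haQ : a (Q v) = v := by
            have h1 : Q (a (Q v) - v) = 0 := by
              rw [map_sub, ha₃ _ (hQ.apply_apply v) hEQ, sub_self]
            refine sub_eq_zero.1 (h.symm.eq_zero_of_apply_eq_zero hδ ?_ ?_ h1)
            · rw [map_sub, ha₁, hPv]
            · rw [map_sub, ha₂ _ hEQ, hEv, sub_zero]
          change E ((↑u⁻¹ : H →L[ℂ] H) (Q' (P' v))) = 0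
          have h2 := hGx (Q v) (hQ.apply_apply v)
          rw [hEQ, sub_zero, map_zero, add_zero, haQ] at h2
          rw [← h2, hinv1, hEQ]
        · rw [← map_add, sub_add_cancel]
      · refine sup_le ?_ LinearMap.map_le_range
        intro y hy
        have hy' : E ((↑u⁻¹ : H →L[ℂ] H) y) = 0 := hy
        have hQy := hQu y (hQ'.mem_range_iff.1 y.2)
        have h2 := hGx _ hQy
        rw [hy', sub_zero, map_zero, add_zero, hinv2] at h2
        exact ⟨⟨a ((↑u⁻¹ : H →L[ℂ] H) y), hP.mem_range_iff.2 (ha₁ _)⟩, Subtype.ext h2.symm⟩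
    rw [heq]
    exact Submodule.isClosed_sup_finiteDimensional _ _ L.isClosed_ker
  refine ⟨hcl, ?_⟩
  rw [← toENat_rank_ker_restr hQ', ← toENat_rank_coker_restr hP' hQ' hcl, hrange, ← hker]
  exact key

end CommonCompl
end

noncomputable section

/-! ### The pairs of subspaces without common complement -/

namespace CommonCompl

open scoped InnerProductSpace
open Topology Filter

variable {H : Type*} [NormedAddCommGroup H] [InnerProductSpace ℂ H] [CompleteSpace H]
  {P Q E : H →L[ℂ] H} {δ : ℝ}

/-- On this subspace `(1 - Q) P` equals `P - Q`, which is bounded below; a compact operator bounded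
below lives on a finite-dimensional space. -/
theorem Reduces.finiteDimensional (h : Reduces δ P Q E) (hP : IsStarProjection P) (hδ₀ : 0 < δ)
    (hc : IsCompactOperator ((1 - Q) * P : H →L[ℂ] H)) :
    FiniteDimensional ℂ (P.range ⊓ E.range : Submodule ℂ H) := by
  set X : Submodule ℂ H := P.range ⊓ E.range with hX
  have : CompleteSpace X := (hP.isClosed_range.inter h.proj.isClosed_range).completeSpace_coe
  let f : X →L[ℂ] H := ((1 - Q) * P).comp X.subtypeL
  have hf : IsCompactOperator f := hc.comp_clm X.subtypeL
  have hanti : AntilipschitzWith δ.toNNReal⁻¹ f := by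
    refine f.antilipschitz_of_bound fun x => ?_
    have h1 := hP.mem_range_iff.1 x.2.1
    have h2 := h.ge x (h.proj.mem_range_iff.1 x.2.2)
    have h3 : f x = P x - Q x := by
      change P x - Q (P x) = _
      rw [h1]
    rw [h3, NNReal.coe_inv, Real.coe_toNNReal _ hδ₀.le, inv_mul_eq_div, le_div_iff₀ hδ₀, mul_comm]
    exact h2
  have hemb := hanti.isClosedEmbedding f.uniformContinuous
  obtain ⟨K, hK, hK0⟩ := hf
  exact FiniteDimensional.of_isCompactOperator_id ⟨f ⁻¹' K, hemb.isCompact_preimage hK, hK0⟩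

/-- `(1 - Q) P E` factors through ran P ∩ ran E, hence has finite rank, and it differs from `(1 - Q)
P` by at most `δ` in norm. -/
theorem isCompactOperator_of_reduces (hP : IsStarProjection P)
    (h : ∀ ε > 0, ∃ δ ≤ ε, ∃ E, 0 ≤ δ ∧ Reduces δ P Q E ∧
      FiniteDimensional ℂ (P.range ⊓ E.range : Submodule ℂ H)) :
    IsCompactOperator ((1 - Q) * P : H →L[ℂ] H) := by
  have hcl : IsClosed {f : H →L[ℂ] H | IsCompactOperator f} :=
    isClosed_setOfPred_isCompactOperator
  refine hcl.closure_subset (Metric.mem_closure_iff.2 fun ε hε => ?_)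
  obtain ⟨δ, hδ, E, hδ₀, hr, hfin⟩ := h (ε / 2) (half_pos hε)
  refine ⟨(1 - Q) * P * E, ?_, ?_⟩
  · let g : H →L[ℂ] (P.range ⊓ E.range : Submodule ℂ H) := (P * E).codRestrict _ fun x => by
      refine ⟨⟨E x, rfl⟩, ⟨P x, ?_⟩⟩
      exact hr.left x
    have : ProperSpace (P.range ⊓ E.range : Submodule ℂ H) := FiniteDimensional.proper ℂ _
    have hg : IsCompactOperator g := isCompactOperator_of_locallyCompactSpace_dom g
    exact hg.clm_comp ((1 - Q).comp (P.range ⊓ E.range : Submodule ℂ H).subtypeL)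
  · rw [dist_eq_norm]
    refine lt_of_le_of_lt (ContinuousLinearMap.opNorm_le_bound _ hδ₀ fun x => ?_)
      (hδ.trans_lt (half_lt_self hε))
    have h1 : ((1 - Q) * P - (1 - Q) * P * E) x = P (P (x - E x)) - Q (P (x - E x)) := by
      rw [hP.apply_apply, map_sub P]
      change (P x - Q (P x)) - (P (E x) - Q (P (E x))) = _
      rw [map_sub Q]
      abel
    rw [h1]
    refine (hr.le _ ?_).trans ?_
    · rw [hr.left, map_sub, hr.proj.apply_apply, sub_self, map_zero]
    · gcongr
      exact (hP.norm_apply_le _).trans (hr.proj.one_sub.norm_apply_le x)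

theorem isCompactOperator_or_of_not_hasCommonComplement [TopologicalSpace.SeparableSpace H]
    (hP : IsStarProjection P) (hQ : IsStarProjection Q)
    (h : ¬ HasCommonComplement P.range Q.range) :
    IsCompactOperator ((1 - Q) * P : H →L[ℂ] H) ∨
      IsCompactOperator ((1 - P) * Q : H →L[ℂ] H) := by
  by_contra! hcon
  have h1 := mt (isCompactOperator_of_reduces hP) hcon.1
  have h2 := mt (isCompactOperator_of_reduces hQ) hcon.2
  push Not at h1 h2
  obtain ⟨ε₁, hε₁, h1⟩ := h1
  obtain ⟨ε₂, hε₂, h2⟩ := h2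
  -- At this scale both parts are infinite-dimensional, hence of equal dimension, and a common
  -- complement exists after all.
  set δ := min (min ε₁ ε₂) (1 / 2) with hδ
  have hδ₀ : 0 < δ := by positivity
  have hδ₁ : δ < 1 := (min_le_right _ _).trans_lt (by norm_num)
  obtain ⟨E, hE⟩ := exists_reduces hP hQ hδ₀.le
  have e1 := h1 δ ((min_le_left _ _).trans (min_le_left _ _)) E hδ₀.le hE
  have e2 := h2 δ ((min_le_left _ _).trans (min_le_right _ _)) E hδ₀.le hE.symm
  refine h (hE.hasCommonComplement hP hQ hδ₀ hδ₁ ?_)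
  rw [dim_eq_top_iff.2 e1, dim_eq_top_iff.2 e2]

theorem exists_projection {S Z : Submodule ℂ H} (hS : IsClosed (S : Set H))
    (hZ : IsClosed (Z : Set H)) (h : IsCompl S Z) :
    ∃ F : H →L[ℂ] H, (∀ x, F x ∈ S) ∧ (∀ s ∈ S, F s = s) ∧ ∀ x, F x = 0 ↔ x ∈ Z := by
  have ht := Submodule.IsCompl.isTopCompl_of_isClosed h hS hZ
  refine ⟨S.subtypeL.comp (S.projectionOntoL Z ht), fun x => (S.projectionOntoL Z ht x).2,
    fun s hs => ?_, fun x => ?_⟩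
  · exact congrArg Subtype.val (Submodule.projectionOntoL_apply_left ht ⟨s, hs⟩)
  · change ((S.projectionOntoL Z ht x : S) : H) = 0 ↔ _
    rw [ZeroMemClass.coe_eq_zero]
    exact Submodule.projectionOntoL_apply_eq_zero_iff ht

/-- Two subspaces with a common complement have parts of equal dimension in the range of a suitable
reducing projection. -/
theorem HasCommonComplement.exists_reduces (hP : IsStarProjection P) (hQ : IsStarProjection Q)
    (h : HasCommonComplement P.range Q.range) :
    ∃ δ E, 0 < δ ∧ δ < 1 ∧ Reduces δ P Q E ∧
      dim (P.range ⊓ E.range) = dim (Q.range ⊓ E.range) := by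
  obtain ⟨Z, hZ, hPZ, hQZ⟩ := h
  obtain ⟨F, hF₁, hF₂, hF₃⟩ := exists_projection hQ.isClosed_range hZ hQZ
  -- Small enough that `‖F‖ * δ ≤ 1 / 4`; the section `a` has norm at most 2 on the relevant
  -- vectors, so `‖1 - G‖ ≤ 1 / 2` below.
  set δ : ℝ := 1 / (4 * (‖F‖ + 1)) with hδd
  have hF0 := norm_nonneg F
  have hδ₀ : 0 < δ := by positivity
  have hFδ : ‖F‖ * δ ≤ 1 / 4 := by
    rw [hδd, mul_one_div, div_le_iff₀ (by positivity)]
    linarith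
  have hδ₁ : δ ≤ 1 / 4 := by
    rw [hδd]
    gcongr
    linarith
  have hδ₁' : δ < 1 := by linarith
  obtain ⟨E, hE⟩ := CommonCompl.exists_reduces hP hQ hδ₀.le
  refine ⟨δ, E, hδ₀, hδ₁', hE, ?_⟩
  obtain ⟨a, ha₁, ha₂, ha₃⟩ := hE.symm.exists_section hQ hP hδ₀.le hδ₁'
  have hFQ : ∀ x, Q (F x) = F x := fun x => hQ.mem_range_iff.1 (hF₁ x)
  set G : H →L[ℂ] H := F * (a * (Q * (1 - E))) + E * Q + (1 - Q) with hG
  have hGx : ∀ x, G x = F (a (Q (x - E x))) + E (Q x) + (x - Q x) := fun x => rfl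
  have hnorm : ‖1 - G‖ < 1 := by
    refine lt_of_le_of_lt (ContinuousLinearMap.opNorm_le_bound _ (M := 1 / 2) (by norm_num)
      fun x => ?_) (by norm_num)
    set t := Q (x - E x) with ht
    have hQt : Q t = t := hQ.apply_apply _
    have hEt : E t = 0 := by
      rw [ht, hE.right, map_sub, hE.proj.apply_apply, sub_self, map_zero]
    have h1 : (1 - G) x = - F (P (a t) - Q (a t)) := by
      change x - G x = _
      have h2 : F (Q (a t)) = t := by rw [ha₃ t hQt hEt, hF₂ t (hQ.mem_range_iff.2 hQt)]
      rw [hGx, ha₁, map_sub F, h2, ← ht, ht, map_sub Q, hE.right]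
      abel
    have h3 : ‖P (a t) - Q (a t)‖ ≤ δ * ‖a t‖ := hE.le _ (ha₂ t hEt)
    have h4 : ‖a t‖ ≤ 2 * ‖t‖ := by
      have h5 : ‖a t‖ ≤ ‖P (a t) - Q (a t)‖ + ‖t‖ := by
        rw [ha₁, ha₃ t hQt hEt]
        have := norm_add_le (a t - t) t
        rwa [sub_add_cancel] at this
      have h6 := norm_nonneg (a t)
      nlinarith
    have h7 : ‖t‖ ≤ ‖x‖ :=
      (hQ.norm_apply_le _).trans (hE.proj.one_sub.norm_apply_le x)
    rw [h1, norm_neg]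
    calc ‖F (P (a t) - Q (a t))‖ ≤ ‖F‖ * (δ * (2 * ‖x‖)) := by
          refine (F.le_opNorm _).trans ?_
          gcongr
          refine h3.trans ?_
          gcongr
          linarith
      _ = (‖F‖ * δ) * (2 * ‖x‖) := by ring
      _ ≤ 1 / 4 * (2 * ‖x‖) := by gcongr
      _ = 1 / 2 * ‖x‖ := by ring
  set u := Units.oneSub (1 - G) hnorm with hu
  have huG : (u : H →L[ℂ] H) = G := by rw [hu, Units.val_oneSub, sub_sub_cancel]
  have hinv1 : ∀ x, (↑u⁻¹ : H →L[ℂ] H) (G x) = x := fun x => by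
    rw [← huG]
    exact DFunLike.congr_fun u.inv_mul x
  have hinv2 : ∀ x, G ((↑u⁻¹ : H →L[ℂ] H) x) = x := fun x => by
    rw [← huG]
    exact DFunLike.congr_fun u.mul_inv x
  -- The oblique projection `F` along the common complement is a bijection from ran P to ran Q. With
  -- `F` in place of `Q`, the index formula has zero kernel and cokernel and yields equality of
  -- dimensions.
  have hK : ∀ x ∈ P.range, F x ∈ Q.range := fun x _ => hF₁ x
  have key := (hE.rank_ker_add hP hQ hδ₁' ha₁ ha₂ ha₃ (T := Q.range) (K := F) (c := 1) (G := G) hK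
    (fun x hx => hx) ?_ ?_ ?_).2
  · have hker : (mapSub F hK).ker = ⊥ := by
      rw [Submodule.eq_bot_iff]
      intro x hx
      have h1 : F x = 0 := congrArg Subtype.val (LinearMap.mem_ker.1 hx)
      exact Subtype.ext (Submodule.disjoint_def.1 hPZ.disjoint x x.2 ((hF₃ _).1 h1))
    have hran : (mapSub F hK).range = ⊤ := by
      rw [eq_top_iff]
      intro y _
      obtain ⟨s, hs, z, hz, hsz⟩ := Submodule.mem_sup.1
        (hPZ.codisjoint.eq_top.ge (Submodule.mem_top (x := (y : H))))
      refine ⟨⟨s, hs⟩, Subtype.ext ?_⟩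
      have h1 := congrArg F hsz
      rw [map_add, (hF₃ z).2 hz, add_zero, hF₂ y y.2] at h1
      exact h1
    have : Subsingleton (Q.range ⧸ (mapSub F hK).range) :=
      Submodule.Quotient.subsingleton_iff.2 hran
    rw [hker, rank_bot, rank_subsingleton', map_zero, zero_add, add_zero] at key
    exact key.symm
  · intro t ht
    rw [hGx, map_sub Q, ← hE.right, ht]
    simp
  · intro t _ h0
    rw [← hinv1 t, h0, map_zero]
  · intro y hy
    refine ⟨(↑u⁻¹ : H →L[ℂ] H) y, ?_, hinv2 y⟩
    set t := (↑u⁻¹ : H →L[ℂ] H) y with ht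
    have h1 : G t = y := hinv2 y
    have h2 := congrArg Q h1
    rw [hQ.mem_range_iff.1 hy, ← h1, hGx, map_add Q, map_add Q, hFQ, ← hE.right, hQ.apply_apply,
      map_sub Q t (Q t), hQ.apply_apply, sub_self] at h2
    have h3 : t - Q t = 0 := (add_left_cancel h2).symm
    exact (sub_eq_zero.1 h3).symm

/-- `P - Q` fixes every vector of this intersection, and fixes its component in ker E too; as `δ <
1`, that component is zero. -/
theorem Reduces.inf_orthogonal_le (h : Reduces δ P Q E) (hP : IsStarProjection P)
    (hQ : IsStarProjection Q) (hδ : δ < 1) : P.range ⊓ Q.rangeᗮ ≤ P.range ⊓ E.range := by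
  rintro x ⟨hx1, hx2⟩
  refine ⟨hx1, h.proj.mem_range_iff.2 ?_⟩
  have h1 := hP.mem_range_iff.1 hx1
  have h2 := hQ.mem_orthogonal_iff.1 hx2
  refine (sub_eq_zero.1 (h.symm.eq_zero_of_apply_eq_zero hδ (t := x - E x) ?_ ?_ ?_)).symm
  · rw [map_sub, ← h.left, h1]
  · rw [map_sub, h.proj.apply_apply, sub_self]
  · rw [map_sub, ← h.right, h2, map_zero, sub_zero]

theorem dim_inf_orthogonal_lt_top (hP : IsStarProjection P) (hQ : IsStarProjection Q)
    (hc : IsCompactOperator ((1 - Q) * P : H →L[ℂ] H)) : dim (P.range ⊓ Q.rangeᗮ) < ⊤ := by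
  obtain ⟨E, hE⟩ := exists_reduces hP hQ (δ := 1 / 2) (by norm_num)
  exact (dim_mono (hE.inf_orthogonal_le hP hQ (by norm_num))).trans_lt
    (dim_lt_top_iff.2 (hE.finiteDimensional hP (by norm_num) hc))

theorem Reduces.index_eq (h : Reduces δ P Q E) (hP : IsStarProjection P)
    (hQ : IsStarProjection Q) (hδ₀ : 0 ≤ δ) (hδ : δ < 1)
    (hfin : FiniteDimensional ℂ (P.range ⊓ E.range : Submodule ℂ H)) :
    IsClosed ((restr P Q).range : Set Q.range) ∧
      dim (P.range ⊓ Q.rangeᗮ) + dim (Q.range ⊓ E.range) =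
        dim (P.range ⊓ E.range) + dim (P.rangeᗮ ⊓ Q.range) := by
  have := (h.eventually_index hP hQ hδ₀ hδ hfin).self_of_nhds hP hQ
  exact ⟨this.1, this.2.2⟩

theorem isClosed_range_restr (hP : IsStarProjection P) (hQ : IsStarProjection Q)
    (hc : IsCompactOperator ((1 - Q) * P : H →L[ℂ] H)) :
    IsClosed ((restr P Q).range : Set Q.range) := by
  obtain ⟨E, hE⟩ := exists_reduces hP hQ (δ := 1 / 2) (by norm_num)
  exact (hE.index_eq hP hQ (by norm_num) (by norm_num)
    (hE.finiteDimensional hP (by norm_num) hc)).1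

/-- By the index formula, finiteness of dim (ran P ∩ ran E) and of the cokernel gives finiteness of
dim (ran Q ∩ ran E) at every small scale. -/
theorem isCompactOperator_symm (hP : IsStarProjection P) (hQ : IsStarProjection Q)
    (hc : IsCompactOperator ((1 - Q) * P : H →L[ℂ] H)) (hj : dim (P.rangeᗮ ⊓ Q.range) < ⊤) :
    IsCompactOperator ((1 - P) * Q : H →L[ℂ] H) := by
  refine isCompactOperator_of_reduces hQ fun ε hε => ?_
  have hδ₀ : 0 < min ε (1 / 2) := by positivity
  have hδ₁ : min ε (1 / 2) < 1 := (min_le_right _ _).trans_lt (by norm_num)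
  obtain ⟨E, hE⟩ := exists_reduces hP hQ hδ₀.le
  have hfin := hE.finiteDimensional hP hδ₀ hc
  refine ⟨_, min_le_left _ _, E, hδ₀.le, hE.symm, dim_lt_top_iff.1 ?_⟩
  have h1 := (hE.index_eq hP hQ hδ₀.le hδ₁ hfin).2
  have h2 : dim (P.range ⊓ E.range) + dim (P.rangeᗮ ⊓ Q.range) < ⊤ :=
    WithTop.add_lt_top.2 ⟨dim_lt_top_iff.2 hfin, hj⟩
  rw [← h1] at h2
  exact (WithTop.add_lt_top.1 h2).2

theorem dim_eq_of_hasCommonComplement (hP : IsStarProjection P) (hQ : IsStarProjection Q)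
    (hc : IsCompactOperator ((1 - Q) * P : H →L[ℂ] H))
    (h : HasCommonComplement P.range Q.range) :
    dim (P.range ⊓ Q.rangeᗮ) = dim (P.rangeᗮ ⊓ Q.range) := by
  obtain ⟨δ, E, hδ₀, hδ₁, hE, hd⟩ := HasCommonComplement.exists_reduces hP hQ h
  have hfin := hE.finiteDimensional hP hδ₀ hc
  have h1 := (hE.index_eq hP hQ hδ₀.le hδ₁ hfin).2
  rw [← hd, add_comm] at h1
  exact WithTop.add_left_cancel (dim_lt_top_iff.2 hfin).ne h1

theorem hasCommonComplement_of_dim_eq [TopologicalSpace.SeparableSpace H]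
    (hP : IsStarProjection P) (hQ : IsStarProjection Q)
    (hc : IsCompactOperator ((1 - Q) * P : H →L[ℂ] H))
    (h : dim (P.range ⊓ Q.rangeᗮ) = dim (P.rangeᗮ ⊓ Q.range)) :
    HasCommonComplement P.range Q.range := by
  obtain ⟨E, hE⟩ := exists_reduces hP hQ (δ := 1 / 2) (by norm_num)
  have hfin := hE.finiteDimensional hP (by norm_num) hc
  have h1 := (hE.index_eq hP hQ (by norm_num) (by norm_num) hfin).2
  refine hE.hasCommonComplement hP hQ (by norm_num) (by norm_num) ?_
  rw [← h, add_comm (dim (P.range ⊓ E.range))] at h1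
  exact (WithTop.add_left_cancel (dim_inf_orthogonal_lt_top hP hQ hc).ne h1).symm

/-- Around a pair in `Γ` with `(1 - Q) P` compact, `Γ` is given by this condition. -/
theorem eventually_mem_gam_iff [TopologicalSpace.SeparableSpace H] (hP : IsStarProjection P)
    (hQ : IsStarProjection Q) (hc : IsCompactOperator ((1 - Q) * P : H →L[ℂ] H))
    (h : ¬ HasCommonComplement P.range Q.range) :
    ∀ᶠ x : (H →L[ℂ] H) × (H →L[ℂ] H) in 𝓝 (P, Q), x ∈ projPairs H →
      (x ∈ Gam H ↔ IsCompactOperator ((1 - x.2) * x.1 : H →L[ℂ] H)) := by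
  obtain ⟨E, hE⟩ := exists_reduces hP hQ (δ := 1 / 2) (by norm_num)
  have hfin := hE.finiteDimensional hP (by norm_num) hc
  have hs := dim_lt_top_iff.2 hfin
  filter_upwards [hE.eventually_index hP hQ (by norm_num) (by norm_num) hfin]
  rintro ⟨P', Q'⟩ hx ⟨hP', hQ'⟩
  simp only at hx hP' hQ' ⊢
  obtain ⟨-, hi, hidx⟩ := hx hP' hQ'
  have hi' := hi.trans_lt hs
  -- For nearby pairs in Γ one of the two products is compact, and finiteness of the kernel reduces
  -- the second case to the first. Conversely, a common complement nearby makes the index zero; the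
  -- index formula based at `(P, Q)` would then give a common complement there.
  constructor
  · rintro ⟨-, hn⟩
    rcases isCompactOperator_or_of_not_hasCommonComplement hP' hQ' hn with h1 | h1
    · exact h1
    · refine isCompactOperator_symm hQ' hP' h1 ?_
      rwa [inf_comm]
  · intro hc'
    refine ⟨⟨hP', hQ'⟩, fun hn => h ?_⟩
    have h1 := dim_eq_of_hasCommonComplement hP' hQ' hc' hn
    refine hE.hasCommonComplement hP hQ (by norm_num) (by norm_num) ?_
    rw [← h1, add_comm (dim (P.range ⊓ E.range))] at hidx
    exact (WithTop.add_left_cancel hi'.ne hidx).symm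

/-- With `F` the projection onto ran P along `Z`, the operators `1 - F + P' F` and `F P' + 1 - P'`
are the identity at `P' = P`. Invertibility of the first gives ran P' + `Z` = `H`, of the second
gives trivial intersection. -/
theorem eventually_isCompl (hP : IsStarProjection P) {Z : Submodule ℂ H}
    (hZ : IsClosed (Z : Set H)) (h : IsCompl P.range Z) :
    ∀ᶠ P' in 𝓝 P, IsStarProjection P' → IsCompl P'.range Z := by
  obtain ⟨F, hF₁, hF₂, hF₃⟩ := exists_projection hP.isClosed_range hZ h
  have hPF : P * F = F := by
    ext x
    exact hP.mem_range_iff.1 (hF₁ x)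
  have hFP : F * P = P := by
    ext x
    exact hF₂ _ ⟨x, rfl⟩
  have hFF : ∀ x, F (F x) = F x := fun x => hF₂ _ (hF₁ x)
  have h1 : ∀ᶠ P' in 𝓝 P, IsUnit ((1 - F) + P' * F) := by
    have hc : Continuous fun P' : H →L[ℂ] H => (1 - F) + P' * F := by fun_prop
    refine hc.continuousAt.eventually (Units.isOpen.mem_nhds ?_)
    change IsUnit ((1 - F) + P * F)
    rw [hPF, sub_add_cancel]
    exact isUnit_one
  have h2 : ∀ᶠ P' in 𝓝 P, IsUnit (F * P' + (1 - P')) := by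
    have hc : Continuous fun P' : H →L[ℂ] H => F * P' + (1 - P') := by fun_prop
    refine hc.continuousAt.eventually (Units.isOpen.mem_nhds ?_)
    change IsUnit (F * P + (1 - P))
    rw [hFP, add_sub_cancel]
    exact isUnit_one
  filter_upwards [h1, h2] with P' h1 h2 hP'
  constructor
  · rw [Submodule.disjoint_def]
    intro x hx hxZ
    have hPx := hP'.mem_range_iff.1 hx
    have hFx := (hF₃ x).2 hxZ
    refine ((ContinuousLinearMap.isUnit_iff_bijective.1 h2).1 ?_)
    rw [map_zero]
    change F (P' x) + (x - P' x) = 0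
    rw [hPx, hFx, sub_self, add_zero]
  · rw [codisjoint_iff_le_sup]
    intro x _
    obtain ⟨y, rfl⟩ := (ContinuousLinearMap.isUnit_iff_bijective.1 h1).2 x
    refine Submodule.mem_sup.2 ⟨P' (F y), ⟨_, rfl⟩, y - F y, ?_, ?_⟩
    · rw [← hF₃, map_sub, hFF, sub_self]
    · exact add_comm _ _

theorem isClosed_setOf_isStarProjection : IsClosed {P : H →L[ℂ] H | IsStarProjection P} := by
  have : {P : H →L[ℂ] H | IsStarProjection P} = {P | P * P = P} ∩ {P | star P = P} := by
    ext P
    exact ⟨fun h => ⟨h.1, h.2⟩, fun h => ⟨h.1, h.2⟩⟩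
  rw [this]
  exact (isClosed_eq (by fun_prop) continuous_id).inter (isClosed_eq continuous_star continuous_id)

theorem isClosed_gam : IsClosed (Gam H) := by
  rw [← isOpen_compl_iff, isOpen_iff_mem_nhds]
  rintro ⟨P, Q⟩ hx
  have hcl : IsClosed (projPairs H) :=
    (isClosed_setOf_isStarProjection.preimage continuous_fst).inter
      (isClosed_setOf_isStarProjection.preimage continuous_snd)
  by_cases hp : (P, Q) ∈ projPairs H
  · have hc : HasCommonComplement P.range Q.range := by
      by_contra hn
      exact hx ⟨hp, hn⟩
    obtain ⟨Z, hZ, h1, h2⟩ := hc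
    have e1 := (continuous_fst.tendsto (P, Q)).eventually
      (eventually_isCompl hp.1 hZ h1)
    have e2 := (continuous_snd.tendsto (P, Q)).eventually
      (eventually_isCompl hp.2 hZ h2)
    filter_upwards [e1, e2] with y h1 h2 hy
    exact hy.2 ⟨Z, hZ, h1 hy.1.1, h2 hy.1.2⟩
  · filter_upwards [hcl.isOpen_compl.mem_nhds hp] with y hy hy'
    exact hy hy'.1

/-- The trivial reducing projection `E = 0` applies, and ran Q is then mapped bijectively onto ran
P. -/
theorem dim_eq_of_norm_sub_lt (hP : IsStarProjection P) (hQ : IsStarProjection Q)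
    (h : ‖P - Q‖ < 1) : dim Q.range = dim P.range ∧ dim Q.rangeᗮ = dim P.rangeᗮ := by
  have key : ∀ {P Q : H →L[ℂ] H}, IsStarProjection P → IsStarProjection Q → ‖P - Q‖ < 1 →
      dim Q.range = dim P.range := by
    intro P Q hP hQ h
    have := (reduces_zero (le_refl ‖P - Q‖)).dim_inf_orthogonal hP hQ (norm_nonneg _) h
    have h0 : ((0 : H →L[ℂ] H)).rangeᗮ = ⊤ := by
      rw [eq_top_iff]
      exact fun x _ => (IsStarProjection.zero (H →L[ℂ] H)).mem_orthogonal_iff.2 rfl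
    rwa [h0, inf_top_eq, inf_top_eq] at this
  refine ⟨key hP hQ h, ?_⟩
  rw [← range_one_sub hP, ← range_one_sub hQ]
  refine key hP.one_sub hQ.one_sub ?_
  rwa [sub_sub_sub_cancel_left, norm_sub_rev]

end CommonCompl
end

noncomputable section

/-! ### The pieces of `Γ` -/

namespace CommonCompl

open Topology Filter

theorem HasCommonComplement.symm {H : Type*} [NormedAddCommGroup H]
    [InnerProductSpace ℂ H] {S T : Submodule ℂ H} (h : HasCommonComplement S T) : HasCommonComplement T S := by
  obtain ⟨Z, hZ, h1, h2⟩ := h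
  exact ⟨Z, hZ, h2, h1⟩

variable {H : Type*} [NormedAddCommGroup H] [InnerProductSpace ℂ H] [CompleteSpace H]
  {P Q E : H →L[ℂ] H} {δ : ℝ} {x : (H →L[ℂ] H) × (H →L[ℂ] H)}

theorem swap_mem_projPairs : x.swap ∈ projPairs H ↔ x ∈ projPairs H := and_comm

theorem swap_mem_gam : x.swap ∈ Gam H ↔ x ∈ Gam H :=
  and_congr swap_mem_projPairs (not_congr ⟨.symm, .symm⟩)

theorem swap_mem_gamInfInf : x.swap ∈ GamInfInf H ↔ x ∈ GamInfInf H :=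
  and_congr swap_mem_gam and_comm

theorem swap_mem_gamInfL : x.swap ∈ GamInfL H ↔ x ∈ GamInfR H := by
  refine and_congr swap_mem_gamInfInf (and_comm.trans ?_)
  simp only [Prod.fst_swap, Prod.snd_swap]
  rw [inf_comm, inf_comm x.2.range]

/-- Both subspaces are copies of `H ⧸ Z`, and both orthogonal complements are copies of `Z`. -/
theorem HasCommonComplement.dim_eq (hP : IsStarProjection P) (hQ : IsStarProjection Q)
    (h : HasCommonComplement P.range Q.range) :
    dim P.range = dim Q.range ∧ dim P.rangeᗮ = dim Q.rangeᗮ := by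
  obtain ⟨Z, -, h1, h2⟩ := h
  have := hP.completeSpace_range
  have := hQ.completeSpace_range
  have e1 := (Submodule.quotientEquivOfIsCompl _ _ h1.symm).symm.trans
    (Submodule.quotientEquivOfIsCompl _ _ h2.symm)
  have e2 := (Submodule.quotientEquivOfIsCompl _ _
    P.range.isCompl_orthogonal).symm.trans
    (Submodule.quotientEquivOfIsCompl _ _ h1)
  have e3 := (Submodule.quotientEquivOfIsCompl _ _
    Q.range.isCompl_orthogonal).symm.trans
    (Submodule.quotientEquivOfIsCompl _ _ h2)
  exact ⟨congrArg Cardinal.toENat e1.rank_eq,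
    congrArg Cardinal.toENat (e2.rank_eq.trans e3.rank_eq.symm)⟩

theorem Reduces.dim_inf_eq_of_dim_eq (h : Reduces δ P Q E) (hP : IsStarProjection P)
    (hQ : IsStarProjection Q) (hδ₀ : 0 ≤ δ) (hδ : δ < 1) (hd : dim P.range = dim Q.range)
    (hf : dim P.range ≠ ⊤) : dim (P.range ⊓ E.range) = dim (Q.range ⊓ E.range) := by
  rw [h.dim_range hP] at hf
  rw [h.dim_range hP, h.symm.dim_range hQ, h.dim_inf_orthogonal hP hQ hδ₀ hδ] at hd
  exact WithTop.add_right_cancel (fun h0 => hf (WithTop.add_eq_top.2 (.inr h0))) hd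

theorem hasCommonComplement_of_dim_range_eq [TopologicalSpace.SeparableSpace H]
    (hP : IsStarProjection P) (hQ : IsStarProjection Q) (hd : dim P.range = dim Q.range)
    (hf : dim P.range ≠ ⊤) : HasCommonComplement P.range Q.range := by
  obtain ⟨E, hE⟩ := exists_reduces hP hQ (δ := 1 / 2) (by norm_num)
  exact hE.hasCommonComplement hP hQ (by norm_num) (by norm_num)
    (hE.dim_inf_eq_of_dim_eq hP hQ (by norm_num) (by norm_num) hd hf)

/-- Pass to `1 - P` and `1 - Q`, reduced by the same `E`, and return through
`Reduces.dim_orthogonal_inf`. -/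
theorem hasCommonComplement_of_dim_orthogonal_eq [TopologicalSpace.SeparableSpace H]
    (hP : IsStarProjection P) (hQ : IsStarProjection Q) (hd : dim P.rangeᗮ = dim Q.rangeᗮ)
    (hf : dim P.rangeᗮ ≠ ⊤) : HasCommonComplement P.range Q.range := by
  obtain ⟨E, hE⟩ := exists_reduces hP hQ (δ := 1 / 2) (by norm_num)
  refine hE.hasCommonComplement hP hQ (by norm_num) (by norm_num) ?_
  have h1 := hE.one_sub.dim_inf_eq_of_dim_eq hP.one_sub hQ.one_sub (by norm_num) (by norm_num)
  rw [range_one_sub hP, range_one_sub hQ] at h1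
  rw [hE.dim_orthogonal_inf hP hQ (by norm_num) (by norm_num),
    hE.symm.dim_orthogonal_inf hQ hP (by norm_num) (by norm_num), h1 hd hf]

theorem isCompactOperator_of_mem_gam [TopologicalSpace.SeparableSpace H]
    (hx : x ∈ Gam H) (hi : dim (x.1.range ⊓ x.2.rangeᗮ) < ⊤) :
    IsCompactOperator ((1 - x.2) * x.1 : H →L[ℂ] H) := by
  obtain ⟨⟨hP, hQ⟩, hn⟩ := hx
  rcases isCompactOperator_or_of_not_hasCommonComplement hP hQ hn with h | h
  · exact h
  · refine isCompactOperator_symm hQ hP h ?_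
    rwa [inf_comm]

theorem mem_gam1n [TopologicalSpace.SeparableSpace H] (hx : x ∈ GamInfInf H) {i j : ℕ}
    (hi : dim (x.1.range ⊓ x.2.rangeᗮ) = i) (hj : dim (x.1.rangeᗮ ⊓ x.2.range) = j) :
    x ∈ Gam1n H (i - j) := by
  have hi' : dim (x.1.range ⊓ x.2.rangeᗮ) < ⊤ := hi ▸ ENat.natCast_lt_top i
  have hj' : dim (x.1.rangeᗮ ⊓ x.2.range) < ⊤ := hj ▸ ENat.natCast_lt_top j
  obtain ⟨hP, hQ⟩ := hx.1.1
  have hcl := isClosed_range_restr hP hQ (isCompactOperator_of_mem_gam hx.1 hi')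
  exact ⟨⟨hx, hi', hj'⟩, isFredholm_restr hP hQ hcl hi' hj', index_restr hP hQ hcl hi hj⟩

theorem piece_subset_gam (a : PieceIndex) : piece H a ⊆ Gam H := by
  rintro x hx
  cases a with
  | full i j k l h =>
    refine ⟨⟨hx.1.1, hx.2.1⟩, fun hc => h ?_⟩
    have := hc.dim_eq hx.1.1 hx.2.1
    rw [← hx.1.2.1, ← hx.1.2.2, this.1, this.2, hx.2.2.1, hx.2.2.2]
  | fredholm n h => exact hx.1.1.1
  | left => exact hx.1.1
  | right => exact hx.1.1

theorem gam_eq_iUnion [TopologicalSpace.SeparableSpace H] : Gam H = ⋃ a, piece H a := by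
  refine subset_antisymm ?_ (Set.iUnion_subset piece_subset_gam)
  intro x hx
  obtain ⟨⟨hP, hQ⟩, hn⟩ := id hx
  rw [Set.mem_iUnion]
  by_cases hd : (dim x.1.range, dim x.1.rangeᗮ) = (dim x.2.range, dim x.2.rangeᗮ)
  swap
  · exact ⟨.full _ _ _ _ hd, ⟨hP, rfl, rfl⟩, ⟨hQ, rfl, rfl⟩⟩
  rw [Prod.mk.injEq] at hd
  have h1 : dim x.1.range = ⊤ := by
    by_contra h
    exact hn (hasCommonComplement_of_dim_range_eq hP hQ hd.1 h)
  have h2 : dim x.1.rangeᗮ = ⊤ := by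
    by_contra h
    exact hn (hasCommonComplement_of_dim_orthogonal_eq hP hQ hd.2 h)
  have hinf : x ∈ GamInfInf H :=
    ⟨hx, ⟨hP, h1, h2⟩, ⟨hQ, hd.1.symm.trans h1, hd.2.symm.trans h2⟩⟩
  rcases eq_or_ne (dim (x.1.range ⊓ x.2.rangeᗮ)) ⊤ with hi | hi <;>
    rcases eq_or_ne (dim (x.1.rangeᗮ ⊓ x.2.range)) ⊤ with hj | hj
  -- Outside common complements one of the two products is compact, which makes one of the two
  -- intersections finite-dimensional.
  · exfalso
    rcases isCompactOperator_or_of_not_hasCommonComplement hP hQ hn with h | h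
    · exact (dim_inf_orthogonal_lt_top hP hQ h).ne hi
    · rw [inf_comm] at hj
      exact (dim_inf_orthogonal_lt_top hQ hP h).ne hj
  · exact ⟨.right, hinf, hi, hj.lt_top⟩
  · exact ⟨.left, hinf, hi.lt_top, hj⟩
  · obtain ⟨i, hi'⟩ := ENat.ne_top_iff_exists.1 hi
    obtain ⟨j, hj'⟩ := ENat.ne_top_iff_exists.1 hj
    refine ⟨.fredholm (i - j) ?_, mem_gam1n hinf hi'.symm hj'.symm⟩
    intro h0
    have hij : i = j := by omega
    refine hn (hasCommonComplement_of_dim_eq hP hQ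
      (isCompactOperator_of_mem_gam hx hi.lt_top) ?_)
    rw [← hi', ← hj', hij]

theorem full_or_gamInfInf {a : PieceIndex} (hx : x ∈ piece H a) :
    (∃ i j k l h, a = .full i j k l h) ∨ x ∈ GamInfInf H := by
  cases a with
  | full i j k l h => exact .inl ⟨i, j, k, l, h, rfl⟩
  | fredholm n h => exact .inr hx.1.1
  | left => exact .inr hx.1
  | right => exact .inr hx.1

theorem notMem_full_of_mem_gamInfInf (hx : x ∈ GamInfInf H) {i j k l : ℕ∞}
    (h : (i, j) ≠ (k, l)) : x ∉ piece H (.full i j k l h) := by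
  intro hx'
  apply h
  rw [← hx'.1.2.1, ← hx'.1.2.2, ← hx'.2.2.1, ← hx'.2.2.2, hx.2.1.2.1, hx.2.1.2.2, hx.2.2.2.1,
    hx.2.2.2.2]

theorem pairwise_disjoint_piece :
    Pairwise (fun a b => Disjoint (piece H a) (piece H b)) := by
  intro a b hab
  rw [Set.disjoint_left]
  intro x ha hb
  rcases full_or_gamInfInf ha with ⟨i, j, k, l, h, rfl⟩ | hxa
  · rcases full_or_gamInfInf hb with ⟨i', j', k', l', h', rfl⟩ | hxb
    · apply hab
      obtain ⟨⟨-, rfl, rfl⟩, -, rfl, rfl⟩ := ha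
      obtain ⟨⟨-, rfl, rfl⟩, -, rfl, rfl⟩ := hb
      rfl
    · exact notMem_full_of_mem_gamInfInf hxb h ha
  rcases full_or_gamInfInf hb with ⟨i', j', k', l', h', rfl⟩ | hxb
  · exact notMem_full_of_mem_gamInfInf hxa h' hb
  cases a <;> cases b <;> first
    | exact notMem_full_of_mem_gamInfInf hxa _ ha
    | exact notMem_full_of_mem_gamInfInf hxa _ hb
    | exact hab rfl
    | skip
  · obtain ⟨-, -, rfl⟩ := ha
    obtain ⟨-, -, rfl⟩ := hb
    exact hab rfl
  · exact ha.1.2.2.ne hb.2.2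
  · exact ha.1.2.1.ne hb.2.1
  · exact hb.1.2.2.ne ha.2.2
  · exact ha.2.1.ne hb.2.1
  · exact hb.1.2.1.ne ha.2.1
  · exact hb.2.1.ne ha.2.1

theorem eventually_dim_eq (hx : x ∈ projPairs H) : ∀ᶠ y in 𝓝 x, y ∈ projPairs H →
    (dim y.1.range = dim x.1.range ∧ dim y.1.rangeᗮ = dim x.1.rangeᗮ) ∧
      (dim y.2.range = dim x.2.range ∧ dim y.2.rangeᗮ = dim x.2.rangeᗮ) := by
  filter_upwards [Metric.ball_mem_nhds x one_pos] with y hy hyp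
  rw [Metric.mem_ball, dist_comm, Prod.dist_eq, max_lt_iff, dist_eq_norm, dist_eq_norm] at hy
  exact ⟨dim_eq_of_norm_sub_lt hx.1 hyp.1 hy.1, dim_eq_of_norm_sub_lt hx.2 hyp.2 hy.2⟩

theorem eventually_mem_full {i j k l : ℕ∞} (hx : x ∈ projOfRank H i j ×ˢ projOfRank H k l) :
    ∀ᶠ y in 𝓝 x, y ∈ projPairs H → y ∈ projOfRank H i j ×ˢ projOfRank H k l := by
  filter_upwards [eventually_dim_eq ⟨hx.1.1, hx.2.1⟩] with y hy hyp
  obtain ⟨h1, h2⟩ := hy hyp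
  exact ⟨⟨hyp.1, h1.1.trans hx.1.2.1, h1.2.trans hx.1.2.2⟩,
    ⟨hyp.2, h2.1.trans hx.2.2.1, h2.2.trans hx.2.2.2⟩⟩

theorem eventually_mem_gamInfInf (hx : x ∈ GamInfInf H) :
    ∀ᶠ y in 𝓝 x, y ∈ Gam H → y ∈ GamInfInf H := by
  filter_upwards [eventually_mem_full hx.2] with y hy hyG
  exact ⟨hyG, hy hyG.1⟩

/-- The infinite cokernel forces dim (ran Q ∩ ran E) = ∞ at the base point; the index formula then
gives an infinite cokernel at every nearby pair, while the kernel stays bounded by dim (ran P ∩ ran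
E). -/
theorem eventually_mem_gamInfL [TopologicalSpace.SeparableSpace H] (hx : x ∈ GamInfL H) :
    ∀ᶠ y in 𝓝 x, y ∈ Gam H → y ∈ GamInfL H := by
  obtain ⟨hinf, hi, hj⟩ := id hx
  obtain ⟨hP, hQ⟩ := hinf.1.1
  obtain ⟨E, hE⟩ := exists_reduces hP hQ (δ := 1 / 2) (by norm_num)
  have hfin := hE.finiteDimensional hP (by norm_num)
    (isCompactOperator_of_mem_gam hinf.1 hi)
  have hs := dim_lt_top_iff.2 hfin
  have h0 := (hE.index_eq hP hQ (by norm_num) (by norm_num) hfin).2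
  rw [hj, add_top] at h0
  have ht := (WithTop.add_eq_top.1 h0).resolve_left hi.ne
  filter_upwards [eventually_mem_gamInfInf hinf,
    hE.eventually_index hP hQ (by norm_num) (by norm_num) hfin] with y hy hyi hyG
  obtain ⟨-, h1, h2⟩ := hyi hyG.1.1 hyG.1.2
  refine ⟨hy hyG, h1.trans_lt hs, ?_⟩
  have h3 := h2.symm.trans (WithTop.add_eq_top.2 (.inr ht))
  exact (WithTop.add_eq_top.1 h3).resolve_left hs.ne

theorem eventually_mem_gamInfR [TopologicalSpace.SeparableSpace H] (hx : x ∈ GamInfR H) :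
    ∀ᶠ y in 𝓝 x, y ∈ Gam H → y ∈ GamInfR H := by
  have h := eventually_mem_gamInfL (swap_mem_gamInfL.2 hx)
  filter_upwards [(continuous_swap.tendsto x).eventually h] with y hy hyG
  exact swap_mem_gamInfL.1 (hy (swap_mem_gam.2 hyG))

/-- Here all dimensions are finite, and the index equals dim (ran P ∩ ran E) - dim (ran Q ∩ ran E)
at the base point and at nearby pairs alike. -/
theorem eventually_mem_gam1n [TopologicalSpace.SeparableSpace H] {n : ℤ} (hx : x ∈ Gam1n H n) :
    ∀ᶠ y in 𝓝 x, y ∈ Gam H → y ∈ Gam1n H n := by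
  obtain ⟨⟨hinf, hi, hj⟩, -, hn⟩ := id hx
  obtain ⟨hP, hQ⟩ := hinf.1.1
  obtain ⟨E, hE⟩ := exists_reduces hP hQ (δ := 1 / 2) (by norm_num)
  have hfin := hE.finiteDimensional hP (by norm_num)
    (isCompactOperator_of_mem_gam hinf.1 hi)
  have hs := dim_lt_top_iff.2 hfin
  obtain ⟨hcl, h0⟩ := hE.index_eq hP hQ (by norm_num) (by norm_num) hfin
  have ht : dim (x.2.range ⊓ E.range) < ⊤ :=
    (WithTop.add_lt_top.1 (h0 ▸ WithTop.add_lt_top.2 ⟨hs, hj⟩)).2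
  obtain ⟨i, hi'⟩ := ENat.ne_top_iff_exists.1 hi.ne
  obtain ⟨j, hj'⟩ := ENat.ne_top_iff_exists.1 hj.ne
  obtain ⟨s, hs'⟩ := ENat.ne_top_iff_exists.1 hs.ne
  obtain ⟨t, ht'⟩ := ENat.ne_top_iff_exists.1 ht.ne
  rw [index_restr hP hQ hcl hi'.symm hj'.symm] at hn
  rw [← hi', ← hj', ← hs', ← ht'] at h0
  norm_cast at h0
  filter_upwards [eventually_mem_gamInfInf hinf,
    hE.eventually_index hP hQ (by norm_num) (by norm_num) hfin] with y hy hyi hyG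
  obtain ⟨-, h1, h2⟩ := hyi hyG.1.1 hyG.1.2
  have hi₂ := h1.trans_lt hs
  have hj₂ := (WithTop.add_lt_top.1 (h2 ▸ WithTop.add_lt_top.2 ⟨hi₂, ht⟩)).2
  obtain ⟨i₂, hi₂'⟩ := ENat.ne_top_iff_exists.1 hi₂.ne
  obtain ⟨j₂, hj₂'⟩ := ENat.ne_top_iff_exists.1 hj₂.ne
  rw [← hi₂', ← hj₂', ← hs', ← ht'] at h2
  norm_cast at h2
  have : n = (i₂ : ℤ) - j₂ := by omega
  rw [this]
  exact mem_gam1n (hy hyG) hi₂'.symm hj₂'.symm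

theorem eventually_mem_piece [TopologicalSpace.SeparableSpace H] {a : PieceIndex}
    (hx : x ∈ piece H a) : ∀ᶠ y in 𝓝 x, y ∈ Gam H → y ∈ piece H a := by
  cases a with
  | full i j k l h =>
    filter_upwards [eventually_mem_full hx] with y hy hyG using hy hyG.1
  | fredholm n h => exact eventually_mem_gam1n hx
  | left => exact eventually_mem_gamInfL hx
  | right => exact eventually_mem_gamInfR hx

theorem exists_isOpen_piece_eq [TopologicalSpace.SeparableSpace H] (a : PieceIndex) :
    ∃ U : Set ((H →L[ℂ] H) × (H →L[ℂ] H)), IsOpen U ∧ piece H a = Gam H ∩ U := by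
  refine ⟨interior {y | y ∈ Gam H → y ∈ piece H a}, isOpen_interior, ?_⟩
  ext x
  refine ⟨fun hx => ⟨piece_subset_gam a hx, mem_interior_iff_mem_nhds.2 (eventually_mem_piece hx)⟩,
    fun hx => interior_subset hx.2 hx.1⟩

end CommonCompl
end

noncomputable section

/-! ### The submanifold structure of `Γ` -/

namespace CommonCompl

open Topology Filter ProjChart BanachSub

/-- The compact operators, as a real subspace of `B(H)`. -/
def compacts (H : Type*) [NormedAddCommGroup H] [InnerProductSpace ℂ H] :
    Submodule ℝ (H →L[ℂ] H) :=
  (compactOperator (RingHom.id ℂ) H H).restrictScalars ℝ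

theorem mem_compacts {H : Type*} [NormedAddCommGroup H] [InnerProductSpace ℂ H] {f : H →L[ℂ] H} :
    f ∈ compacts H ↔ IsCompactOperator f := Iff.rfl

variable {H : Type*} [NormedAddCommGroup H] [InnerProductSpace ℂ H] [CompleteSpace H]
  {x : (H →L[ℂ] H) × (H →L[ℂ] H)}

theorem isClosed_compacts : IsClosed (compacts H : Set (H →L[ℂ] H)) :=
  isClosed_setOfPred_isCompactOperator

/-- Used with two ideals: the compact operators on `GamInfInf`, and the whole algebra on the pieces
of unequal dimension data. -/
theorem exists_isFlattening_gam_of_eventually {J : Submodule ℝ (H →L[ℂ] H)}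
    (hJ : IsClosed (J : Set (H →L[ℂ] H))) (hl : ∀ a, ∀ f ∈ J, a * f ∈ J)
    (hr : ∀ a, ∀ f ∈ J, f * a ∈ J) (hx : x ∈ projPairs H) (h0 : (1 - x.2) * x.1 ∈ J)
    (h : ∀ᶠ y in 𝓝 x, y ∈ projPairs H → (y ∈ Gam H ↔ (1 - y.2) * y.1 ∈ J)) :
    ∃ φ, IsFlattening (Gam H) (projPairs H) x φ (idealCorner x.1 x.2 J)
      ((corner x.1).prod (corner x.2)) := by
  obtain ⟨φ, hφ⟩ := exists_isFlattening hx.1 hx.2 hJ hl hr h0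
  obtain ⟨U, hU, hUo, hxU⟩ := eventually_nhds_iff.1 h
  refine ⟨_, hφ.restrOpen hUo hxU (fun y hy => ?_) fun y _ => Iff.rfl⟩
  exact ⟨fun h => ⟨h.1, (hU y hy h.1).1 h⟩, fun h => (hU y hy h.1).2 h.2⟩

theorem exists_isFlattening_gam_of_isCompactOperator [TopologicalSpace.SeparableSpace H]
    (hx : x ∈ Gam H) (hc : IsCompactOperator ((1 - x.2) * x.1 : H →L[ℂ] H)) :
    ∃ φ, IsFlattening (Gam H) (projPairs H) x φ (idealCorner x.1 x.2 (compacts H))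
      ((corner x.1).prod (corner x.2)) :=
  exists_isFlattening_gam_of_eventually isClosed_compacts
    (fun a _ hf => mem_compacts.2 (IsCompactOperator.clm_comp hf a))
    (fun a _ hf => mem_compacts.2 (IsCompactOperator.comp_clm hf a)) hx.1 hc
    (eventually_mem_gam_iff hx.1.1 hx.1.2 hc hx.2)

variable (H) in
/-- The flip of `B(H) × B(H)`. -/
def flip : ((H →L[ℂ] H) × (H →L[ℂ] H)) ≃L[ℝ] (H →L[ℂ] H) × (H →L[ℂ] H) :=
  ContinuousLinearEquiv.prodComm ℝ _ _

theorem flip_preimage_gam : flip H ⁻¹' Gam H = Gam H := Set.ext fun _ => swap_mem_gam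

theorem flip_preimage_projPairs : flip H ⁻¹' projPairs H = projPairs H :=
  Set.ext fun _ => swap_mem_projPairs

/-- Around every point of `Γ_{∞,∞}`, up to the flip, `Γ` is modelled on the pairs of off-diagonal
operators whose first component is compact modulo `Q`. -/
theorem exists_isFlattening_gamInfInf [TopologicalSpace.SeparableSpace H] (hx : x ∈ GamInfInf H) :
    ∃ (e : ((H →L[ℂ] H) × (H →L[ℂ] H)) ≃L[ℝ] (H →L[ℂ] H) × (H →L[ℂ] H))
      (y : (H →L[ℂ] H) × (H →L[ℂ] H)), y ∈ GamInfInf H ∧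
      IsCompactOperator ((1 - y.2) * y.1 : H →L[ℂ] H) ∧
      ∃ φ, IsFlattening (Gam H) (projPairs H) x φ
        ((idealCorner y.1 y.2 (compacts H)).comap (e : _ →ₗ[ℝ] _))
        (((corner y.1).prod (corner y.2)).comap (e : _ →ₗ[ℝ] _)) := by
  have hn := hx.1.2
  rcases isCompactOperator_or_of_not_hasCommonComplement hx.1.1.1 hx.1.1.2 hn with h | h
  · obtain ⟨φ, hφ⟩ := exists_isFlattening_gam_of_isCompactOperator hx.1 h
    exact ⟨.refl ℝ _, x, hx, h, φ, hφ⟩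
  · obtain ⟨φ, hφ⟩ := exists_isFlattening_gam_of_isCompactOperator (x := x.swap)
      (swap_mem_gam.2 hx.1) h
    have := hφ.conj (flip H)
    rw [flip_preimage_gam, flip_preimage_projPairs] at this
    exact ⟨flip H, x.swap, swap_mem_gamInfInf.2 hx, h, _, this⟩

theorem exists_isFlattening_gam [TopologicalSpace.SeparableSpace H] (hx : x ∈ Gam H) :
    ∃ φ F G, IsFlattening (Gam H) (projPairs H) x φ F G := by
  have hx' := hx
  rw [gam_eq_iUnion, Set.mem_iUnion] at hx'
  obtain ⟨a, ha⟩ := hx'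
  rcases full_or_gamInfInf ha with ⟨i, j, k, l, h, rfl⟩ | hinf
  -- Near such a point every pair of projections lies in Γ, so the ideal condition is void.
  · obtain ⟨φ, hφ⟩ := exists_isFlattening_gam_of_eventually (J := ⊤) isClosed_univ
      (fun _ _ _ => trivial) (fun _ _ _ => trivial) hx.1 trivial (by
        filter_upwards [eventually_mem_full ha] with y hy hyp
        exact ⟨fun _ => trivial, fun _ => piece_subset_gam (.full i j k l h) (hy hyp)⟩)
    exact ⟨φ, _, _, hφ⟩
  · obtain ⟨_, _, _, _, φ, hφ⟩ := exists_isFlattening_gamInfInf hinf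
    exact ⟨φ, _, _, hφ⟩

theorem isSubmanifoldOf_gam [TopologicalSpace.SeparableSpace H]
    {N : Set ((H →L[ℂ] H) × (H →L[ℂ] H))} (hN : N = Set.univ ∨ N = projPairs H) :
    IsSubmanifoldOf (Gam H) N := by
  rcases hN with rfl | rfl
  · refine ⟨Set.subset_univ _, fun x hx => ?_⟩
    obtain ⟨φ, F, G, h⟩ := exists_isFlattening_gam hx
    exact ⟨φ, F, ⊤, h.univ⟩
  · exact ⟨fun x hx => hx.1, fun x hx => exists_isFlattening_gam hx⟩

theorem isSubmanifoldOf_piece [TopologicalSpace.SeparableSpace H]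
    {N : Set ((H →L[ℂ] H) × (H →L[ℂ] H))} (hN : N = Set.univ ∨ N = projPairs H)
    (a : PieceIndex) : IsSubmanifoldOf (piece H a) N := by
  obtain ⟨U, hU, h⟩ := exists_isOpen_piece_eq (H := H) a
  rw [h]
  exact (isSubmanifoldOf_gam hN).inter_open hU

end CommonCompl
end

noncomputable section

/-! ### Operators on bounded sequences that vanish on finitely supported sequences -/

namespace BoundedSeq

open scoped lp ENNReal

/-- The indicator of a set of natural numbers, as a bounded sequence. -/
def ind (A : Set ℕ) : ℓ^∞(ℕ, ℂ) :=
  ⟨A.indicator 1, memℓp_infty ⟨1, by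
    rintro _ ⟨n, rfl⟩
    exact (norm_indicator_le_norm_self _ _).trans (by simp)⟩⟩

theorem ind_apply (A : Set ℕ) (n : ℕ) : ind A n = A.indicator 1 n := rfl

/-- The codes of the initial segments of `α`. -/
def branch (α : ℕ → Bool) : Set ℕ :=
  Set.range fun n => Encodable.encode ((List.range n).map α)

theorem infinite_branch (α : ℕ → Bool) : (branch α).Infinite := by
  refine Set.infinite_range_of_injective fun m n h => ?_
  have := congrArg List.length (Encodable.encode_injective h)
  simpa using this

/-- Common codes come from common initial segments, whose length is at most the place of a
disagreement. -/
theorem finite_branch_inter {α β : ℕ → Bool} (h : α ≠ β) : (branch α ∩ branch β).Finite := by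
  obtain ⟨k, hk⟩ := Function.ne_iff.1 h
  refine ((Set.finite_Iic k).image
    fun n => Encodable.encode ((List.range n).map α)).subset ?_
  rintro _ ⟨⟨n, rfl⟩, ⟨m, hm⟩⟩
  refine ⟨n, ?_, rfl⟩
  have h1 := Encodable.encode_injective hm
  have h2 : m = n := by simpa using congrArg List.length h1
  subst h2
  rw [Set.mem_Iic]
  by_contra! hlt
  exact hk (List.map_inj_left.1 h1 k (List.mem_range.2 hlt)).symm

/-- The branches form an uncountable almost disjoint family. If `L` killed none of their indicators,
some single functional would be bounded away from zero on infinitely many of them; signed sums of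
these, made disjoint by deleting finite sets, have norm at most 1 but arbitrarily large image. -/
theorem exists_infinite_apply_ind_eq_zero {Y : Type*} [NormedAddCommGroup Y] [NormedSpace ℝ Y]
    {ι : Type*} [Countable ι] (f : ι → Y →L[ℝ] ℝ) (hf : ∀ v, (∀ i, f i v = 0) → v = 0)
    (L : ℓ^∞(ℕ, ℂ) →L[ℝ] Y) (hL : ∀ a : ℓ^∞(ℕ, ℂ), {n | a n ≠ 0}.Finite → L a = 0) :
    ∃ A : Set ℕ, A.Infinite ∧ L (ind A) = 0 := by
  by_contra! hcon
  have h1 : ∀ α : ℕ → Bool, ∃ c : ι × ℕ, 1 / ((c.2 : ℝ) + 1) < |f c.1 (L (ind (branch α)))| := by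
    intro α
    have h2 : ∃ i, f i (L (ind (branch α))) ≠ 0 := by
      by_contra! h3
      exact hcon _ (infinite_branch α) (hf _ h3)
    obtain ⟨i, hi⟩ := h2
    obtain ⟨k, hk⟩ := exists_nat_one_div_lt (abs_pos.2 hi)
    exact ⟨(i, k), hk⟩
  choose c hc using h1
  -- Otherwise the uncountable set of branches would be a countable union of finite sets; the
  -- contradiction is Cantor's diagonal.
  have h2 : ∃ d, (c ⁻¹' {d}).Infinite := by
    by_contra! h3
    have h4 : (⋃ d, c ⁻¹' {d}).Countable :=
      Set.countable_iUnion fun d => (h3 d).countable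
    have h5 : (⋃ d, c ⁻¹' {d}) = Set.univ := by
      ext α
      simp
    rw [h5, Set.countable_univ_iff] at h4
    obtain ⟨e, he⟩ := exists_surjective_nat (ℕ → Bool)
    obtain ⟨n, hn⟩ := he fun n => !(e n n)
    simpa using congrFun hn n
  obtain ⟨⟨i, k⟩, hd⟩ := h2
  set g : ℓ^∞(ℕ, ℂ) →L[ℝ] ℝ := (f i).comp L with hg
  -- With `m` branches the signed sum `b` satisfies `m / (k + 1) ≤ g b ≤ ‖g‖`, contradicting this
  -- choice.
  obtain ⟨m, hm⟩ := exists_nat_gt (‖g‖ * (k + 1))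
  obtain ⟨s, hs, hsm⟩ := hd.exists_subset_card_eq m
  set D : Set ℕ := ⋃ α ∈ s, ⋃ β ∈ s, ⋃ (_ : α ≠ β), branch α ∩ branch β with hD
  have hDfin : D.Finite := by
    refine Set.Finite.biUnion s.finite_toSet fun α _ => Set.Finite.biUnion s.finite_toSet
      fun β _ => Set.finite_iUnion fun h => finite_branch_inter h
  have hgD : ∀ A, g (ind (A \ D)) = g (ind A) := by
    intro A
    have h3 : L (ind A - ind (A \ D)) = 0 := by
      refine hL _ (hDfin.subset fun n hn => ?_)
      by_contra hnD
      apply hn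
      have : ind A n = ind (A \ D) n := by
        by_cases hA : n ∈ A
        · rw [ind_apply, ind_apply, Set.indicator_of_mem hA,
            Set.indicator_of_mem (show n ∈ A \ D from ⟨hA, hnD⟩)]
        · rw [ind_apply, ind_apply, Set.indicator_of_notMem hA,
            Set.indicator_of_notMem fun h => hA h.1]
      rw [lp.coeFn_sub, Pi.sub_apply, this, sub_self]
    rw [map_sub, sub_eq_zero] at h3
    simp only [hg, ContinuousLinearMap.comp_apply, h3]
  set b : ℓ^∞(ℕ, ℂ) :=
    ∑ α ∈ s, (SignType.sign (g (ind (branch α))) : ℝ) • ind (branch α \ D) with hb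
  have hgb : g b = ∑ α ∈ s, |g (ind (branch α))| := by
    rw [hb, map_sum]
    refine Finset.sum_congr rfl fun α _ => ?_
    rw [map_smul, hgD, smul_eq_mul, sign_mul_self]
  have hbn : ‖b‖ ≤ 1 := by
    refine lp.norm_le_of_forall_le zero_le_one fun n => ?_
    have hbn : b n = ∑ α ∈ s,
        (SignType.sign (g (ind (branch α))) : ℝ) • (branch α \ D).indicator (1 : ℕ → ℂ) n := by
      rw [hb, lp.coeFn_sum, Finset.sum_apply]
      rfl
    rw [hbn]
    by_cases hn : ∃ α ∈ s, n ∈ branch α \ D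
    · obtain ⟨α, hα, hnα⟩ := hn
      rw [Finset.sum_eq_single_of_mem α hα]
      · rw [Set.indicator_of_mem hnα, norm_smul, Pi.one_apply, norm_one, mul_one]
        rcases (SignType.sign (g (ind (branch α)))) with _ | _ | _ <;> simp
      · intro β hβ hne
        rw [Set.indicator_of_notMem, smul_zero]
        intro hnβ
        refine hnα.2 ?_
        simp only [hD, Set.mem_iUnion]
        exact ⟨α, hα, β, hβ, hne.symm, hnα.1, hnβ.1⟩
    · push Not at hn
      rw [Finset.sum_eq_zero fun α hα => by rw [Set.indicator_of_notMem (hn α hα), smul_zero],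
        norm_zero]
      exact zero_le_one
  have h3 : (m : ℝ) * (1 / ((k : ℝ) + 1)) ≤ g b := by
    rw [hgb, ← hsm, ← nsmul_eq_mul]
    refine Finset.card_nsmul_le_sum _ _ _ fun α hα => ?_
    have h4 := hc α
    rw [show c α = (i, k) from hs hα] at h4
    exact h4.le
  have h4 : g b ≤ ‖g‖ := by
    refine (le_abs_self _).trans ((g.le_opNorm b).trans ?_)
    exact mul_le_of_le_one_right (norm_nonneg g) hbn
  rw [mul_one_div, div_le_iff₀ (by positivity)] at h3
  have h5 : (0 : ℝ) < (k : ℝ) + 1 := by positivity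
  nlinarith

end BoundedSeq
end

noncomputable section

/-! ### Non-complementation -/

namespace BanachSub

/-- Treats both ambient sets at once: a projection onto the model of `M` defined on all of `E`
restricts to the model of `N`. Then `e` removes the flip. -/
theorem IsComplementedAt.exists_projection_of_comap {E : Type*} [NormedAddCommGroup E]
    [NormedSpace ℝ E] {M N N' : Set E} {x : E} (hc : IsComplementedAt M N' x) (hx : x ∈ M)
    (hMN : M ⊆ N) (hN : N' = Set.univ ∨ N' = N) (e : E ≃L[ℝ] E)
    {φ : OpenPartialHomeomorph E E} {F G : Submodule ℝ E}
    (h : IsFlattening M N x φ (F.comap (e : E →ₗ[ℝ] E)) (G.comap (e : E →ₗ[ℝ] E))) :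
    ∃ ρ : G →L[ℝ] E, (∀ v, ρ v ∈ F) ∧ ∀ v : G, (v : E) ∈ F → ρ v = v := by
  have key : ∃ π : G.comap (e : E →ₗ[ℝ] E) →L[ℝ] F.comap (e : E →ₗ[ℝ] E),
      ∀ v (hv : v ∈ F.comap (e : E →ₗ[ℝ] E)), π ⟨v, h.le hv⟩ = ⟨v, hv⟩ := by
    rcases hN with rfl | rfl
    · obtain ⟨π, hπ⟩ := hc.closedComplemented hx (Set.subset_univ _) h.univ
      exact ⟨π.comp ((G.comap (e : E →ₗ[ℝ] E)).subtypeL.codRestrict ⊤ fun _ => trivial), hπ⟩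
    · exact hc.closedComplemented hx hMN h
  obtain ⟨π, hπ⟩ := key
  let ι : G →L[ℝ] G.comap (e : E →ₗ[ℝ] E) :=
    ((e.symm : E →L[ℝ] E).comp G.subtypeL).codRestrict _ fun v => by simp
  refine ⟨(e : E →L[ℝ] E).comp ((Submodule.subtypeL _).comp (π.comp ι)), fun v => (π (ι v)).2,
    fun v hv => ?_⟩
  have h1 : e.symm v ∈ F.comap (e : E →ₗ[ℝ] E) := by simpa using hv
  have h2 : π (ι v) = ⟨e.symm v, h1⟩ := hπ _ h1
  change e (π (ι v)) = _
  rw [h2]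
  exact e.apply_symm_apply _

end BanachSub

namespace BoundedSeq

open scoped lp ENNReal

/-- The diagonal operators on `ℓ²`. -/
def diag : ℓ^∞(ℕ, ℂ) →L[ℂ] ℓ²(ℕ, ℂ) →L[ℂ] ℓ²(ℕ, ℂ) :=
  lp.holderL 2 (fun _ => ContinuousLinearMap.mul ℂ ℂ) (K := 1) fun _ => by
    simp

theorem diag_apply (a : ℓ^∞(ℕ, ℂ)) (v : ℓ²(ℕ, ℂ)) (n : ℕ) : diag a v n = a n * v n := rfl

theorem isCompactOperator_diag {a : ℓ^∞(ℕ, ℂ)} (ha : {n | a n ≠ 0}.Finite) :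
    IsCompactOperator (diag a) := by
  set K : Submodule ℂ ℓ²(ℕ, ℂ) :=
    Submodule.span ℂ ((fun n => lp.single 2 n (1 : ℂ)) '' {n | a n ≠ 0}) with hK
  have hfd : FiniteDimensional ℂ K := FiniteDimensional.span_of_finite ℂ (ha.image _)
  have : ProperSpace K := FiniteDimensional.proper ℂ _
  have hmem : ∀ v, diag a v ∈ K := by
    intro v
    have h1 : diag a v = ∑ n ∈ ha.toFinset, (a n * v n) • lp.single 2 n (1 : ℂ) := by
      ext m
      rw [diag_apply, lp.coeFn_sum, Finset.sum_apply]
      by_cases hm : a m = 0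
      · rw [hm, zero_mul, Finset.sum_eq_zero]
        intro n hn
        have : m ≠ n := by
          rintro rfl
          exact (ha.mem_toFinset.1 hn) hm
        simp [lp.single_apply, this]
      · rw [Finset.sum_eq_single_of_mem m (ha.mem_toFinset.2 hm)]
        · simp [lp.single_apply]
        · intro n _ hne
          simp [lp.single_apply, hne.symm]
    rw [h1]
    exact K.sum_mem fun n hn => K.smul_mem _
      (Submodule.subset_span ⟨n, ha.mem_toFinset.1 hn, rfl⟩)
  have h2 : IsCompactOperator ((diag a).codRestrict K hmem) :=
    isCompactOperator_of_locallyCompactSpace_dom _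
  exact h2.clm_comp K.subtypeL

theorem diag_ind_single {A : Set ℕ} {n : ℕ} (hn : n ∈ A) :
    diag (ind A) (lp.single 2 n 1) = lp.single 2 n 1 := by
  ext m
  rw [diag_apply, ind_apply]
  by_cases h : m = n
  · subst h
    rw [Set.indicator_of_mem hn, Pi.one_apply, one_mul]
  · simp [lp.single_apply, h]

end BoundedSeq

namespace CommonCompl

open Topology Filter ProjChart BanachSub BoundedSeq
open scoped lp InnerProductSpace ENNReal

theorem not_isCompactOperator_of_orthonormal {X Y : Type*} [NormedAddCommGroup X]
    [InnerProductSpace ℂ X] [NormedAddCommGroup Y] [InnerProductSpace ℂ Y] (T : X →L[ℂ] Y)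
    {e : ℕ → X} (he : ∀ n, ‖e n‖ ≤ 1) (hT : Orthonormal ℂ fun n => T (e n)) :
    ¬ IsCompactOperator T := by
  intro hc
  obtain ⟨K, hK, hsub⟩ := IsCompactOperator.image_closedBall_subset_compact (f := (T : X →ₗ[ℂ] Y)) hc 1
  have hmem : ∀ n, T (e n) ∈ K := fun n =>
    hsub ⟨e n, mem_closedBall_zero_iff.2 (he n), rfl⟩
  obtain ⟨_, -, σ, hσ, hlim⟩ := hK.tendsto_subseq hmem
  obtain ⟨N, hN⟩ := Metric.cauchySeq_iff'.1 hlim.cauchySeq 1 one_pos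
  have h1 := hN (N + 1) (Nat.le_succ N)
  have hne : σ (N + 1) ≠ σ N := (hσ (Nat.lt_succ_self N)).ne'
  have h2 : ‖T (e (σ (N + 1))) - T (e (σ N))‖ ^ 2 = 2 := by
    rw [@norm_sub_sq ℂ, hT.2 hne, hT.1, hT.1]
    norm_num
  rw [dist_eq_norm] at h1
  simp only [Function.comp_apply] at h1
  have h3 := norm_nonneg (T (e (σ (N + 1))) - T (e (σ N)))
  nlinarith

/-- Countably many functionals separate the points of `B(H) × B(H)`. -/
theorem exists_separating {H : Type*} [NormedAddCommGroup H] [InnerProductSpace ℂ H]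
    [TopologicalSpace.SeparableSpace H] :
    ∃ f : (ℕ × ℕ) × Bool × Bool → ((H →L[ℂ] H) × (H →L[ℂ] H)) →L[ℝ] ℝ,
      ∀ v, (∀ i, f i v = 0) → v = 0 := by
  set d := TopologicalSpace.denseSeq H with hd
  have hdense := TopologicalSpace.denseRange_denseSeq H
  let g : ℕ × ℕ → (H →L[ℂ] H) →L[ℝ] ℂ := fun n =>
    ((innerSL ℂ (d n.1)).comp (ContinuousLinearMap.apply ℂ H (d n.2))).restrictScalars ℝ
  have hgx : ∀ n T, g n T = ⟪d n.1, T (d n.2)⟫_ℂ := fun n T => rfl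
  have hg : ∀ T, (∀ n, g n T = 0) → T = 0 := by
    intro T hT
    have h1 : ∀ j, T (d j) = 0 := by
      intro j
      have h2 : (fun y => ⟪y, T (d j)⟫_ℂ) = fun _ => 0 :=
        hdense.equalizer (by fun_prop) continuous_const (by
          ext i
          exact hT (i, j))
      exact inner_self_eq_zero.1 (congrFun h2 (T (d j)))
    have h3 : (T : H → H) = fun _ => 0 :=
      hdense.equalizer T.continuous continuous_const (by
        ext j
        exact h1 j)
    exact ContinuousLinearMap.ext fun y => congrFun h3 y
  refine ⟨fun i => ((if i.2.1 then Complex.reCLM else Complex.imCLM).comp (g i.1)).comp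
    (if i.2.2 then ContinuousLinearMap.fst ℝ _ _ else ContinuousLinearMap.snd ℝ _ _), ?_⟩
  intro v hv
  refine Prod.ext (hg _ fun n => ?_) (hg _ fun n => ?_)
  · exact Complex.ext (hv (n, true, true)) (hv (n, false, true))
  · exact Complex.ext (hv (n, true, false)) (hv (n, false, false))

variable {H : Type*} [NormedAddCommGroup H] [InnerProductSpace ℂ H] [CompleteSpace H]

/-- Infinite rank of the first projection and infinite corank of the second make room for diagonal
operators from ran p to the orthogonal complement of ran q. The difference between identity and `π`
on them vanishes on finite support, so some infinite indicator gives a compact operator that carries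
an orthonormal sequence to an orthonormal one. -/
theorem not_exists_projection [TopologicalSpace.SeparableSpace H]
    {x : (H →L[ℂ] H) × (H →L[ℂ] H)} (hx : x ∈ GamInfInf H)
    (hc : IsCompactOperator ((1 - x.2) * x.1 : H →L[ℂ] H))
    (π : (corner x.1).prod (corner x.2) →L[ℝ] (H →L[ℂ] H) × (H →L[ℂ] H))
    (hπ : ∀ v, π v ∈ idealCorner x.1 x.2 (compacts H))
    (hπ' : ∀ v : (corner x.1).prod (corner x.2), (v : (H →L[ℂ] H) × (H →L[ℂ] H)) ∈ idealCorner x.1 x.2 (compacts H) →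
      π v = (v : (H →L[ℂ] H) × (H →L[ℂ] H))) : False := by
  obtain ⟨p, q⟩ := x
  obtain ⟨⟨⟨hp, hq⟩, -⟩, ⟨-, hdp, -⟩, ⟨-, -, hdq⟩⟩ := hx
  simp only at hp hq hc hdp hdq hπ hπ'
  have := hp.completeSpace_range
  obtain ⟨b⟩ := nonempty_hilbertBasis_nat p.range (dim_eq_top_iff.1 hdp)
  obtain ⟨c⟩ := nonempty_hilbertBasis_nat q.rangeᗮ (dim_eq_top_iff.1 hdq)
  let R : H →L[ℂ] ℓ²(ℕ, ℂ) := (b.repr.toContinuousLinearEquiv : p.range →L[ℂ] ℓ²(ℕ, ℂ)).comp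
    (p.codRestrict p.range fun y => ⟨y, rfl⟩)
  let V : ℓ²(ℕ, ℂ) →L[ℂ] H := q.rangeᗮ.subtypeL.comp
    (c.repr.symm.toContinuousLinearEquiv : ℓ²(ℕ, ℂ) →L[ℂ] q.rangeᗮ)
  have hR : ∀ n, R (b n) = lp.single 2 n 1 := by
    intro n
    have h1 : p.codRestrict p.range (fun y => ⟨y, rfl⟩) (b n) = b n :=
      Subtype.ext (hp.mem_range_iff.1 (b n).2)
    change b.repr (p.codRestrict p.range _ (b n)) = _
    rw [h1, b.repr_self]
  have hRp : R.comp p = R := by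
    ext1 y
    refine congrArg b.repr (Subtype.ext ?_)
    exact hp.apply_apply y
  have hV : ∀ n, V (lp.single 2 n 1) = c n := by
    intro n
    change ((c.repr.symm (lp.single 2 n 1) : q.rangeᗮ) : H) = _
    rw [c.repr_symm_single]
  have hqV : ∀ y, q (V y) = 0 := fun y => hq.mem_orthogonal_iff.1 (c.repr.symm y).2
  let X : ℓ^∞(ℕ, ℂ) → H →L[ℂ] H := fun a => V.comp ((diag a).comp R)
  let w : ℓ^∞(ℕ, ℂ) →L[ℂ] H →L[ℂ] H :=
    ((ContinuousLinearMap.compL ℂ H ℓ²(ℕ, ℂ) H).flip R).comp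
      ((ContinuousLinearMap.compL ℂ ℓ²(ℕ, ℂ) ℓ²(ℕ, ℂ) H ((1 - p).comp V)).comp diag)
  have hw : ∀ a, w a = (1 - p) * X a := fun _ => rfl
  have hXp : ∀ a, X a * p = X a := fun a => by
    change V.comp ((diag a).comp (R.comp p)) = _
    rw [hRp]
  have hqX : ∀ a, (1 - q) * X a = X a := fun a => by
    ext1 y
    change X a y - q (V _) = _
    rw [hqV, sub_zero]
  have hmem : ∀ a, ((w.restrictScalars ℝ).prod (0 : ℓ^∞(ℕ, ℂ) →L[ℝ] H →L[ℂ] H)) a ∈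
      (corner p).prod (corner q) := by
    intro a
    refine ⟨?_, (corner q).zero_mem⟩
    have := compress_mem_corner hp.isIdempotentElem (X a)
    rwa [mul_assoc, hXp] at this
  let W : ℓ^∞(ℕ, ℂ) →L[ℝ] (corner p).prod (corner q) :=
    ((w.restrictScalars ℝ).prod (0 : ℓ^∞(ℕ, ℂ) →L[ℝ] H →L[ℂ] H)).codRestrict _ hmem
  -- Compressing `X a` into the corner of `p` costs only `(1 - q) p X a` after multiplication by `1
  -- - q`, and this is compact by hypothesis.
  have hW : ∀ a, (W a : (H →L[ℂ] H) × (H →L[ℂ] H)) ∈ idealCorner p q (compacts H) ↔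
      IsCompactOperator (X a) := by
    intro a
    have h1 : (1 - q) * w a = X a - ((1 - q) * p) * X a := by
      rw [hw, sub_mul 1 p, one_mul, mul_sub, hqX, mul_assoc (1 - q) p]
    have h2 : ((1 - q) * p) * X a ∈ compacts H := hc.comp_clm (X a)
    rw [mem_idealCorner]
    refine (and_iff_right (hmem a)).trans ?_
    change (1 - q) * w a ∈ compacts H ↔ X a ∈ compacts H
    rw [h1]
    exact (compacts H).sub_mem_iff_left h2
  obtain ⟨f, hf⟩ := exists_separating (H := H)
  obtain ⟨A, hA, hA0⟩ := exists_infinite_apply_ind_eq_zero f hf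
    (((corner p).prod (corner q)).subtypeL.comp W - π.comp W) fun a ha => by
      have h1 : IsCompactOperator (X a) :=
        IsCompactOperator.clm_comp ((isCompactOperator_diag ha).comp_clm R) V
      exact sub_eq_zero.2 (hπ' _ ((hW a).2 h1)).symm
  have h1 : (W (ind A) : (H →L[ℂ] H) × (H →L[ℂ] H)) = π (W (ind A)) := sub_eq_zero.1 hA0
  have h2 : IsCompactOperator (X (ind A)) := by
    rw [← hW, h1]
    exact hπ _
  let σ := hA.natEmbedding
  refine not_isCompactOperator_of_orthonormal (X (ind A)) (e := fun n => (b (σ n) : H))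
    (fun n => (b.orthonormal.1 (σ n)).le) ?_ h2
  have h3 : (fun n => X (ind A) (b (σ n))) = fun n => q.rangeᗮ.subtypeₗᵢ (c (σ n)) := by
    ext1 n
    change V (diag (ind A) (R (b (σ n)))) = c (σ n)
    rw [hR, diag_ind_single (σ n).2, hV]
  rw [h3]
  exact (c.orthonormal.comp_linearIsometry q.rangeᗮ.subtypeₗᵢ).comp (fun n => (σ n : ℕ))
    (Subtype.val_injective.comp σ.injective)

/-- `Γ` is not complemented at any point of `Γ_{∞,∞}`. -/
theorem not_isComplementedAt_gam [TopologicalSpace.SeparableSpace H]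
    {N : Set ((H →L[ℂ] H) × (H →L[ℂ] H))} (hN : N = Set.univ ∨ N = projPairs H)
    {x : (H →L[ℂ] H) × (H →L[ℂ] H)} (hx : x ∈ GamInfInf H) :
    ¬ IsComplementedAt (Gam H) N x := by
  intro hcomp
  obtain ⟨e, y, hy, hc, φ, hφ⟩ := exists_isFlattening_gamInfInf hx
  obtain ⟨ρ, h1, h2⟩ := hcomp.exists_projection_of_comap hx.1 (fun z hz => hz.1) hN e hφ
  exact not_exists_projection hy hc ρ h1 h2

theorem not_isComplementedAt_piece [TopologicalSpace.SeparableSpace H]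
    {N : Set ((H →L[ℂ] H) × (H →L[ℂ] H))} (hN : N = Set.univ ∨ N = projPairs H) (a : PieceIndex)
    {x : (H →L[ℂ] H) × (H →L[ℂ] H)} (hx : x ∈ GamInfInf H) (hxa : x ∈ piece H a) :
    ¬ IsComplementedAt (Gam H) N x ∧ ¬ IsComplementedAt (piece H a) N x := by
  refine ⟨not_isComplementedAt_gam hN hx, fun h => not_isComplementedAt_gam hN hx ?_⟩
  obtain ⟨U, hU, h'⟩ := exists_isOpen_piece_eq (H := H) a
  rw [h'] at hxa h
  exact h.congr hU hxa.2 fun y hy => ⟨fun h => ⟨h, hy⟩, fun h => h.1⟩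

end CommonCompl
end

noncomputable section

/-! ### A pair of coordinate subspaces without common complement -/

namespace CommonCompl

open BoundedSeq
open scoped lp InnerProductSpace ENNReal

variable {H : Type*} [NormedAddCommGroup H] [InnerProductSpace ℂ H]

/-- The projection onto the closed span of the basis vectors with index in `A`. -/
def coordProj (b : HilbertBasis ℕ ℂ H) (A : Set ℕ) : H →L[ℂ] H :=
  (b.repr.symm.toContinuousLinearEquiv : ℓ²(ℕ, ℂ) →L[ℂ] H).comp
    ((diag (ind A)).comp (b.repr.toContinuousLinearEquiv : H →L[ℂ] ℓ²(ℕ, ℂ)))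

theorem repr_coordProj (b : HilbertBasis ℕ ℂ H) (A : Set ℕ) (x : H) :
    b.repr (coordProj b A x) = diag (ind A) (b.repr x) :=
  b.repr.apply_symm_apply _

theorem coordProj_coordProj (b : HilbertBasis ℕ ℂ H) {A B : Set ℕ} (h : A ⊆ B) (x : H) :
    coordProj b B (coordProj b A x) = coordProj b A x := by
  apply b.repr.injective
  rw [repr_coordProj, repr_coordProj]
  ext n
  rw [diag_apply, diag_apply, ind_apply, ind_apply]
  by_cases hn : n ∈ A
  · rw [Set.indicator_of_mem (h hn), Pi.one_apply, one_mul]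
  · rw [Set.indicator_of_notMem hn, zero_mul, mul_zero]

theorem coordProj_of_mem (b : HilbertBasis ℕ ℂ H) {A : Set ℕ} {n : ℕ} (hn : n ∈ A) :
    coordProj b A (b n) = b n := by
  apply b.repr.injective
  rw [repr_coordProj, b.repr_self, diag_ind_single hn]

theorem coordProj_of_notMem (b : HilbertBasis ℕ ℂ H) {A : Set ℕ} {n : ℕ} (hn : n ∉ A) :
    coordProj b A (b n) = 0 := by
  apply b.repr.injective
  rw [repr_coordProj, b.repr_self, map_zero]
  ext m
  rw [diag_apply, ind_apply]
  by_cases h : m = n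
  · subst h
    rw [Set.indicator_of_notMem hn, zero_mul]
    rfl
  · simp [lp.single_apply, h]

theorem isStarProjection_coordProj [CompleteSpace H] (b : HilbertBasis ℕ ℂ H) (A : Set ℕ) :
    IsStarProjection (coordProj b A) := by
  refine ⟨ContinuousLinearMap.ext fun x => coordProj_coordProj b subset_rfl x, ?_⟩
  rw [ContinuousLinearMap.isSelfAdjoint_iff_isSymmetric]
  intro x y
  change ⟪coordProj b A x, y⟫_ℂ = ⟪x, coordProj b A y⟫_ℂ
  rw [← b.repr.inner_map_map, ← b.repr.inner_map_map x, repr_coordProj, repr_coordProj,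
    lp.inner_eq_tsum, lp.inner_eq_tsum]
  refine tsum_congr fun n => ?_
  rw [diag_apply, diag_apply, ind_apply]
  by_cases hn : n ∈ A
  · rw [Set.indicator_of_mem hn, Pi.one_apply, one_mul, one_mul]
  · rw [Set.indicator_of_notMem hn, zero_mul, zero_mul, inner_zero_left, inner_zero_right]

theorem dim_eq_top_of_infinite (b : HilbertBasis ℕ ℂ H) {A : Set ℕ} (hA : A.Infinite)
    {S : Submodule ℂ H} (hS : ∀ n ∈ A, b n ∈ S) : dim S = ⊤ := by
  rw [dim_eq_top_iff]
  intro hfin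
  have hli : LinearIndependent ℂ fun n : A => (⟨b n, hS n n.2⟩ : S) :=
    LinearIndependent.of_comp S.subtype
      (b.orthonormal.linearIndependent.comp (fun n : A => (n : ℕ)) Subtype.val_injective)
  have := hli.finite
  exact hA (Set.toFinite A)

theorem coordProj_mem_projOfRank [CompleteSpace H] (b : HilbertBasis ℕ ℂ H) {A : Set ℕ}
    (hA : A.Infinite) (hA' : Aᶜ.Infinite) : coordProj b A ∈ projOfRank H ⊤ ⊤ := by
  have h := isStarProjection_coordProj b A
  exact ⟨h, dim_eq_top_of_infinite b hA fun n hn => h.mem_range_iff.2 (coordProj_of_mem b hn),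
    dim_eq_top_of_infinite b hA' fun n hn =>
      h.mem_orthogonal_iff.2 (coordProj_of_notMem b hn)⟩

/-- By modularity, nested subspaces with the same complement coincide. -/
theorem not_hasCommonComplement_of_lt {S T : Submodule ℂ H} (h : T < S) :
    ¬ HasCommonComplement S T := by
  rintro ⟨Z, -, hS, hT⟩
  refine h.ne (eq_of_le_of_inf_le_of_sup_le h.le (z := Z) ?_ ?_)
  · rw [hS.inf_eq_bot]
    exact bot_le
  · rw [hT.sup_eq_top]
    exact le_top

theorem gamInfInf_nonempty [CompleteSpace H] [TopologicalSpace.SeparableSpace H]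
    (h : ¬ FiniteDimensional ℂ H) : (GamInfInf H).Nonempty := by
  obtain ⟨b⟩ := nonempty_hilbertBasis_nat H h
  -- Removing one index from an infinite, co-infinite set gives a proper inclusion while all ranks
  -- and coranks stay infinite.
  set A : Set ℕ := {n | Even n} with hA
  set B : Set ℕ := A \ {0} with hB
  have hAi : A.Infinite := Set.infinite_of_injective_forall_mem (f := fun n => 2 * n)
    (fun m n hmn => by simpa using hmn) fun n => even_two_mul n
  have hAc : Aᶜ.Infinite := Set.infinite_of_injective_forall_mem (f := fun n => 2 * n + 1)
    (fun m n hmn => by simpa using hmn) fun n => Nat.not_even_two_mul_add_one n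
  have hBA : B ⊆ A := Set.sdiff_subset
  have hBi : B.Infinite := hAi.sdiff (Set.finite_singleton 0)
  have hBc : Bᶜ.Infinite := hAc.mono (Set.compl_subset_compl.2 hBA)
  have hPA := isStarProjection_coordProj b A
  have hPB := isStarProjection_coordProj b B
  refine ⟨(coordProj b A, coordProj b B), ⟨⟨hPA, hPB⟩, not_hasCommonComplement_of_lt ?_⟩,
    coordProj_mem_projOfRank b hAi hAc, coordProj_mem_projOfRank b hBi hBc⟩
  refine SetLike.lt_iff_le_and_exists.2 ⟨?_, b 0, ?_, ?_⟩
  · rintro _ ⟨x, rfl⟩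
    exact hPA.mem_range_iff.2 (coordProj_coordProj b hBA x)
  · exact hPA.mem_range_iff.2 (coordProj_of_mem b Even.zero)
  · intro h0
    have h1 := hPB.mem_range_iff.1 h0
    rw [coordProj_of_notMem b fun h => h.2 rfl] at h1
    have h2 := b.orthonormal.1 0
    rw [← h1, norm_zero] at h2
    exact zero_ne_one h2

end CommonCompl
end



theorem mainTheorem4 (H : Type*) [NormedAddCommGroup H] [InnerProductSpace ℂ H] [CompleteSpace H]
    [TopologicalSpace.SeparableSpace H] :
    -- `Γ` is closed in `B(H) × B(H)`
    IsClosed (CommonCompl.Gam H) ∧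
    -- `Γ` is the disjoint union of its pieces, each of which is relatively open in `Γ`
    CommonCompl.Gam H = (⋃ a, CommonCompl.piece H a) ∧
    Pairwise (fun a b => Disjoint (CommonCompl.piece H a) (CommonCompl.piece H b)) ∧
    (∀ a, ∃ U : Set ((H →L[ℂ] H) × (H →L[ℂ] H)), IsOpen U ∧
      CommonCompl.piece H a = CommonCompl.Gam H ∩ U) ∧
    -- both in `B(H) × B(H)` and in `P(H) × P(H)`:
    (∀ N ∈ ({Set.univ, CommonCompl.projPairs H} : Set (Set ((H →L[ℂ] H) × (H →L[ℂ] H)))),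
      -- `Γ` and each of its pieces are `C^∞` submanifolds
      BanachSub.IsSubmanifoldOf (CommonCompl.Gam H) N ∧
      (∀ a, BanachSub.IsSubmanifoldOf (CommonCompl.piece H a) N) ∧
      -- which are not complemented at any point of the pieces `Γ_1^n`, `Γ_∞^l`, `Γ_∞^r`
      (∀ n : ℤ, n ≠ 0 → ∀ x ∈ CommonCompl.Gam1n H n,
        ¬ BanachSub.IsComplementedAt (CommonCompl.Gam H) N x ∧
        ¬ BanachSub.IsComplementedAt (CommonCompl.Gam1n H n) N x) ∧
      (∀ x ∈ CommonCompl.GamInfL H,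
        ¬ BanachSub.IsComplementedAt (CommonCompl.Gam H) N x ∧
        ¬ BanachSub.IsComplementedAt (CommonCompl.GamInfL H) N x) ∧
      (∀ x ∈ CommonCompl.GamInfR H,
        ¬ BanachSub.IsComplementedAt (CommonCompl.Gam H) N x ∧
        ¬ BanachSub.IsComplementedAt (CommonCompl.GamInfR H) N x) ∧
      -- so that `Γ` is not a complemented submanifold if `H` is infinite-dimensional
      (¬ FiniteDimensional ℂ H →
        ∃ x ∈ CommonCompl.Gam H, ¬ BanachSub.IsComplementedAt (CommonCompl.Gam H) N x)) := by
  refine ⟨CommonCompl.isClosed_gam, CommonCompl.gam_eq_iUnion, CommonCompl.pairwise_disjoint_piece,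
    CommonCompl.exists_isOpen_piece_eq, fun N hN => ?_⟩
  refine ⟨CommonCompl.isSubmanifoldOf_gam hN, CommonCompl.isSubmanifoldOf_piece hN, ?_, ?_, ?_, ?_⟩
  · exact fun n hn x hx => CommonCompl.not_isComplementedAt_piece hN (.fredholm n hn) hx.1.1 hx
  · exact fun x hx => CommonCompl.not_isComplementedAt_piece hN .left hx.1 hx
  · exact fun x hx => CommonCompl.not_isComplementedAt_piece hN .right hx.1 hx
  · intro h
    obtain ⟨x, hx⟩ := CommonCompl.gamInfInf_nonempty h
    exact ⟨x, hx.1, CommonCompl.not_isComplementedAt_gam hN hx⟩
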